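/- Trees are finite, rooted and non-plane (the subtrees of a vertex are unordered); a tree is regarded as a poset on its vertices whose maximum is the root. A binary tree is a tree in which every vertex has $0$ or $2$ children, and $\mathcal V_n$ is the set of (isomorphism classes of) binary trees with $n$ vertices. An embedding of a tree $S$ into a tree $T$ is a subposet of $T$ isomorphic to $S$, where two subposets that are mapped onto each other by an automorphism of $T$ count as the same embedding; it is good if it contains the root of $T$. Let $a_T(S)$ and $g_T(S)$ be the numbers of embeddings and of good embeddings of $S$ into $T$, and put $a_{\mathcal V_n}(S)=\sum_{T\in\mathcal V_n}a_T(S)$ and $g_{\mathcal V_n}(S)=\sum_{T\in\mathcal V_n}g_T(S)$. For a tree $S$ let $\mathcal M_S$ be the set of (isomorphism classes of) non-plane unary-binary trees obtained from $S$ by replacing each vertex with $d\ge 3$ children by a non-plane binary tree with $d$ leaves, at which the $d$ subtrees are attached; the root of this binary tree is the original vertex, and its $d-2$ other internal vertices are marked as auxiliary (isomorphisms preserve the marks). A symmetry vertex of $t\in\mathcal M_S$ is a vertex with two children whose subtrees are isomorphic. Put $$C_S=\sum_{t\in\mathcal M_S}\left(\tfrac12\right)^{s(t)},\qquad s(t)=\text{number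 of symmetry vertices of }t .$$ Let $V(z)=\sum_{n}|\mathcal V_n|z^n$, let $\rho$ be its radius of convergence, and let $b$ be the constant with $$V(z)=\frac1\rho-b\sqrt{1-\frac z\rho}+o\!\left(\sqrt{1-\frac z\rho}\right)\qquad(z\to\rho^-).$$ **Theorem.** These constants exist, and $\rho\approx 0.6346$, $b\approx 2.5184$ (correct to four decimals). For every tree $S$ with $m$ vertices and $l$ leaves, as $n\to\infty$ through the odd integers, $$a_{\mathcal V_n}(S)\sim\frac{2C_S\,b^{-m-l+1}\rho^{-m-l}}{\Gamma\left(\frac{m+l-1}{2}\right)}\,\rho^{-n}\,n^{\frac{m+l-3}{2}},$$ $$g_{\mathcal V_n}(S)\sim\begin{cases}\dfrac{2C_S\,b^{-m-l+2}\rho^{-m-l+1}}{\Gamma\left(\frac{m+l-2}{2}\right)}\,\rho^{-n}\,n^{\frac{m+l-4}{2}}&\text{if }m+l-2>0,\\[2ex]\dfrac{b}{\sqrt\pi}\,\rho^{-n}\,n^{-3/2}&\text{if }m+l-2=0,\end{cases}$$ and $a_{\mathcal V_n}(S)=g_{\mathcal V_n}(S)=0$ for every even $n$. -/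

import Mathlib

open Filter Topology Asymptotics

/-- Rooted trees: a root together with a finite family of subtrees. A term is a plane
representative; all notions below see it only up to reordering of the subtrees. -/
inductive RTree : Type
  | node (d : ℕ) (c : Fin d → RTree) : RTree

namespace RTree

/-- The vertices of a rooted tree: the root (`⊤`) and the vertices of the subtrees. -/
def Vertex : RTree → Type
  | node _ c => WithTop (Σ i, Vertex (c i))

/-- The tree as a poset whose maximum is the root: `v ≤ w` iff `w` lies on the path from the
root to `v`. (Vertices of different subtrees are incomparable.) -/
@[reducible]
def vertexOrder : (t : RTree) → PartialOrder t.Vertex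
  | node _ c =>
    letI : ∀ i, PartialOrder (c i).Vertex := fun i => vertexOrder (c i)
    inferInstanceAs (PartialOrder (WithTop (Σ i, (c i).Vertex)))

instance (t : RTree) : PartialOrder t.Vertex := vertexOrder t

/-- The root of a tree, as a vertex. -/
def root : (t : RTree) → t.Vertex
  | node _ c => (⊤ : WithTop (Σ i, Vertex (c i)))

/-- The number of vertices. -/
def size : RTree → ℕ
  | node _ c => 1 + ∑ i, size (c i)

/-- The number of leaves (vertices of out-degree `0`). -/
def leaves : RTree → ℕ
  | node d c => if d = 0 then 1 else ∑ i, leaves (c i)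

/-- Every vertex has out-degree `0` or `2`. -/
def IsBinary : RTree → Prop
  | node d c => (d = 0 ∨ d = 2) ∧ ∀ i, IsBinary (c i)

/-- Isomorphism of non-plane rooted trees: isomorphism of the associated posets. -/
def Iso (s t : RTree) : Prop := Nonempty (s.Vertex ≃o t.Vertex)

theorem le_root : ∀ (t : RTree) (v : t.Vertex), v ≤ t.root
  | node _ c => fun v =>
    letI : ∀ i, PartialOrder (c i).Vertex := fun i => vertexOrder (c i)
    (le_top : (show WithTop (Σ i, (c i).Vertex) from v) ≤ ⊤)

theorem map_root {s t : RTree} (f : s.Vertex ≃o t.Vertex) : f s.root = t.root := by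
  apply le_antisymm (le_root t _)
  exact (f.symm_apply_le).1 (le_root s _)

theorem finite_vertex : ∀ t : RTree, Finite t.Vertex
  | node _ c => by
    have : ∀ i, Finite (c i).Vertex := fun i => finite_vertex (c i)
    exact inferInstanceAs (Finite (Option (Σ i, (c i).Vertex)))

theorem card_vertex : ∀ t : RTree, Nat.card t.Vertex = t.size
  | node _ c => by
    have : ∀ i, Finite (c i).Vertex := fun i => finite_vertex (c i)
    have h : Nat.card (Option (Σ i, (c i).Vertex)) = 1 + ∑ i, (c i).size := by
      rw [Finite.card_option, Nat.card_sigma, add_comm]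
      simp only [card_vertex]
    exact h

theorem Iso.size_eq {s t : RTree} (h : s.Iso t) : s.size = t.size := by
  obtain ⟨f⟩ := h
  rw [← card_vertex, ← card_vertex]
  exact Nat.card_congr f.toEquiv

theorem finite_size_le (n : ℕ) : {t : RTree | t.size ≤ n}.Finite := by
  induction n with
  | zero =>
    apply Set.Finite.subset Set.finite_empty
    rintro ⟨d, c⟩ h
    simp [size] at h
  | succ n ih =>
    have hfin : (⋃ d ∈ Finset.range (n + 1),
        (fun c : Fin d → RTree => node d c) '' Set.pi Set.univ
          (fun _ => {t : RTree | t.size ≤ n})).Finite := by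
      apply Set.Finite.biUnion (Finset.finite_toSet _)
      intro d _
      exact (Set.Finite.pi (fun _ => ih)).image _
    refine hfin.subset ?_
    rintro ⟨d, c⟩ h
    have h' : ∑ i, (c i).size ≤ n := by
      have : 1 + ∑ i, (c i).size ≤ n + 1 := h
      omega
    have hpos : ∀ t : RTree, 1 ≤ t.size := by
      rintro ⟨d, c⟩
      simp [size]
    have hd : d ≤ n := by
      calc d = ∑ _i : Fin d, 1 := by simp
        _ ≤ ∑ i, (c i).size := Finset.sum_le_sum (fun i _ => hpos _)
        _ ≤ n := h'
    simp only [Set.mem_iUnion]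
    refine ⟨d, by simp; omega, c, ?_, rfl⟩
    intro i _
    exact (Finset.single_le_sum (f := fun i => (c i).size) (fun _ _ => Nat.zero_le _)
      (Finset.mem_univ i)).trans h'

/-- The subposets of `T` (given by their vertex sets) that are isomorphic to `S`. -/
def Copy (S T : RTree) : Type := {E : Set T.Vertex // Nonempty (S.Vertex ≃o E)}

/-- Two copies of `S` in the non-plane tree `T` are the same embedding if an automorphism of `T`
maps one onto the other. -/
def copySetoid (S T : RTree) : Setoid (Copy S T) where
  r E F := ∃ f : T.Vertex ≃o T.Vertex, f '' E.1 = F.1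
  iseqv :=
    { refl := fun E => ⟨OrderIso.refl _, by simp⟩
      symm := by
        rintro E F ⟨f, hf⟩
        refine ⟨f.symm, ?_⟩
        rw [← hf, ← Set.image_comp]
        simp
      trans := by
        rintro E F G ⟨f, hf⟩ ⟨g, hg⟩
        refine ⟨f.trans g, ?_⟩
        rw [← hg, ← hf, ← Set.image_comp]
        rfl }

/-- Embeddings of the non-plane tree `S` into the non-plane tree `T`. -/
def Embedding (S T : RTree) : Type := Quotient (copySetoid S T)

/-- An embedding is good if it contains the root of `T`. -/
def Embedding.IsGood {S T : RTree} (e : Embedding S T) : Prop :=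
  Quotient.liftOn e (fun E => T.root ∈ E.1) (by
    rintro E F ⟨f, hf⟩
    apply propext
    rw [← hf]
    constructor
    · intro h
      exact ⟨_, h, map_root f⟩
    · rintro ⟨x, hx, hfx⟩
      rw [← map_root f] at hfx
      rwa [← f.injective hfx])

/-- `a_T(S)`: the number of embeddings of `S` into `T`. -/
noncomputable def numEmb (S T : RTree) : ℕ := Nat.card (Embedding S T)

/-- `g_T(S)`: the number of good embeddings of `S` into `T`. -/
noncomputable def numGoodEmb (S T : RTree) : ℕ := Nat.card {e : Embedding S T // e.IsGood}

/-- Transport of copies along an isomorphism of the host trees. -/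
def copyCongr (S : RTree) {T T' : RTree} (f : T.Vertex ≃o T'.Vertex) : Copy S T ≃ Copy S T' where
  toFun E := ⟨f '' E.1, E.2.map fun φ => φ.trans
    { toEquiv := f.toEquiv.image E.1, map_rel_iff' := fun {a b} => f.le_iff_le (x := a.1) }⟩
  invFun E := ⟨f.symm '' E.1, E.2.map fun φ => φ.trans
    { toEquiv := f.symm.toEquiv.image E.1, map_rel_iff' := fun {a b} => f.symm.le_iff_le (x := a.1) }⟩
  left_inv E := by
    apply Subtype.ext
    simp [← Set.image_comp]
  right_inv E := by
    apply Subtype.ext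
    simp [← Set.image_comp]

/-- Transport of embeddings along an isomorphism of the host trees. -/
def embCongr (S : RTree) {T T' : RTree} (f : T.Vertex ≃o T'.Vertex) :
    Embedding S T ≃ Embedding S T' :=
  Quotient.congr (copyCongr S f) (by
    intro E F
    constructor
    · rintro ⟨g, hg⟩
      refine ⟨(f.symm.trans g).trans f, ?_⟩
      change _ '' (f '' E.1) = f '' F.1
      rw [← hg, ← Set.image_comp, ← Set.image_comp]
      apply Set.image_congr
      intro x _
      simp
    · rintro ⟨g, hg⟩
      refine ⟨(f.trans g).trans f.symm, ?_⟩
      change g '' (f '' E.1) = f '' F.1 at hg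
      have h2 : f.symm '' (g '' (f '' E.1)) = F.1 := by
        rw [hg, ← Set.image_comp]
        simp
      rw [← h2, ← Set.image_comp, ← Set.image_comp]
      rfl)

theorem embCongr_isGood (S : RTree) {T T' : RTree} (f : T.Vertex ≃o T'.Vertex)
    (e : Embedding S T) : e.IsGood ↔ (embCongr S f e).IsGood := by
  induction e using Quotient.inductionOn with
  | h E =>
    change T.root ∈ E.1 ↔ T'.root ∈ f '' E.1
    rw [← map_root f]
    exact (f.injective.mem_set_image).symm

theorem numEmb_congr (S : RTree) {T T' : RTree} (h : T.Iso T') : numEmb S T = numEmb S T' := by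
  obtain ⟨f⟩ := h
  exact Nat.card_congr (embCongr S f)

theorem numGoodEmb_congr (S : RTree) {T T' : RTree} (h : T.Iso T') :
    numGoodEmb S T = numGoodEmb S T' := by
  obtain ⟨f⟩ := h
  exact Nat.card_congr ((embCongr S f).subtypeEquiv (embCongr_isGood S f))

/-- Isomorphism on the binary trees with `n` vertices. -/
def binarySetoid (n : ℕ) : Setoid {T : RTree // T.IsBinary ∧ T.size = n} where
  r T T' := T.1.Iso T'.1
  iseqv :=
    { refl := fun _ => ⟨OrderIso.refl _⟩
      symm := fun ⟨f⟩ => ⟨f.symm⟩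
      trans := fun ⟨f⟩ ⟨g⟩ => ⟨f.trans g⟩ }

/-- `𝒱ₙ`: the non-plane binary trees with `n` vertices. -/
def NonPlaneBinary (n : ℕ) : Type := Quotient (binarySetoid n)

instance (n : ℕ) : Finite (NonPlaneBinary n) := by
  have : Finite {T : RTree // T.IsBinary ∧ T.size = n} :=
    ((finite_size_le n).subset (fun _ h => h.2.le) : {T : RTree | T.IsBinary ∧ T.size = n}.Finite)
  exact Quotient.finite _

noncomputable instance (n : ℕ) : Fintype (NonPlaneBinary n) := Fintype.ofFinite _

/-- `a_{𝒱ₙ}(S)`: the number of embeddings of `S` into all members of `𝒱ₙ`. -/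
noncomputable def totalEmb (n : ℕ) (S : RTree) : ℕ :=
  ∑ T : NonPlaneBinary n,
    Quotient.liftOn T (fun T => numEmb S T.1) (fun _ _ h => numEmb_congr S h)

/-- `g_{𝒱ₙ}(S)`: the number of good embeddings of `S` into all members of `𝒱ₙ`. -/
noncomputable def totalGoodEmb (n : ℕ) (S : RTree) : ℕ :=
  ∑ T : NonPlaneBinary n,
    Quotient.liftOn T (fun T => numGoodEmb S T.1) (fun _ _ h => numGoodEmb_congr S h)

/-- `|𝒱ₙ|`. -/
noncomputable def numBinary (n : ℕ) : ℕ := Fintype.card (NonPlaneBinary n)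

/-- The tree whose root has the given list of subtrees. -/
def ofList (F : List RTree) : RTree := node F.length F.get

end RTree

/-- Unary-binary trees (plane representatives) in which some of the binary vertices are
distinguished as auxiliary vertices (`aux = true`). -/
inductive UBTree : Type
  | leaf : UBTree
  | unary (t : UBTree) : UBTree
  | binary (aux : Bool) (l r : UBTree) : UBTree

namespace UBTree

/-- Isomorphism of non-plane unary-binary trees with auxiliary vertices. -/
inductive Iso : UBTree → UBTree → Prop
  | leaf : Iso leaf leaf
  | unary {s t : UBTree} : Iso s t → Iso (unary s) (unary t)
  | binary {x : Bool} {l r l' r' : UBTree} :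
      Iso l l' → Iso r r' → Iso (binary x l r) (binary x l' r')
  | swap {x : Bool} {l r l' r' : UBTree} :
      Iso l r' → Iso r l' → Iso (binary x l r) (binary x l' r')

theorem Iso.refl : ∀ t : UBTree, Iso t t
  | .leaf => .leaf
  | .unary t => .unary (Iso.refl t)
  | .binary _ l r => .binary (Iso.refl l) (Iso.refl r)

theorem Iso.symm {s t : UBTree} (h : Iso s t) : Iso t s := by
  induction h with
  | leaf => exact .leaf
  | unary _ ih => exact .unary ih
  | binary _ _ ih1 ih2 => exact .binary ih1 ih2
  | swap _ _ ih1 ih2 => exact .swap ih2 ih1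

theorem Iso.trans {s t u : UBTree} (h : Iso s t) (h' : Iso t u) : Iso s u := by
  induction h generalizing u with
  | leaf => exact h'
  | unary _ ih => cases h' with | unary h => exact .unary (ih h)
  | binary _ _ ih1 ih2 =>
    cases h' with
    | binary a b => exact .binary (ih1 a) (ih2 b)
    | swap a b => exact .swap (ih1 a) (ih2 b)
  | swap _ _ ih1 ih2 =>
    cases h' with
    | binary a b => exact .swap (ih1 b) (ih2 a)
    | swap a b => exact .binary (ih1 b) (ih2 a)

open Classical in
/-- The number of symmetry vertices, i.e. parents of two isomorphic subtrees. -/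
noncomputable def sym : UBTree → ℕ
  | leaf => 0
  | unary t => sym t
  | binary _ l r => sym l + sym r + if Iso l r then 1 else 0

theorem sym_congr {s t : UBTree} (h : Iso s t) : sym s = sym t := by
  induction h with
  | leaf => rfl
  | unary _ ih => exact ih
  | binary h1 h2 ih1 ih2 =>
    simp only [sym, ih1, ih2]
    congr 2
    exact propext ⟨fun h => (h1.symm.trans h).trans h2, fun h => (h1.trans h).trans h2.symm⟩
  | swap h1 h2 ih1 ih2 =>
    simp only [sym, ih1, ih2]
    rw [add_comm (sym _) (sym _)]
    congr 2
    exact propext ⟨fun h => (h2.symm.trans h.symm).trans h1,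
      fun h => (h1.trans h.symm).trans h2.symm⟩

/-- `Refines t F`: contracting every auxiliary vertex of `t` that lies below a non-auxiliary vertex
into its nearest non-auxiliary ancestor, and deleting the auxiliary vertices with no such ancestor,
leaves the list of rooted trees `F`. The only child of a unary vertex is never auxiliary, because
below an auxiliary vertex there are at least two trees. -/
inductive Refines : UBTree → List RTree → Prop
  | leaf : Refines leaf [RTree.ofList []]
  | unary {t : UBTree} {S : RTree} : Refines t [S] → Refines (unary t) [RTree.ofList [S]]
  | binary {l r : UBTree} {F G : List RTree} :
      Refines l F → Refines r G → Refines (binary false l r) [RTree.ofList (F ++ G)]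
  | aux {l r : UBTree} {F G : List RTree} :
      Refines l F → Refines r G → Refines (binary true l r) (F ++ G)

/-- `t` arises from the non-plane tree `S` by replacing every vertex of out-degree `d ≥ 3` by a
binary tree with `d` leaves, at which the `d` subtrees are attached; the root of this binary tree
is the original vertex and its `d - 2` other internal vertices are auxiliary. -/
def IsReplacement (S : RTree) (t : UBTree) : Prop := ∃ S', S'.Iso S ∧ Refines t [S']

/-- Isomorphism on the trees that arise from `S` by replacement. -/
def replacementSetoid (S : RTree) : Setoid {t : UBTree // IsReplacement S t} where
  r t t' := Iso t.1 t'.1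
  iseqv := ⟨fun _ => Iso.refl _, fun h => h.symm, fun h h' => h.trans h'⟩

/-- `ℳ_S`: the non-plane unary-binary trees that arise from `S` by replacement. -/
def Replacements (S : RTree) : Type := Quotient (replacementSetoid S)

/-- The number of vertices. -/
def size : UBTree → ℕ
  | leaf => 1
  | unary t => 1 + size t
  | binary _ l r => 1 + size l + size r

theorem Refines.size_le {t : UBTree} {F : List RTree} (h : Refines t F) :
    t.size + 1 ≤ 2 * (F.map RTree.size).sum := by
  have key : ∀ F : List RTree, (RTree.ofList F).size = 1 + (F.map RTree.size).sum := by
    intro F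
    simp only [RTree.ofList, RTree.size, List.get_eq_getElem]
    congr 1
    rw [← Fin.sum_univ_fun_getElem]
  induction h with
  | leaf => simp [size, key]
  | unary _ ih => simp [size, key] at *; omega
  | binary _ _ ih1 ih2 => simp [size, key] at *; omega
  | aux _ _ ih1 ih2 => simp [size] at *; omega

theorem finite_size_le (n : ℕ) : {t : UBTree | t.size ≤ n}.Finite := by
  induction n with
  | zero =>
    apply Set.Finite.subset Set.finite_empty
    rintro (_ | _ | _) h <;> simp [size] at h
  | succ n ih =>
    have hfin : ({leaf} ∪ unary '' {t | t.size ≤ n} ∪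
        (fun p : Bool × UBTree × UBTree => binary p.1 p.2.1 p.2.2) ''
          (Set.univ ×ˢ ({t | t.size ≤ n} ×ˢ {t | t.size ≤ n}))).Finite :=
      ((Set.finite_singleton _).union (ih.image _)).union
        ((Set.finite_univ.prod (ih.prod ih)).image _)
    refine hfin.subset ?_
    rintro (_ | t | ⟨x, l, r⟩) h
    · simp
    · refine Or.inl (Or.inr ⟨t, ?_, rfl⟩)
      simp [size] at h ⊢
      omega
    · refine Or.inr ⟨(x, l, r), ?_, rfl⟩
      simp [size] at h ⊢
      omega

instance (S : RTree) : Finite (Replacements S) := by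
  have : Finite {t : UBTree // IsReplacement S t} := by
    have : {t : UBTree | IsReplacement S t}.Finite := by
      refine (finite_size_le (2 * S.size)).subset ?_
      rintro t ⟨S', hS, ht⟩
      have h1 := ht.size_le
      have h2 := hS.size_eq
      simp at h1 ⊢
      omega
    exact this
  exact Quotient.finite _

noncomputable instance (S : RTree) : Fintype (Replacements S) := Fintype.ofFinite _

end UBTree

/-- `C_S`: the sum of `(1/2)^s` over the trees in `ℳ_S`, where `s` is the number of symmetry
vertices. -/
noncomputable def RTree.symmetryConstant (S : RTree) : ℝ :=
  ∑ t : UBTree.Replacements S,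
    Quotient.liftOn t (fun t => (1 / 2 : ℝ) ^ t.1.sym)
      (fun _ _ h => congrArg (fun k => (1 / 2 : ℝ) ^ k) (UBTree.sym_congr h))

namespace RTree

/-- `V(z) = ∑ₙ |𝒱ₙ| zⁿ` as a formal power series over `ℝ`. -/
noncomputable def binarySeries : FormalMultilinearSeries ℝ ℝ ℝ :=
  FormalMultilinearSeries.ofScalars ℝ (fun n => (numBinary n : ℝ))

end RTree

/-! Two copies of `S` in `T` are the same embedding exactly when an automorphism of `T` exchanges
them. Hence a binary tree with an embedding of `S` is an isomorphism class of binary trees with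
marked vertices whose marked poset is `S`. Cutting at the root gives a recursion once the marked
poset may be a forest `F`. Let A_F(x) count these classes by leaves; a binary tree with k leaves has
2k - 1 vertices. An unmarked root is a single vertex or carries an unordered pair of marked trees
whose forests add up to `F`; a marked root is the root of the only tree of `F`. Unordered pairs
contribute (Σ A_G A_H + A_H(x²)) / 2, where G + H = F and the last term occurs only for F = 2H
(`two_mul_pairSeries`).

For F = 0 put B = A_0 and y = 1 - B. Then y² = h(x) with h(x) = 1 - 2x - B(x²). The radius of
convergence α of B is the zero of h in (0, 1/2), and B(α) = 1. Since α < 1, B(x²) is analytic beyond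
α; positivity of the coefficients shows that α is the only zero of h with |x| ≤ α, and it is simple.
So y = (1 - x/α)^(1/2) u, where u and 1/u are analytic beyond α (`exists_unit_inv`).

For a single tree the recursion reads y A_S = G_S, where G_S counts good embeddings. For two or more
trees, 2 y A_F is the sum of A_G A_H over nonempty G and H, plus a term analytic beyond α. By
induction A_F y^(w-1) = C_F + y e, where w counts vertices plus leaves of F and e = p + q y with p,
q analytic beyond α (`allSeries_expansion`). Here C is 1 for the leaf, does not change when a
nonempty forest gets a common root, and satisfies 2 C_F = Σ C_G C_H. The sums of (1/2)^s over
unary-binary trees obey the same rules: auxiliary vertices record how a forest is split, and the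
factor 1/2 at a symmetry vertex offsets that a pair of equal trees comes from only one ordered pair.

The coefficients of a power of 1 - x/α follow from Euler's limit for Γ, and a dominated convolution
carries them over to products with series analytic beyond α (`tendsto_coeff`). Finally z V(z) =
B(z²), so ρ = √α, and b² = -2 h'(α). -/

/-! ### Isomorphisms of disjoint unions of posets -/

/-- Families with the same multiset of values differ by a bijection of the index types. -/
theorem exists_equiv_of_sum_singleton_eq {ι κ α : Type*} [Fintype ι] [Fintype κ] {f : ι → α}
    {g : κ → α} (h : ∑ i, ({f i} : Multiset α) = ∑ j, {g j}) : ∃ σ : ι ≃ κ, ∀ i, f i = g (σ i) := by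
  classical
  have key : ∀ a, Nonempty ({i // f i = a} ≃ {j // g j = a}) := by
    intro a
    have := congrArg (Multiset.count a) h
    simp only [Multiset.count_sum', Multiset.count_singleton, Finset.sum_boole] at this
    refine ⟨Fintype.equivOfCardEq ?_⟩
    rw [Fintype.card_subtype, Fintype.card_subtype]
    simpa [eq_comm] using this
  exact ⟨Equiv.ofFiberEquiv fun a => (key a).some,
    fun i => (Equiv.ofFiberEquiv_map (fun a => (key a).some) i).symm⟩

theorem sum_singleton_comp_equiv {ι κ α : Type*} [Fintype ι] [Fintype κ] {f : ι → α}
    {g : κ → α} (σ : ι ≃ κ) (h : ∀ i, f i = g (σ i)) :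
    ∑ i, ({f i} : Multiset α) = ∑ j, {g j} :=
  Fintype.sum_equiv σ _ _ fun i => by rw [h]

/-- An isomorphism of disjoint unions of posets with maxima permutes the components. -/
theorem exists_component_iso {ι κ : Type*} {P : ι → Type*} {Q : κ → Type*}
    [∀ i, PartialOrder (P i)] [∀ j, PartialOrder (Q j)]
    {p : ∀ i, P i} (hp : ∀ i x, x ≤ p i) {q : ∀ j, Q j} (hq : ∀ j x, x ≤ q j)
    (f : (Σ i, P i) ≃o Σ j, Q j) :
    ∃ (σ : ι ≃ κ) (g : ∀ i, P i ≃o Q (σ i)), ∀ i x, f ⟨i, x⟩ = ⟨σ i, g i x⟩ := by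
  -- Different components are incomparable, so everything below the maximum of a component stays
  -- with it.
  have fst : ∀ i x, (f ⟨i, x⟩).1 = (f ⟨i, p i⟩).1 := fun i x =>
    (Sigma.le_def.1 (f.monotone (Sigma.mk_le_mk_iff.2 (hp i x)))).1
  have fst' : ∀ j y, (f.symm ⟨j, y⟩).1 = (f.symm ⟨j, q j⟩).1 := fun j y =>
    (Sigma.le_def.1 (f.symm.monotone (Sigma.mk_le_mk_iff.2 (hq j y)))).1
  let σ : ι ≃ κ :=
    { toFun := fun i => (f ⟨i, p i⟩).1
      invFun := fun j => (f.symm ⟨j, q j⟩).1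
      left_inv := fun i => by
        change (f.symm ⟨(f ⟨i, p i⟩).1, q _⟩).1 = i
        rw [← fst' _ (f ⟨i, p i⟩).2]
        simp
      right_inv := fun j => by
        change (f ⟨(f.symm ⟨j, q j⟩).1, p _⟩).1 = j
        rw [← fst _ (f.symm ⟨j, q j⟩).2]
        simp }
  have hg : ∀ i x, ∃ y : Q (σ i), f ⟨i, x⟩ = ⟨σ i, y⟩ := by
    intro i x
    have h := fst i x
    revert h
    generalize f ⟨i, x⟩ = z
    obtain ⟨j, y⟩ := z
    rintro rfl
    exact ⟨y, rfl⟩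
  choose g hg using hg
  have hle : ∀ i x x', g i x ≤ g i x' ↔ x ≤ x' := by
    intro i x x'
    rw [← Sigma.mk_le_mk_iff (i := σ i) (α := Q), ← hg, ← hg, f.le_iff_le, Sigma.mk_le_mk_iff]
  have hinj : ∀ i, Function.Injective (g i) := fun i x x' h =>
    le_antisymm ((hle _ _ _).1 h.le) ((hle _ _ _).1 h.ge)
  have hsurj : ∀ i, Function.Surjective (g i) := by
    intro i y
    obtain ⟨⟨i', x⟩, hx⟩ := f.surjective ⟨σ i, y⟩
    have h1 : σ i' = σ i := by
      have := hg i' x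
      rw [hx] at this
      exact (congrArg Sigma.fst this).symm
    obtain rfl := σ.injective h1
    refine ⟨x, ?_⟩
    rw [hg] at hx
    simpa using hx
  exact ⟨σ, fun i => ⟨Equiv.ofBijective (g i) ⟨hinj i, hsurj i⟩, hle i _ _⟩, hg⟩

/-- Disjoint unions of isomorphic posets are isomorphic. -/
def sigmaOrderIso {ι κ : Type*} {P : ι → Type*} {Q : κ → Type*}
    [∀ i, PartialOrder (P i)] [∀ j, PartialOrder (Q j)] (σ : ι ≃ κ) (g : ∀ i, P i ≃o Q (σ i)) :
    (Σ i, P i) ≃o Σ j, Q j where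
  toEquiv := Equiv.sigmaCongr σ fun i => (g i).toEquiv
  map_rel_iff' := by
    rintro ⟨i, x⟩ ⟨i', x'⟩
    rw [Sigma.le_def, Sigma.le_def]
    constructor
    · rintro ⟨h, h'⟩
      obtain rfl : i = i' := σ.injective h
      exact ⟨rfl, (g i).le_iff_le.1 h'⟩
    · rintro ⟨h, h'⟩
      obtain rfl : i = i' := h
      exact ⟨rfl, (g i).le_iff_le.2 h'⟩

/-- An isomorphism between posets with an added maximum restricts to the posets. -/
theorem exists_iso_of_withTop_iso {P Q : Type*} [PartialOrder P] [PartialOrder Q]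
    (f : WithTop P ≃o WithTop Q) : ∃ g : P ≃o Q, ∀ x : P, f x = (g x : WithTop Q) := by
  have h : ∀ x : P, ∃ y : Q, f x = y := fun x => by
    have : f x ≠ ⊤ := by
      rw [← f.map_top]
      exact fun h => WithTop.coe_ne_top (f.injective h)
    exact ⟨_, (WithTop.coe_untop _ this).symm⟩
  choose g hg using h
  have hle : ∀ x x', g x ≤ g x' ↔ x ≤ x' := fun x x' => by
    rw [← WithTop.coe_le_coe, ← hg, ← hg, f.le_iff_le, WithTop.coe_le_coe]
  refine ⟨⟨Equiv.ofBijective g ⟨fun x x' h => le_antisymm ((hle _ _).1 h.le) ((hle _ _).1 h.ge),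
    fun y => ?_⟩, hle _ _⟩, hg⟩
  obtain ⟨x, hx⟩ := f.surjective y
  have : x ≠ ⊤ := by
    rintro rfl
    rw [f.map_top] at hx
    exact WithTop.top_ne_coe hx
  lift x to P using this
  exact ⟨x, WithTop.coe_injective ((hg x).symm.trans hx)⟩

/-! ### Marked trees and isomorphism at the root -/

/-- A rooted tree with a set of marked vertices. -/
abbrev MarkedTree : Type := Σ T : RTree, Set T.Vertex

namespace RTree

/-- The vertices of a tree: the root and the vertices of its subtrees. -/
def nodeIso (d : ℕ) (c : Fin d → RTree) :
    (node d c).Vertex ≃o WithTop (Σ i, (c i).Vertex) :=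
  OrderIso.refl _

end RTree

namespace MarkedTree

open RTree

/-- Isomorphism of rooted trees with marked vertices. -/
def Iso (x y : MarkedTree) : Prop := ∃ f : x.1.Vertex ≃o y.1.Vertex, ∀ v, v ∈ x.2 ↔ f v ∈ y.2

theorem Iso.refl (x : MarkedTree) : x.Iso x := ⟨OrderIso.refl _, fun _ => Iff.rfl⟩

theorem Iso.symm {x y : MarkedTree} : x.Iso y → y.Iso x := fun ⟨f, hf⟩ =>
  ⟨f.symm, fun v => by rw [hf, f.apply_symm_apply]⟩

theorem Iso.trans {x y z : MarkedTree} : x.Iso y → y.Iso z → x.Iso z := fun ⟨f, hf⟩ ⟨g, hg⟩ =>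
  ⟨f.trans g, fun v => by rw [hf, hg]; rfl⟩

/-- The marked tree with given subtrees whose root is marked iff `m`. -/
def node {d : ℕ} (m : Prop) (c : Fin d → MarkedTree) : MarkedTree :=
  ⟨RTree.node d fun i => (c i).1, {v | match nodeIso d (fun i => (c i).1) v with
    | none => m
    | some ⟨i, w⟩ => w ∈ (c i).2}⟩

/-- Every marked tree is literally a `node` of the restrictions of its marks to the subtrees, so
induction on the underlying tree suffices. -/
theorem induction {p : MarkedTree → Prop}
    (h : ∀ (d : ℕ) (m : Prop) (c : Fin d → MarkedTree), (∀ i, p (c i)) → p (node m c))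
    (x : MarkedTree) : p x := by
  obtain ⟨T, E⟩ := x
  induction T with
  | node d c ih =>
    have := h d ((nodeIso d c).symm ⊤ ∈ E)
      (fun i => ⟨c i, {v | (nodeIso d c).symm (some ⟨i, v⟩) ∈ E}⟩) (fun i => ih i _)
    convert this using 1
    unfold node
    congr 1
    ext v
    obtain ⟨w, rfl⟩ := (nodeIso d c).symm.surjective v
    rcases w with _ | ⟨i, w⟩ <;> rfl

/-- An isomorphism fixes the root, hence acts on the disjoint union of the subtrees; these have
maxima, so `exists_component_iso` makes it permute them. -/
theorem node_iso_iff {d d' : ℕ} {m m' : Prop} {c : Fin d → MarkedTree}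
    {c' : Fin d' → MarkedTree} :
    (node m c).Iso (node m' c') ↔
      (m ↔ m') ∧ ∃ σ : Fin d ≃ Fin d', ∀ i, (c i).Iso (c' (σ i)) := by
  constructor
  · rintro ⟨f, hf⟩
    let F : WithTop (Σ i, (c i).1.Vertex) ≃o WithTop (Σ i, (c' i).1.Vertex) := f
    have hF : F ⊤ = ⊤ := F.map_top
    obtain ⟨g, hg⟩ := exists_iso_of_withTop_iso F
    obtain ⟨σ, k, hk⟩ := exists_component_iso (fun i => le_root (c i).1)
      (fun i => le_root (c' i).1) g
    refine ⟨?_, σ, fun i => ⟨k i, fun v => ?_⟩⟩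
    · have := hf (⊤ : WithTop (Σ i, (c i).1.Vertex))
      change m ↔ F ⊤ ∈ (node m' c').2 at this
      rw [hF] at this
      exact this
    · have := hf ((⟨i, v⟩ : Σ i, (c i).1.Vertex) : WithTop (Σ i, (c i).1.Vertex))
      change v ∈ (c i).2 ↔ F _ ∈ (node m' c').2 at this
      rw [hg, hk] at this
      exact this
  · rintro ⟨hm, σ, h⟩
    choose k hk using h
    refine ⟨(sigmaOrderIso σ k).withTopCongr, fun v => ?_⟩
    obtain ⟨w, rfl⟩ := (nodeIso _ _).symm.surjective v
    rcases w with _ | ⟨i, w⟩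
    · exact hm
    · exact hk i w

end MarkedTree

namespace RTree

/-- The case without marks of the marked statement. -/
theorem iso_node_iff {d d' : ℕ} {c : Fin d → RTree} {c' : Fin d' → RTree} :
    (node d c).Iso (node d' c') ↔ ∃ σ : Fin d ≃ Fin d', ∀ i, (c i).Iso (c' (σ i)) := by
  have key : ∀ s t : RTree, s.Iso t ↔ MarkedTree.Iso ⟨s, ∅⟩ ⟨t, ∅⟩ := fun s t =>
    ⟨fun ⟨f⟩ => ⟨f, by simp⟩, fun ⟨f, _⟩ => ⟨f⟩⟩
  have key' : ∀ (d : ℕ) (c : Fin d → RTree),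
      (⟨node d c, ∅⟩ : MarkedTree) = MarkedTree.node False (fun i => ⟨c i, ∅⟩) := by
    intro d c
    unfold MarkedTree.node
    congr 1
    ext v
    obtain ⟨w, rfl⟩ := (nodeIso d c).symm.surjective v
    rcases w with _ | ⟨i, w⟩ <;> exact Iff.rfl
  rw [key, key', key', MarkedTree.node_iso_iff]
  simp [key]

theorem Iso.refl (s : RTree) : s.Iso s := ⟨OrderIso.refl _⟩

theorem Iso.symm {s t : RTree} : s.Iso t → t.Iso s := fun ⟨f⟩ => ⟨f.symm⟩

theorem Iso.trans {s t u : RTree} : s.Iso t → t.Iso u → s.Iso u := fun ⟨f⟩ ⟨g⟩ => ⟨f.trans g⟩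

theorem Iso.leaves_eq {s t : RTree} (h : s.Iso t) : s.leaves = t.leaves := by
  induction s generalizing t with
  | node d c ih =>
    obtain ⟨d', c'⟩ := t
    obtain ⟨σ, hσ⟩ := iso_node_iff.1 h
    obtain rfl : d = d' := by simpa using Fintype.card_congr σ
    simp only [leaves]
    congr 1
    exact Fintype.sum_equiv σ _ _ fun i => ih i (hσ i)

/-- Isomorphism of non-plane trees. -/
def isoSetoid : Setoid RTree := ⟨Iso, Iso.refl, Iso.symm, Iso.trans⟩

end RTree

/-! ### Tree classes as multisets of subtrees -/

/-- Isomorphism classes of non-plane trees. -/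
def TreeClass : Type := Quotient RTree.isoSetoid

/-- The isomorphism class of a tree. -/
def RTree.cls (T : RTree) : TreeClass := Quotient.mk RTree.isoSetoid T

namespace TreeClass

open RTree

theorem cls_eq_iff {s t : RTree} : s.cls = t.cls ↔ s.Iso t := Quotient.eq (r := isoSetoid)

/-- A representative of an isomorphism class. -/
noncomputable def out (t : TreeClass) : RTree := Quotient.out (s := isoSetoid) t

theorem cls_out (t : TreeClass) : t.out.cls = t := Quotient.out_eq (s := isoSetoid) t

theorem map_cls_map_out (l : List TreeClass) : (l.map out).map cls = l := by
  rw [List.map_map, show cls ∘ out = id from funext cls_out, List.map_id]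

/-- The class whose subtrees at the root are the given classes. -/
noncomputable def mk (F : Multiset TreeClass) : TreeClass :=
  (ofList (F.toList.map out)).cls

theorem cls_node_eq_iff {d d' : ℕ} {c : Fin d → RTree} {c' : Fin d' → RTree} :
    (node d c).cls = (node d' c').cls ↔
      ∑ i, ({(c i).cls} : Multiset TreeClass) = ∑ i, {(c' i).cls} := by
  rw [cls_eq_iff, iso_node_iff]
  constructor
  · rintro ⟨σ, h⟩
    exact sum_singleton_comp_equiv σ fun i => cls_eq_iff.2 (h i)
  · intro h
    obtain ⟨σ, h⟩ := exists_equiv_of_sum_singleton_eq h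
    exact ⟨σ, fun i => cls_eq_iff.1 (h i)⟩

theorem sum_singleton_get {α : Type*} (l : List α) :
    ∑ i, ({l.get i} : Multiset α) = (l : Multiset α) := by
  rw [← List.sum_ofFn]
  induction l with
  | nil => rfl
  | cons a l ih =>
    rw [List.ofFn_succ, List.sum_cons]
    change {a} + (List.ofFn fun i => ({l.get i} : Multiset α)).sum = _
    rw [ih, Multiset.singleton_add, Multiset.cons_coe]

theorem sum_cls_get (l : List RTree) :
    ∑ i, ({(l.get i).cls} : Multiset TreeClass) = (l.map cls : Multiset TreeClass) := by
  rw [← sum_singleton_get]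
  have hl : l.length = (l.map cls).length := by simp
  exact sum_singleton_comp_equiv (finCongr hl) fun i => by simp

theorem cls_node {d : ℕ} (c : Fin d → RTree) : (node d c).cls = mk (∑ i, {(c i).cls}) := by
  rw [mk, ofList, cls_node_eq_iff, sum_cls_get, map_cls_map_out, Multiset.coe_toList]

theorem cls_ofList (l : List RTree) : (ofList l).cls = mk (l.map cls : Multiset TreeClass) := by
  rw [ofList, cls_node, sum_cls_get]

/-- With `exists_mk`, this makes a tree class the same thing as the multiset of its root subtrees,
so that recursions can run on multisets. -/
theorem mk_injective : Function.Injective mk := by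
  intro F G h
  rw [mk, mk, ofList, ofList, cls_node_eq_iff, sum_cls_get, sum_cls_get,
    map_cls_map_out, map_cls_map_out, Multiset.coe_toList, Multiset.coe_toList] at h
  exact h

theorem exists_mk (t : TreeClass) : ∃ F, t = mk F := by
  obtain ⟨⟨d, c⟩, rfl⟩ := Quotient.exists_rep t
  exact ⟨_, cls_node c⟩

/-- The number of vertices. -/
def size : TreeClass → ℕ := Quotient.lift RTree.size fun _ _ h => Iso.size_eq h

/-- The number of leaves. -/
def leaves : TreeClass → ℕ := Quotient.lift RTree.leaves fun _ _ h => Iso.leaves_eq h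

@[simp] theorem size_cls (T : RTree) : T.cls.size = T.size := rfl

@[simp] theorem leaves_cls (T : RTree) : T.cls.leaves = T.leaves := rfl

theorem exists_sum_cls (F : Multiset TreeClass) :
    ∃ (d : ℕ) (c : Fin d → RTree), F = ∑ i, {(c i).cls} := by
  refine ⟨_, (F.toList.map out).get, ?_⟩
  rw [sum_cls_get, map_cls_map_out, Multiset.coe_toList]

theorem size_mk (F : Multiset TreeClass) : (mk F).size = 1 + (F.map size).sum := by
  obtain ⟨d, c, rfl⟩ := exists_sum_cls F
  rw [← cls_node, size_cls, RTree.size, ← Multiset.coe_mapAddMonoidHom, map_sum, Multiset.sum_sum]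
  simp

theorem leaves_mk_zero : (mk 0).leaves = 1 := by
  have := cls_node (d := 0) Fin.elim0
  simp only [Finset.univ_eq_empty, Finset.sum_empty] at this
  rw [← this, leaves_cls, RTree.leaves, if_pos rfl]

theorem leaves_mk {F : Multiset TreeClass} (hF : F ≠ 0) :
    (mk F).leaves = (F.map leaves).sum := by
  obtain ⟨d, c, rfl⟩ := exists_sum_cls F
  have hd : d ≠ 0 := by
    rintro rfl
    simp at hF
  rw [← cls_node, leaves_cls, RTree.leaves, if_neg hd, ← Multiset.coe_mapAddMonoidHom, map_sum,
    Multiset.sum_sum]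
  simp

end TreeClass

/-! ### Posets that are forests -/

/-- The poset `P` is the disjoint union of the trees in the multiset `F`. -/
def IsForest (P : Type) [PartialOrder P] (F : Multiset TreeClass) : Prop :=
  ∃ (ι : Type) (_ : Fintype ι) (t : ι → RTree),
    Nonempty (P ≃o Σ i, (t i).Vertex) ∧ F = ∑ i, {(t i).cls}

namespace IsForest

open RTree TreeClass

variable {P Q : Type} [PartialOrder P] [PartialOrder Q] {F G : Multiset TreeClass}

theorem congr (e : P ≃o Q) : IsForest P F → IsForest Q F := fun ⟨ι, h, t, ⟨f⟩, hF⟩ =>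
  ⟨ι, h, t, ⟨e.symm.trans f⟩, hF⟩

/-- Associativity of disjoint unions. -/
def sigmaAssocIso {ι : Type*} {κ : ι → Type*} {R : ∀ i, κ i → Type*}
    [∀ i j, PartialOrder (R i j)] :
    (Σ i, Σ j, R i j) ≃o Σ x : Σ i, κ i, R x.1 x.2 where
  toEquiv := (Equiv.sigmaAssoc R).symm
  map_rel_iff' := by
    rintro ⟨i, j, x⟩ ⟨i', j', x'⟩
    change (⟨⟨i, j⟩, x⟩ : Σ x : Σ i, κ i, R x.1 x.2) ≤ ⟨⟨i', j'⟩, x'⟩ ↔ _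
    constructor
    · intro h
      obtain ⟨h1, h2⟩ := Sigma.le_def.1 h
      cases h1
      exact Sigma.mk_le_mk_iff.2 (Sigma.mk_le_mk_iff.2 h2)
    · intro h
      obtain ⟨h1, h2⟩ := Sigma.le_def.1 h
      cases h1
      obtain ⟨h3, h4⟩ := Sigma.le_def.1 h2
      cases h3
      exact Sigma.mk_le_mk_iff.2 h4

theorem sigma {ι : Type} [Fintype ι] {P : ι → Type} [∀ i, PartialOrder (P i)]
    {F : ι → Multiset TreeClass} (h : ∀ i, IsForest (P i) (F i)) :
    IsForest (Σ i, P i) (∑ i, F i) := by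
  choose κ hκ t e hF using h
  refine ⟨Σ i, κ i, inferInstance, fun x => t x.1 x.2, ⟨?_⟩, ?_⟩
  · have e1 : (Σ i, P i) ≃o Σ i, Σ j, (t i j).Vertex :=
      sigmaOrderIso (Equiv.refl ι) fun i => (e i).some
    exact e1.trans (sigmaAssocIso (R := fun i j => (t i j).Vertex))
  · rw [Fintype.sum_sigma]
    exact Finset.sum_congr rfl fun i _ => hF i

/-- Adding a maximum turns a forest into one tree; this reduces questions on forests to `mk`. -/
theorem exists_iso (h : IsForest P F) :
    ∃ T : RTree, T.cls = mk F ∧ Nonempty (WithTop P ≃o T.Vertex) := by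
  obtain ⟨ι, _, t, ⟨f⟩, rfl⟩ := h
  let e := Fintype.equivFin ι
  refine ⟨RTree.node _ (t ∘ e.symm), ?_, ⟨?_⟩⟩
  · rw [cls_node]
    congr 1
    exact sum_singleton_comp_equiv e.symm fun i => rfl
  · have e1 : (Σ j, (t (e.symm j)).Vertex) ≃o Σ i, (t i).Vertex :=
      sigmaOrderIso e.symm fun j => OrderIso.refl _
    exact (f.trans e1.symm).withTopCongr

theorem vertex (T : RTree) : IsForest T.Vertex {T.cls} := by
  refine ⟨Unit, inferInstance, fun _ => T, ⟨?_⟩, by simp⟩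
  exact
    { toEquiv := (Equiv.uniqueSigma fun _ : Unit => T.Vertex).symm
      map_rel_iff' := fun {a b} => by
        change (⟨(), a⟩ : Σ _ : Unit, T.Vertex) ≤ ⟨(), b⟩ ↔ _
        exact Sigma.mk_le_mk_iff }

theorem withTop (h : IsForest P F) : IsForest (WithTop P) {mk F} := by
  obtain ⟨T, hT, ⟨e⟩⟩ := h.exists_iso
  rw [← hT]
  exact (vertex T).congr e.symm

/-- After a common root is added, both forests become isomorphic trees, and `mk` is injective. -/
theorem unique (hF : IsForest P F) (hG : IsForest P G) : F = G := by
  obtain ⟨T, hT, ⟨e⟩⟩ := hF.exists_iso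
  obtain ⟨T', hT', ⟨e'⟩⟩ := hG.exists_iso
  apply mk_injective
  rw [← hT, ← hT', cls_eq_iff]
  exact ⟨e.symm.trans e'⟩

/-- Translates the defining condition of a copy of `S` into a condition on the forest of marked
vertices. -/
theorem singleton_iff (S : RTree) : IsForest P {S.cls} ↔ Nonempty (S.Vertex ≃o P) := by
  constructor
  · rintro ⟨ι, _, t, ⟨f⟩, h⟩
    have hc : Fintype.card ι = 1 := by
      have := congrArg Multiset.card h
      simpa using this.symm
    obtain ⟨i, hi⟩ := Fintype.card_eq_one_iff.1 hc
    let _ : Unique ι := ⟨⟨i⟩, hi⟩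
    rw [Fintype.sum_unique, Multiset.singleton_inj, cls_eq_iff] at h
    obtain ⟨g⟩ := h
    refine ⟨g.trans (OrderIso.trans ?_ f.symm)⟩
    exact
      { toEquiv := (Equiv.uniqueSigma fun i : ι => (t i).Vertex).symm
        map_rel_iff' := fun {a b} => by
          change (⟨default, a⟩ : Σ i : ι, (t i).Vertex) ≤ ⟨default, b⟩ ↔ _
          exact Sigma.mk_le_mk_iff }
  · rintro ⟨e⟩
    exact (vertex S).congr e

theorem zero_iff : IsForest P 0 ↔ IsEmpty P := by
  constructor
  · rintro ⟨ι, _, t, ⟨f⟩, h⟩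
    have hc : Fintype.card ι = 0 := by
      have := congrArg Multiset.card h
      simpa using this.symm
    have := Fintype.card_eq_zero_iff.1 hc
    exact f.toEquiv.isEmpty
  · intro h
    exact ⟨Empty, inferInstance, Empty.elim,
      ⟨⟨Equiv.equivOfIsEmpty _ _, fun {a} => h.elim a⟩⟩, by simp⟩

end IsForest

/-! ### The forest of marked vertices -/

namespace MarkedTree

open RTree TreeClass

/-- The root lies above all other marks and so is the added maximum. -/
theorem marks_node_of_marked {d : ℕ} {m : Prop} (hm : m) (c : Fin d → MarkedTree) :
    Nonempty (WithTop (Σ i, ((c i).2 : Set _)) ≃o ((node m c).2 : Set _)) := by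
  let f : WithTop (Σ i, ((c i).2 : Set _)) → ((node m c).2 : Set _) := fun v =>
    match v with
    | none => ⟨(nodeIso d fun i => (c i).1).symm none, hm⟩
    | some ⟨i, w⟩ => ⟨(nodeIso d fun i => (c i).1).symm (some ⟨i, w.1⟩), w.2⟩
  have hle : ∀ a b, f a ≤ f b ↔ a ≤ b := by
    rintro (_ | ⟨i, v, hv⟩) (_ | ⟨j, w, hw⟩)
    · exact iff_of_true le_rfl le_rfl
    · exact iff_of_false
        (fun h : (⊤ : WithTop (Σ i, (c i).1.Vertex)) ≤ ((⟨j, w⟩ : Σ i, (c i).1.Vertex) :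
          WithTop (Σ i, (c i).1.Vertex)) => WithTop.coe_ne_top (top_le_iff.1 h))
        (fun h : (⊤ : WithTop (Σ i, ((c i).2 : Set _))) ≤
          ((⟨j, w, hw⟩ : Σ i, ((c i).2 : Set _)) : WithTop _) =>
          WithTop.coe_ne_top (top_le_iff.1 h))
    · exact iff_of_true
        (le_top : (_ : WithTop (Σ i, (c i).1.Vertex)) ≤ ⊤)
        (le_top : (_ : WithTop (Σ i, ((c i).2 : Set _))) ≤ ⊤)
    · change (((⟨i, v⟩ : Σ i, (c i).1.Vertex) : WithTop (Σ i, (c i).1.Vertex)) ≤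
        ((⟨j, w⟩ : Σ i, (c i).1.Vertex) : WithTop (Σ i, (c i).1.Vertex))) ↔
        (((⟨i, v, hv⟩ : Σ i, ((c i).2 : Set _)) : WithTop (Σ i, ((c i).2 : Set _))) ≤
        ((⟨j, w, hw⟩ : Σ i, ((c i).2 : Set _)) : WithTop (Σ i, ((c i).2 : Set _))))
      rw [WithTop.coe_le_coe, WithTop.coe_le_coe]
      constructor
      · intro h
        obtain ⟨h1, h2⟩ := Sigma.le_def.1 h
        cases h1
        exact Sigma.mk_le_mk_iff.2 h2
      · intro h
        obtain ⟨h1, h2⟩ := Sigma.le_def.1 h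
        cases h1
        exact Sigma.mk_le_mk_iff.2 h2
  refine ⟨⟨Equiv.ofBijective f ⟨fun a b h => le_antisymm ((hle _ _).1 h.le) ((hle _ _).1 h.ge),
    ?_⟩, hle _ _⟩⟩
  rintro ⟨v, hv⟩
  obtain ⟨w, rfl⟩ := (nodeIso d fun i => (c i).1).symm.surjective v
  rcases w with _ | ⟨i, w⟩
  · exact ⟨none, rfl⟩
  · exact ⟨some ⟨i, w, hv⟩, rfl⟩

theorem marks_node_of_not_marked {d : ℕ} {m : Prop} (hm : ¬ m) (c : Fin d → MarkedTree) :
    Nonempty ((Σ i, ((c i).2 : Set _)) ≃o ((node m c).2 : Set _)) := by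
  let f : (Σ i, ((c i).2 : Set _)) → ((node m c).2 : Set _) := fun v =>
    ⟨(nodeIso d fun i => (c i).1).symm (some ⟨v.1, v.2.1⟩), v.2.2⟩
  have hle : ∀ a b, f a ≤ f b ↔ a ≤ b := by
    rintro ⟨i, v, hv⟩ ⟨j, w, hw⟩
    change (((⟨i, v⟩ : Σ i, (c i).1.Vertex) : WithTop (Σ i, (c i).1.Vertex)) ≤
        ((⟨j, w⟩ : Σ i, (c i).1.Vertex) : WithTop (Σ i, (c i).1.Vertex))) ↔ _
    rw [WithTop.coe_le_coe]
    constructor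
    · intro h
      obtain ⟨h1, h2⟩ := Sigma.le_def.1 h
      cases h1
      exact Sigma.mk_le_mk_iff.2 h2
    · intro h
      obtain ⟨h1, h2⟩ := Sigma.le_def.1 h
      cases h1
      exact Sigma.mk_le_mk_iff.2 h2
  refine ⟨⟨Equiv.ofBijective f ⟨fun a b h => le_antisymm ((hle _ _).1 h.le) ((hle _ _).1 h.ge),
    ?_⟩, hle _ _⟩⟩
  rintro ⟨v, hv⟩
  obtain ⟨w, rfl⟩ := (nodeIso d fun i => (c i).1).symm.surjective v
  rcases w with _ | ⟨i, w⟩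
  · exact absurd hv hm
  · exact ⟨⟨i, w, hv⟩, rfl⟩

theorem isForest_node_of_marked {d : ℕ} {m : Prop} (hm : m) {c : Fin d → MarkedTree}
    {F : Fin d → Multiset TreeClass} (h : ∀ i, IsForest ((c i).2 : Set _) (F i)) :
    IsForest ((node m c).2 : Set _) {mk (∑ i, F i)} :=
  (IsForest.sigma h).withTop.congr (marks_node_of_marked hm c).some

theorem isForest_node_of_not_marked {d : ℕ} {m : Prop} (hm : ¬ m) {c : Fin d → MarkedTree}
    {F : Fin d → Multiset TreeClass} (h : ∀ i, IsForest ((c i).2 : Set _) (F i)) :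
    IsForest ((node m c).2 : Set _) (∑ i, F i) :=
  (IsForest.sigma h).congr (marks_node_of_not_marked hm c).some

/-- Built from the leaves up: the forests of the subtrees are united, and a marked root joins them
into one tree. -/
theorem exists_isForest (x : MarkedTree) : ∃ F, IsForest (x.2 : Set _) F := by
  induction x using MarkedTree.induction with
  | h d m c ih =>
    choose F hF using ih
    by_cases hm : m
    · exact ⟨_, isForest_node_of_marked hm hF⟩
    · exact ⟨_, isForest_node_of_not_marked hm hF⟩

/-- The multiset of trees formed by the marked vertices. -/
noncomputable def forest (x : MarkedTree) : Multiset TreeClass := (exists_isForest x).choose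

theorem isForest_forest (x : MarkedTree) : IsForest (x.2 : Set _) x.forest :=
  (exists_isForest x).choose_spec

open Classical in
theorem forest_node {d : ℕ} (m : Prop) (c : Fin d → MarkedTree) :
    (node m c).forest = if m then {mk (∑ i, (c i).forest)} else ∑ i, (c i).forest := by
  apply (isForest_forest _).unique
  split_ifs with hm
  · exact isForest_node_of_marked hm fun i => isForest_forest _
  · exact isForest_node_of_not_marked hm fun i => isForest_forest _

theorem Iso.forest_eq {x y : MarkedTree} (h : x.Iso y) : x.forest = y.forest := by
  obtain ⟨f, hf⟩ := h
  refine ((isForest_forest x).congr ?_).unique (isForest_forest y)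
  exact
    { toEquiv := f.toEquiv.subtypeEquiv hf
      map_rel_iff' := fun {a b} => f.le_iff_le (x := a.1) (y := b.1) }

theorem Iso.root_mem_iff {x y : MarkedTree} (h : x.Iso y) : x.1.root ∈ x.2 ↔ y.1.root ∈ y.2 := by
  obtain ⟨f, hf⟩ := h
  rw [hf, map_root]

theorem iso_node_two {m m' : Prop} {x y x' y' : MarkedTree} :
    (node m ![x, y]).Iso (node m' ![x', y']) ↔
      (m ↔ m') ∧ (x.Iso x' ∧ y.Iso y' ∨ x.Iso y' ∧ y.Iso x') := by
  rw [node_iso_iff]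
  refine and_congr_right fun _ => ?_
  constructor
  · rintro ⟨σ, h⟩
    have h0 := h 0
    have h1 := h 1
    have hne : σ 0 ≠ σ 1 := fun h => by simpa using σ.injective h
    rcases Fin.exists_fin_two.1 ⟨σ 0, rfl⟩ with h2 | h2 <;>
      rcases Fin.exists_fin_two.1 ⟨σ 1, rfl⟩ with h3 | h3 <;>
      rw [h2] at h0 <;> rw [h3] at h1 <;> simp_all
  · rintro (⟨h0, h1⟩ | ⟨h0, h1⟩)
    · exact ⟨Equiv.refl _, Fin.forall_fin_two.2 ⟨h0, h1⟩⟩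
    · exact ⟨Equiv.swap 0 1, Fin.forall_fin_two.2 ⟨by simpa using h0, by simpa using h1⟩⟩

end MarkedTree

/-! ### Classes of marked binary trees -/

/-- Binary trees with marked vertices. -/
abbrev BinaryMarkedTree : Type := {x : MarkedTree // x.1.IsBinary}

/-- Isomorphism of binary trees with marked vertices. -/
def binaryMarkedSetoid : Setoid BinaryMarkedTree :=
  ⟨fun x y => x.1.Iso y.1, fun x => .refl x.1, .symm, .trans⟩

/-- Isomorphism classes of binary trees with marked vertices. -/
def MarkedClass : Type := Quotient binaryMarkedSetoid

namespace MarkedClass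

open TreeClass

/-- The class of a binary tree with marked vertices. -/
def of (x : BinaryMarkedTree) : MarkedClass := Quotient.mk binaryMarkedSetoid x

theorem of_eq_iff {x y : BinaryMarkedTree} : of x = of y ↔ x.1.Iso y.1 :=
  Quotient.eq (r := binaryMarkedSetoid)

theorem exists_of (q : MarkedClass) : ∃ x, q = of x := by
  obtain ⟨x, rfl⟩ := Quotient.exists_rep q
  exact ⟨x, rfl⟩

/-- The number of vertices. -/
def size : MarkedClass → ℕ :=
  Quotient.lift (fun x => x.1.1.size) fun _ _ ⟨f, _⟩ => RTree.Iso.size_eq ⟨f⟩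

/-- The number of leaves. -/
def leaves : MarkedClass → ℕ :=
  Quotient.lift (fun x => x.1.1.leaves) fun _ _ ⟨f, _⟩ => RTree.Iso.leaves_eq ⟨f⟩

/-- The multiset of trees formed by the marked vertices. -/
noncomputable def forest : MarkedClass → Multiset TreeClass :=
  Quotient.lift (fun x => x.1.forest) fun _ _ h => MarkedTree.Iso.forest_eq h

/-- The root is marked. -/
def IsGood : MarkedClass → Prop :=
  Quotient.lift (fun x => x.1.1.root ∈ x.1.2) fun _ _ h =>
    propext (MarkedTree.Iso.root_mem_iff h)

/-- The single vertex, which is marked iff `m`. -/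
def leaf (m : Prop) : MarkedClass :=
  of ⟨MarkedTree.node (d := 0) m Fin.elim0, Or.inl rfl, fun i => i.elim0⟩

/-- The binary tree with the two given subtrees at the root, which is marked iff `m`. -/
def pair (m : Prop) (x y : BinaryMarkedTree) : BinaryMarkedTree :=
  ⟨MarkedTree.node m ![x.1, y.1], Or.inr rfl, Fin.forall_fin_two.2 ⟨x.2, y.2⟩⟩

theorem of_pair_eq_iff {m m' : Prop} {x y x' y' : BinaryMarkedTree} :
    of (pair m x y) = of (pair m' x' y') ↔
      m = m' ∧ (of x = of x' ∧ of y = of y' ∨ of x = of y' ∧ of y = of x') := by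
  simp only [of_eq_iff, pair, MarkedTree.iso_node_two, eq_iff_iff]

/-- The class with the given unordered pair of subtrees at the root, which is marked iff `m`. -/
def node (m : Prop) : Sym2 MarkedClass → MarkedClass :=
  Sym2.lift ⟨Quotient.lift₂ (fun x y => of (pair m x y)) fun _ _ _ _ h h' =>
      of_pair_eq_iff.2 ⟨rfl, Or.inl ⟨of_eq_iff.2 h, of_eq_iff.2 h'⟩⟩, fun a b => by
    obtain ⟨x, rfl⟩ := a.exists_of
    obtain ⟨y, rfl⟩ := b.exists_of
    exact of_pair_eq_iff.2 ⟨rfl, Or.inr ⟨rfl, rfl⟩⟩⟩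

theorem node_mk (m : Prop) (x y : BinaryMarkedTree) : node m s(of x, of y) = of (pair m x y) := rfl

theorem node_eq_iff {m m' : Prop} {p p' : Sym2 MarkedClass} :
    node m p = node m' p' ↔ m = m' ∧ p = p' := by
  induction p with | _ a b
  induction p' with | _ a' b'
  obtain ⟨x, rfl⟩ := a.exists_of
  obtain ⟨y, rfl⟩ := b.exists_of
  obtain ⟨x', rfl⟩ := a'.exists_of
  obtain ⟨y', rfl⟩ := b'.exists_of
  rw [node_mk, node_mk, of_pair_eq_iff, Sym2.eq_iff]

theorem eq_leaf_or_node (q : MarkedClass) : (∃ m, q = leaf m) ∨ ∃ m p, q = node m p := by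
  obtain ⟨⟨x, hx⟩, rfl⟩ := q.exists_of
  induction x using MarkedTree.induction with
  | h d m c _ =>
    obtain ⟨rfl | rfl, hc⟩ := hx
    · refine Or.inl ⟨m, of_eq_iff.2 ?_⟩
      exact MarkedTree.node_iso_iff.2 ⟨Iff.rfl, Equiv.refl _, fun i => i.elim0⟩
    · refine Or.inr ⟨m, s(of ⟨c 0, hc 0⟩, of ⟨c 1, hc 1⟩), of_eq_iff.2 ?_⟩
      exact MarkedTree.node_iso_iff.2
        ⟨Iff.rfl, Equiv.refl _, Fin.forall_fin_two.2 ⟨.refl _, .refl _⟩⟩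

theorem leaf_ne_node (m m' : Prop) (p : Sym2 MarkedClass) : leaf m ≠ node m' p := by
  induction p with | _ a b
  obtain ⟨x, rfl⟩ := a.exists_of
  obtain ⟨y, rfl⟩ := b.exists_of
  intro h
  obtain ⟨-, σ, -⟩ := MarkedTree.node_iso_iff.1 (of_eq_iff.1 h)
  exact (σ.symm 0).elim0

open Classical in
theorem forest_leaf (m : Prop) : (leaf m).forest = if m then {mk 0} else 0 := by
  change MarkedTree.forest _ = _
  rw [MarkedTree.forest_node]
  simp

open Classical in
theorem forest_node (m : Prop) (a b : MarkedClass) :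
    (node m s(a, b)).forest = if m then {mk (a.forest + b.forest)} else a.forest + b.forest := by
  obtain ⟨x, rfl⟩ := a.exists_of
  obtain ⟨y, rfl⟩ := b.exists_of
  change MarkedTree.forest _ = _
  rw [pair, MarkedTree.forest_node]
  simp only [Fin.sum_univ_two]
  rfl

theorem isGood_leaf (m : Prop) : (leaf m).IsGood ↔ m := Iff.rfl

theorem isGood_node (m : Prop) (p : Sym2 MarkedClass) : (node m p).IsGood ↔ m := by
  induction p with | _ a b
  obtain ⟨x, rfl⟩ := a.exists_of
  obtain ⟨y, rfl⟩ := b.exists_of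
  exact Iff.rfl

theorem leaves_leaf (m : Prop) : (leaf m).leaves = 1 := rfl

theorem leaves_node (m : Prop) (a b : MarkedClass) :
    (node m s(a, b)).leaves = a.leaves + b.leaves := by
  obtain ⟨x, rfl⟩ := a.exists_of
  obtain ⟨y, rfl⟩ := b.exists_of
  change RTree.leaves _ = RTree.leaves _ + RTree.leaves _
  simp only [pair, MarkedTree.node, RTree.leaves, Fin.sum_univ_two]
  rfl

/-- Allows counting by leaves, which add up over the two subtrees, and explains why even sizes do
not occur. -/
theorem _root_.RTree.IsBinary.size_add_one {T : RTree} (h : T.IsBinary) :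
    T.size + 1 = 2 * T.leaves := by
  induction T with
  | node d c ih =>
    obtain ⟨rfl | rfl, hc⟩ := h
    · simp [RTree.size, RTree.leaves]
    · have h0 := ih 0 (hc 0)
      have h1 := ih 1 (hc 1)
      simp only [RTree.size, RTree.leaves, Fin.sum_univ_two]
      rw [if_neg (by decide)]
      omega

theorem size_add_one (q : MarkedClass) : q.size + 1 = 2 * q.leaves := by
  obtain ⟨x, rfl⟩ := q.exists_of
  exact x.2.size_add_one

theorem finite_leaves_eq (k : ℕ) : {q : MarkedClass | q.leaves = k}.Finite := by
  have h1 : Finite {T : RTree // T.size ≤ 2 * k} := (RTree.finite_size_le (2 * k)).to_subtype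
  have h2 : ∀ T : RTree, Finite T.Vertex := RTree.finite_vertex
  have h3 : Finite (Σ T : {T : RTree // T.size ≤ 2 * k}, Set T.1.Vertex) := inferInstance
  have h4 : Finite {x : BinaryMarkedTree // x.1.1.size ≤ 2 * k} := by
    refine Finite.of_injective (fun x => (⟨⟨x.1.1.1, x.2⟩, x.1.1.2⟩ :
      Σ T : {T : RTree // T.size ≤ 2 * k}, Set T.1.Vertex)) ?_
    rintro ⟨⟨⟨T, E⟩, h⟩, h'⟩ ⟨⟨⟨T', E'⟩, _⟩, _⟩ he
    simp only [Sigma.mk.injEq, Subtype.mk.injEq] at he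
    obtain ⟨rfl, he⟩ := he
    rw [heq_eq_eq] at he
    subst he
    rfl
  refine (Set.finite_range fun x : {x : BinaryMarkedTree // x.1.1.size ≤ 2 * k} => of x.1).subset ?_
  intro q hq
  have h5 := q.size_add_one
  obtain ⟨x, rfl⟩ := q.exists_of
  change (of x).leaves = k at hq
  exact ⟨⟨x, by change x.1.1.size + 1 = _ at h5; omega⟩, rfl⟩

end MarkedClass

/-! ### Weighted counts of unordered pairs -/

section SymmetricPairs

variable {X Γ : Type*} [AddCommMonoid Γ]

/-- The degree of an unordered pair is the sum of the degrees. -/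
def Sym2.addDeg (deg : X → Γ) : Sym2 X → Γ :=
  Sym2.lift ⟨fun a b => deg a + deg b, fun _ _ => add_comm _ _⟩

/-- The weight of an unordered pair is the product of the weights. -/
def Sym2.mulWeight (w : X → ℝ) : Sym2 X → ℝ :=
  Sym2.lift ⟨fun a b => w a * w b, fun _ _ => mul_comm _ _⟩

variable {deg : X → Γ} (hfin : ∀ γ, {x | deg x = γ}.Finite) {γ : Γ} {D : Finset (Γ × Γ)}
  (hD : ∀ x, x ∈ D ↔ x.1 + x.2 = γ)

include hfin hD

theorem finite_pairs_deg_eq : {x : X × X | deg x.1 + deg x.2 = γ}.Finite := by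
  have : (⋃ d ∈ D, {x : X | deg x = d.1} ×ˢ {x : X | deg x = d.2}).Finite :=
    Set.Finite.biUnion D.finite_toSet fun d _ => (hfin _).prod (hfin _)
  refine this.subset fun x hx => ?_
  simp only [Set.mem_iUnion]
  exact ⟨(deg x.1, deg x.2), (hD _).2 hx, rfl, rfl⟩

theorem finite_sym2_deg_eq : {p : Sym2 X | p.addDeg deg = γ}.Finite := by
  refine ((finite_pairs_deg_eq hfin hD).image fun x => s(x.1, x.2)).subset fun p hp => ?_
  induction p with | _ a b
  exact ⟨(a, b), hp, rfl⟩

theorem finite_double_deg_eq : {x : X | deg x + deg x = γ}.Finite := by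
  refine ((finite_pairs_deg_eq hfin hD).image fun x => x.1).subset fun x hx => ?_
  exact ⟨(x, x), hx, rfl⟩

open Classical in
-- An unordered pair of distinct elements comes from two ordered pairs, a diagonal one from a single
-- ordered pair. The set `D` lists the finitely many ways to split the degree.
theorem sum_sym2_deg_eq (w : X → ℝ) :
    ∑ p ∈ (finite_sym2_deg_eq hfin hD).toFinset, p.mulWeight w * (if p.IsDiag then 1 else 2) =
      ∑ d ∈ D, (∑ a ∈ (hfin d.1).toFinset, w a) * ∑ b ∈ (hfin d.2).toFinset, w b := by
  have h1 : ∑ d ∈ D, (∑ a ∈ (hfin d.1).toFinset, w a) * ∑ b ∈ (hfin d.2).toFinset, w b =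
      ∑ x ∈ (finite_pairs_deg_eq hfin hD).toFinset, w x.1 * w x.2 := by
    rw [← Finset.sum_fiberwise_of_maps_to (g := fun x : X × X => (deg x.1, deg x.2)) (t := D)
      (fun x hx => (hD _).2 ((finite_pairs_deg_eq hfin hD).mem_toFinset.1 hx))]
    refine Finset.sum_congr rfl fun d hd => ?_
    rw [Finset.sum_mul_sum, ← Finset.sum_product']
    refine Finset.sum_congr ?_ fun _ _ => rfl
    ext x
    simp only [Finset.mem_product, Set.Finite.mem_toFinset, Finset.mem_filter, Prod.ext_iff]
    constructor
    · rintro ⟨h, h'⟩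
      refine ⟨?_, h, h'⟩
      change deg x.1 + deg x.2 = γ
      rw [show deg x.1 = _ from h, show deg x.2 = _ from h']
      exact (hD d).1 hd
    · rintro ⟨-, h, h'⟩
      exact ⟨h, h'⟩
  rw [h1, ← Finset.sum_fiberwise_of_maps_to (g := fun x : X × X => s(x.1, x.2))
    (t := (finite_sym2_deg_eq hfin hD).toFinset) fun x hx =>
      (finite_sym2_deg_eq hfin hD).mem_toFinset.2 ((finite_pairs_deg_eq hfin hD).mem_toFinset.1 hx)]
  refine Finset.sum_congr rfl fun p hp => ?_
  induction p with | _ a b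
  have hab : deg a + deg b = γ := (finite_sym2_deg_eq hfin hD).mem_toFinset.1 hp
  have h2 : {x ∈ (finite_pairs_deg_eq hfin hD).toFinset | s(x.1, x.2) = s(a, b)} =
      {(a, b), (b, a)} := by
    ext ⟨x, y⟩
    simp only [Finset.mem_filter, Set.Finite.mem_toFinset, Set.mem_ofPred_eq, Sym2.eq_iff,
      Finset.mem_insert, Finset.mem_singleton, Prod.mk.injEq]
    constructor
    · exact fun h => h.2
    · rintro (⟨rfl, rfl⟩ | ⟨rfl, rfl⟩)
      · exact ⟨hab, by simp⟩
      · exact ⟨by rwa [add_comm], by simp⟩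
  rw [h2]
  simp only [Sym2.mulWeight, Sym2.lift_mk, Sym2.mk_isDiag_iff]
  split_ifs with h
  · subst h
    simp
  · rw [Finset.sum_pair (by simp [h])]
    ring

/-- The ordered pairs count the diagonal once only; adding it again gives every unordered pair
multiplicity two. -/
theorem two_mul_ncard_sym2_deg_eq :
    (2 : ℝ) * {p : Sym2 X | p.addDeg deg = γ}.ncard =
      ∑ d ∈ D, ({x | deg x = d.1}.ncard : ℝ) * {x | deg x = d.2}.ncard +
        {x : X | deg x + deg x = γ}.ncard := by
  classical
  have h1 := sum_sym2_deg_eq hfin hD (fun _ => 1)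
  have h2 : ∀ p : Sym2 X, p.mulWeight (fun _ => (1 : ℝ)) = 1 := fun p => by
    induction p with | _ a b
    simp [Sym2.mulWeight]
  have h3 : {x : X | deg x + deg x = γ}.ncard =
      ((finite_sym2_deg_eq hfin hD).toFinset.filter Sym2.IsDiag).card := by
    rw [← Set.ncard_image_of_injective _ (Sym2.diag_injective (α := X)), ← Set.ncard_coe_finset]
    congr 1
    ext p
    induction p with | _ a b
    simp only [Set.mem_image, Set.mem_ofPred_eq, Finset.coe_filter, Set.Finite.mem_toFinset,
      Sym2.mk_isDiag_iff]
    constructor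
    · rintro ⟨x, hx, hx'⟩
      obtain ⟨rfl, rfl⟩ | ⟨rfl, rfl⟩ := Sym2.eq_iff.1 hx' <;> exact ⟨hx, rfl⟩
    · rintro ⟨h, rfl⟩
      exact ⟨a, h, rfl⟩
  simp only [h2, one_mul, Finset.sum_const, nsmul_eq_mul, mul_one] at h1
  rw [h3, Set.ncard_eq_toFinset_card _ (finite_sym2_deg_eq hfin hD)]
  simp_rw [fun γ => Set.ncard_eq_toFinset_card _ (hfin γ)]
  rw [← h1, Finset.card_filter, Nat.cast_sum, ← Finset.sum_add_distrib, mul_comm,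
    ← nsmul_eq_mul, ← Finset.sum_const]
  refine Finset.sum_congr rfl fun p _ => ?_
  split_ifs <;> norm_num

end SymmetricPairs

/-- The pairs of multisets with sum `F`. -/
noncomputable def Multiset.splittings {α : Type*} (F : Multiset α) :
    Finset (Multiset α × Multiset α) :=
  open Classical in F.antidiagonal.toFinset

@[simp] theorem Multiset.mem_splittings {α : Type*} {F : Multiset α}
    {x : Multiset α × Multiset α} : x ∈ F.splittings ↔ x.1 + x.2 = F := by
  simp [Multiset.splittings]

/-! ### Functional equations of the generating functions -/

namespace MarkedClass

open TreeClass PowerSeries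

/-- The number of leaves together with the forest of marked vertices. -/
noncomputable def deg (q : MarkedClass) : ℕ × Multiset TreeClass := (q.leaves, q.forest)

theorem finite_deg_eq (γ : ℕ × Multiset TreeClass) : {q : MarkedClass | q.deg = γ}.Finite :=
  (finite_leaves_eq γ.1).subset fun _ h => congrArg Prod.fst h

/-- The generating function by leaves of the binary trees whose marked vertices form `F`. -/
noncomputable def allSeries (F : Multiset TreeClass) : ℝ⟦X⟧ :=
  PowerSeries.mk fun k => ({q : MarkedClass | q.deg = (k, F)}.ncard : ℝ)

/-- The generating function by leaves of the binary trees with marked root whose marked vertices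
form the tree `S`. -/
noncomputable def goodSeries (S : TreeClass) : ℝ⟦X⟧ :=
  PowerSeries.mk fun k => ({q : MarkedClass | q.deg = (k, {S}) ∧ q.IsGood}.ncard : ℝ)

/-- The generating function of the unordered pairs of marked binary trees. -/
noncomputable def pairSeries (F : Multiset TreeClass) : ℝ⟦X⟧ :=
  PowerSeries.mk fun k => ({p : Sym2 MarkedClass | p.addDeg deg = (k, F)}.ncard : ℝ)

theorem mem_degreePairs {k : ℕ} {F : Multiset TreeClass}
    (x : (ℕ × Multiset TreeClass) × (ℕ × Multiset TreeClass)) :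
    x ∈ (Finset.HasAntidiagonal.antidiagonal k ×ˢ F.splittings).map
      (Equiv.prodProdProdComm _ _ _ _).toEmbedding ↔ x.1 + x.2 = (k, F) := by
  obtain ⟨⟨a, b⟩, c, d⟩ := x
  rw [Finset.mem_map_equiv]
  simp [Equiv.prodProdProdComm]

theorem finite_pair_deg_eq (γ : ℕ × Multiset TreeClass) :
    {p : Sym2 MarkedClass | p.addDeg deg = γ}.Finite :=
  finite_sym2_deg_eq finite_deg_eq mem_degreePairs

open Classical in
-- The diagonal pairs consist of two equal marked trees: the forest must be `H + H` and the leaves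
-- double, which substitutes x² for x.
theorem two_mul_pairSeries (F : Multiset TreeClass) :
    2 * pairSeries F = ∑ d ∈ F.splittings, allSeries d.1 * allSeries d.2 +
      if h : ∃ H, F = H + H then expand 2 two_ne_zero (allSeries h.choose) else 0 := by
  ext k
  have h1 := two_mul_ncard_sym2_deg_eq finite_deg_eq (mem_degreePairs (k := k) (F := F))
  have h2 : (2 * pairSeries F : ℝ⟦X⟧) = C (2 : ℝ) * pairSeries F := by rw [map_ofNat]
  rw [h2, coeff_C_mul, pairSeries, coeff_mk, h1, map_add, map_sum]
  congr 1
  · rw [Finset.sum_map, Finset.sum_product_right]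
    refine Finset.sum_congr rfl fun d _ => ?_
    rw [coeff_mul]
    exact Finset.sum_congr rfl fun i _ => by simp [allSeries, Equiv.prodProdProdComm]
  · split_ifs with h
    · rw [coeff_expand]
      have hF := h.choose_spec
      set H := h.choose
      split_ifs with hk
      · rw [allSeries, coeff_mk]
        congr 3
        ext q
        obtain ⟨j, rfl⟩ := hk
        rw [hF]
        simp only [deg, Prod.mk_add_mk, Prod.mk.injEq]
        refine and_congr (by omega) ?_
        -- A multiset determines its half, so the chosen `H` is the only one.
        rw [← two_nsmul, ← two_nsmul]
        constructor
        · intro h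
          ext a
          have := congrArg (Multiset.count a) h
          simpa using this
        · intro h
          rw [h]
      · rw [Nat.cast_eq_zero, Set.ncard_eq_zero (finite_double_deg_eq finite_deg_eq mem_degreePairs),
          Set.eq_empty_iff_forall_notMem]
        intro q hq
        have : q.leaves + q.leaves = k := congrArg Prod.fst hq
        exact hk ⟨q.leaves, by omega⟩
    · rw [map_zero, Nat.cast_eq_zero,
        Set.ncard_eq_zero (finite_double_deg_eq finite_deg_eq mem_degreePairs),
        Set.eq_empty_iff_forall_notMem]
      intro q hq
      exact h ⟨q.forest, (congrArg Prod.snd hq).symm⟩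

open Classical in
-- Below an unmarked root there is nothing or an unordered pair whose forests add up to `F`; the
-- single unmarked vertex is the exceptional term.
theorem ncard_not_good (k : ℕ) (F : Multiset TreeClass) :
    {q : MarkedClass | q.deg = (k, F) ∧ ¬ q.IsGood}.ncard = (if k = 1 ∧ F = 0 then 1 else 0) +
      {p : Sym2 MarkedClass | p.addDeg deg = (k, F)}.ncard := by
  have h1 : {q : MarkedClass | q.deg = (k, F) ∧ ¬ q.IsGood} =
      (if k = 1 ∧ F = 0 then {leaf False} else ∅) ∪
        node False '' {p : Sym2 MarkedClass | p.addDeg deg = (k, F)} := by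
    ext q
    obtain ⟨m, rfl⟩ | ⟨m, p, rfl⟩ := q.eq_leaf_or_node
    · have h2 : leaf m ∉ node False '' {p : Sym2 MarkedClass | p.addDeg deg = (k, F)} := by
        rintro ⟨p, -, h⟩
        exact leaf_ne_node _ _ _ h.symm
      simp only [Set.mem_union, h2, or_false, Set.mem_ofPred_eq, deg, leaves_leaf, forest_leaf,
        isGood_leaf]
      constructor
      · rintro ⟨h, hm⟩
        rw [if_neg hm] at h
        obtain ⟨rfl, rfl⟩ := Prod.mk.injEq _ _ _ _ ▸ h
        simp [hm]
      · intro h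
        split_ifs at h with h'
        · obtain ⟨rfl, rfl⟩ := h'
          have : m = False := by
            by_contra hm
            have hm : m = True := by simpa using hm
            subst hm
            obtain ⟨hm, -⟩ := MarkedTree.node_iso_iff.1 (of_eq_iff.1 (Set.mem_singleton_iff.1 h))
            exact hm.1 trivial
          simp [this]
        · exact h.elim
    · have h2 : node m p ∉ (if k = 1 ∧ F = 0 then {leaf False} else ∅ : Set MarkedClass) := by
        split_ifs
        · exact fun h => leaf_ne_node _ _ _ (Set.mem_singleton_iff.1 h).symm
        · simp
      simp only [Set.mem_union, h2, false_or, Set.mem_ofPred_eq, isGood_node, Set.mem_image,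
        node_eq_iff]
      induction p with | _ a b
      constructor
      · rintro ⟨h, hm⟩
        refine ⟨s(a, b), ?_, by simp [hm], rfl⟩
        rw [deg, leaves_node, forest_node, if_neg hm] at h
        exact h
      · rintro ⟨p, hp, hm, rfl⟩
        subst hm
        refine ⟨?_, id⟩
        rw [deg, leaves_node, forest_node, if_neg id]
        exact hp
  rw [h1, Set.ncard_union_eq ?_ (by split_ifs <;> simp) ((finite_pair_deg_eq _).image _),
    Set.ncard_image_of_injective _ fun p p' h => (node_eq_iff.1 h).2]
  · congr 1
    split_ifs <;> simp
  · rw [Set.disjoint_left]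
    rintro q hq ⟨p, -, rfl⟩
    split_ifs at hq
    · exact leaf_ne_node _ _ _ (Set.mem_singleton_iff.1 hq).symm
    · exact hq

open Classical in
-- As for an unmarked root, except that the root now joins the forest below it into `mk F`, and `mk`
-- loses no information.
theorem ncard_good (k : ℕ) (F : Multiset TreeClass) :
    {q : MarkedClass | q.deg = (k, {TreeClass.mk F}) ∧ q.IsGood}.ncard =
      (if k = 1 ∧ F = 0 then 1 else 0) +
      {p : Sym2 MarkedClass | p.addDeg deg = (k, F)}.ncard := by
  have h1 : {q : MarkedClass | q.deg = (k, {TreeClass.mk F}) ∧ q.IsGood} =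
      (if k = 1 ∧ F = 0 then {leaf True} else ∅) ∪
        node True '' {p : Sym2 MarkedClass | p.addDeg deg = (k, F)} := by
    ext q
    obtain ⟨m, rfl⟩ | ⟨m, p, rfl⟩ := q.eq_leaf_or_node
    · have h2 : leaf m ∉ node True '' {p : Sym2 MarkedClass | p.addDeg deg = (k, F)} := by
        rintro ⟨p, -, h⟩
        exact leaf_ne_node _ _ _ h.symm
      simp only [Set.mem_union, h2, or_false, Set.mem_ofPred_eq, deg, leaves_leaf, forest_leaf,
        isGood_leaf]
      constructor
      · rintro ⟨h, hm⟩
        rw [if_pos hm, Prod.mk.injEq, Multiset.singleton_inj] at h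
        obtain ⟨rfl, h⟩ := h
        obtain rfl := mk_injective h
        simp [hm]
      · intro h
        split_ifs at h with h'
        · obtain ⟨rfl, rfl⟩ := h'
          have : m = True := by
            by_contra hm
            have hm : m = False := by simpa using hm
            subst hm
            obtain ⟨hm, -⟩ := MarkedTree.node_iso_iff.1 (of_eq_iff.1 (Set.mem_singleton_iff.1 h))
            exact hm.2 trivial
          simp [this]
        · exact h.elim
    · have h2 : node m p ∉ (if k = 1 ∧ F = 0 then {leaf True} else ∅ : Set MarkedClass) := by
        split_ifs
        · exact fun h => leaf_ne_node _ _ _ (Set.mem_singleton_iff.1 h).symm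
        · simp
      simp only [Set.mem_union, h2, false_or, Set.mem_ofPred_eq, isGood_node, Set.mem_image,
        node_eq_iff]
      induction p with | _ a b
      constructor
      · rintro ⟨h, hm⟩
        refine ⟨s(a, b), ?_, by simp [hm], rfl⟩
        rw [deg, leaves_node, forest_node, if_pos hm, Prod.mk.injEq, Multiset.singleton_inj] at h
        exact Prod.ext h.1 (mk_injective h.2)
      · rintro ⟨p, hp, hm, rfl⟩
        subst hm
        refine ⟨?_, trivial⟩
        rw [deg, leaves_node, forest_node, if_pos trivial]
        obtain ⟨h1, h2⟩ := (Prod.mk.injEq _ _ _ _ ▸ hp : _ ∧ _)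
        exact Prod.ext h1 (congrArg (fun G => {TreeClass.mk G}) h2)
  rw [h1, Set.ncard_union_eq ?_ (by split_ifs <;> simp) ((finite_pair_deg_eq _).image _),
    Set.ncard_image_of_injective _ fun p p' h => (node_eq_iff.1 h).2]
  · congr 1
    split_ifs <;> simp
  · rw [Set.disjoint_left]
    rintro q hq ⟨p, -, rfl⟩
    split_ifs at hq
    · exact leaf_ne_node _ _ _ (Set.mem_singleton_iff.1 hq).symm
    · exact hq

/-- A marked root is a maximum of the marked poset, which is therefore a single tree. Hence empty
forests and forests of several trees force an unmarked root. -/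
theorem forest_of_isGood {q : MarkedClass} (h : q.IsGood) : ∃ F, q.forest = {TreeClass.mk F} := by
  obtain ⟨m, rfl⟩ | ⟨m, p, rfl⟩ := q.eq_leaf_or_node
  · rw [isGood_leaf] at h
    exact ⟨0, by rw [forest_leaf, if_pos h]⟩
  · rw [isGood_node] at h
    induction p with | _ a b
    exact ⟨_, by rw [forest_node, if_pos h]⟩

theorem ncard_eq_good_add_not_good (γ : ℕ × Multiset TreeClass) :
    {q : MarkedClass | q.deg = γ}.ncard = {q : MarkedClass | q.deg = γ ∧ q.IsGood}.ncard +
      {q : MarkedClass | q.deg = γ ∧ ¬ q.IsGood}.ncard := by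
  rw [← Set.ncard_union_eq ?_ ((finite_deg_eq γ).subset fun _ h => h.1)
    ((finite_deg_eq γ).subset fun _ h => h.1)]
  · congr 1
    ext q
    simp only [Set.mem_union, Set.mem_ofPred_eq]
    tauto
  · rw [Set.disjoint_left]
    exact fun q h h' => h'.2 h.2

open Classical in
theorem goodSeries_mk (F : Multiset TreeClass) :
    goodSeries (TreeClass.mk F) = (if F = 0 then X else 0) + pairSeries F := by
  ext k
  rw [goodSeries, coeff_mk, ncard_good, map_add, pairSeries, coeff_mk]
  split_ifs <;> simp_all [coeff_X]

theorem allSeries_singleton (S : TreeClass) : allSeries {S} = goodSeries S + pairSeries {S} := by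
  ext k
  rw [allSeries, coeff_mk, ncard_eq_good_add_not_good, ncard_not_good, map_add, goodSeries,
    pairSeries, coeff_mk, coeff_mk]
  simp

theorem allSeries_zero : allSeries 0 = X + pairSeries 0 := by
  ext k
  have : {q : MarkedClass | q.deg = (k, 0) ∧ q.IsGood} = ∅ := by
    rw [Set.eq_empty_iff_forall_notMem]
    rintro q ⟨h, h'⟩
    obtain ⟨F, hF⟩ := forest_of_isGood h'
    have h1 : q.forest = 0 := congrArg Prod.snd h
    simp [hF] at h1
  rw [allSeries, coeff_mk, ncard_eq_good_add_not_good, this, ncard_not_good, map_add,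
    pairSeries, coeff_mk]
  split_ifs <;> simp_all [coeff_X]

theorem allSeries_of_two_le {F : Multiset TreeClass} (hF : 2 ≤ F.card) :
    allSeries F = pairSeries F := by
  ext k
  have : {q : MarkedClass | q.deg = (k, F) ∧ q.IsGood} = ∅ := by
    rw [Set.eq_empty_iff_forall_notMem]
    rintro q ⟨h, h'⟩
    obtain ⟨G, hG⟩ := forest_of_isGood h'
    have h1 : q.forest = F := congrArg Prod.snd h
    rw [← h1, hG] at hF
    simp at hF
  rw [allSeries, coeff_mk, ncard_eq_good_add_not_good, this, ncard_not_good,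
    pairSeries, coeff_mk]
  have : F ≠ 0 := by
    rintro rfl
    simp at hF
  simp [this]

end MarkedClass

/-! ### Embeddings as marked classes -/

namespace RTree

open MarkedClass

/-- A binary tree with an embedded tree is a binary tree with marked vertices. -/
def Embedding.toMarkedClass {S T : RTree} (hT : T.IsBinary) : Embedding S T → MarkedClass :=
  Quotient.lift (fun E => of ⟨⟨T, E.1⟩, hT⟩) fun E F ⟨f, hf⟩ => of_eq_iff.2
    ⟨f, fun v => by rw [← hf, f.injective.mem_set_image]⟩

/-- An isomorphism between two markings of the same tree is an automorphism that carries one copy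
onto the other. -/
theorem Embedding.toMarkedClass_injective {S T : RTree} (hT : T.IsBinary) :
    Function.Injective (Embedding.toMarkedClass (S := S) hT) := by
  intro e e' h
  induction e using Quotient.inductionOn with | h E
  induction e' using Quotient.inductionOn with | h E'
  obtain ⟨f, hf⟩ := of_eq_iff.1 h
  refine Quotient.sound ⟨f, ?_⟩
  ext v
  obtain ⟨w, rfl⟩ := f.surjective v
  rw [f.injective.mem_set_image]
  exact hf w

theorem Embedding.isGood_toMarkedClass {S T : RTree} (hT : T.IsBinary) (e : Embedding S T) :
    (e.toMarkedClass hT).IsGood ↔ e.IsGood := by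
  induction e using Quotient.inductionOn with | h E
  exact Iff.rfl

theorem Embedding.forest_toMarkedClass {S T : RTree} (hT : T.IsBinary) (e : Embedding S T) :
    (e.toMarkedClass hT).forest = {S.cls} := by
  induction e using Quotient.inductionOn with | h E
  exact (MarkedTree.isForest_forest ⟨T, E.1⟩).unique ((IsForest.singleton_iff S).2 E.2)

/-- A representative of a non-plane binary tree. -/
noncomputable def NonPlaneBinary.out {n : ℕ} (T : NonPlaneBinary n) :
    {T : RTree // T.IsBinary ∧ T.size = n} :=
  Quotient.out (s := binarySetoid n) T

theorem NonPlaneBinary.mk_out {n : ℕ} (T : NonPlaneBinary n) :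
    Quotient.mk (binarySetoid n) T.out = T := Quotient.out_eq (s := binarySetoid n) T

/-- Summation over host trees becomes one count of marked classes. The predicate `p` covers all
embeddings and good embeddings together. -/
theorem sum_card_embedding (n : ℕ) (S : RTree) (p : MarkedClass → Prop) :
    ∑ T : NonPlaneBinary n,
        Nat.card {e : Embedding S T.out.1 // p (e.toMarkedClass T.out.2.1)} =
      {q : MarkedClass | (q.size = n ∧ q.forest = {S.cls}) ∧ p q}.ncard := by
  have hV : ∀ T : RTree, Finite T.Vertex := finite_vertex
  have hE : ∀ T : RTree, Finite (Embedding S T) := fun T => by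
    have : Finite (Copy S T) := Subtype.finite
    exact Quotient.finite _
  have hs : ∀ T : NonPlaneBinary n,
      Finite {e : Embedding S T.out.1 // p (e.toMarkedClass T.out.2.1)} := fun T => Subtype.finite
  rw [← Nat.card_sigma, ← Nat.card_coe_set_eq]
  refine Nat.card_eq_of_bijective
    (fun x => ⟨x.2.1.toMarkedClass x.1.out.2.1, ⟨?_, x.2.1.forest_toMarkedClass _⟩, x.2.2⟩) ⟨?_, ?_⟩
  · obtain ⟨T, ⟨e, he⟩⟩ := x
    induction e using Quotient.inductionOn with | h E
    exact T.out.2.2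
  · rintro ⟨T, e, he⟩ ⟨T', e', he'⟩ h0
    have h : e.toMarkedClass T.out.2.1 = e'.toMarkedClass T'.out.2.1 := congrArg Subtype.val h0
    have hT : T = T' := by
      rw [← T.mk_out, ← T'.mk_out]
      clear h0 he he'
      induction e using Quotient.inductionOn with | h E
      induction e' using Quotient.inductionOn with | h E'
      obtain ⟨f, -⟩ := of_eq_iff.1 h
      exact Quotient.sound (s := binarySetoid n) ⟨f⟩
    subst hT
    obtain rfl := Embedding.toMarkedClass_injective _ h
    rfl
  · rintro ⟨q, ⟨hq, hq'⟩, hp⟩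
    obtain ⟨⟨⟨T, E⟩, hT⟩, rfl⟩ := q.exists_of
    let T' : NonPlaneBinary n := Quotient.mk (binarySetoid n) ⟨T, hT, hq⟩
    obtain ⟨f⟩ : T'.out.1.Iso T := Quotient.exact (s := binarySetoid n) T'.mk_out
    have hE : Nonempty (S.Vertex ≃o E) := by
      rw [← IsForest.singleton_iff, ← hq']
      exact MarkedTree.isForest_forest ⟨T, E⟩
    -- The marks are transported to the chosen representative of the host tree.
    let e : Embedding S T'.out.1 :=
      Quotient.mk (copySetoid _ _) (copyCongr S f.symm ⟨E, hE⟩)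
    have he : e.toMarkedClass T'.out.2.1 = of ⟨⟨T, E⟩, hT⟩ := by
      refine of_eq_iff.2 ⟨f, fun v => ?_⟩
      change v ∈ f.symm '' E ↔ f v ∈ E
      obtain ⟨w, rfl⟩ := f.symm.surjective v
      rw [f.symm.injective.mem_set_image, f.apply_symm_apply]
    exact ⟨⟨T', e, by rwa [he]⟩, Subtype.ext he⟩

theorem totalEmb_eq_ncard (n : ℕ) (S : RTree) :
    totalEmb n S = {q : MarkedClass | q.size = n ∧ q.forest = {S.cls}}.ncard := by
  have := sum_card_embedding n S (fun _ => True)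
  simp only [and_true] at this
  rw [totalEmb, ← this]
  refine Finset.sum_congr rfl fun T _ => ?_
  conv_lhs => rw [← T.mk_out]
  exact (Nat.card_congr (Equiv.subtypeUnivEquiv fun _ => trivial)).symm

theorem totalGoodEmb_eq_ncard (n : ℕ) (S : RTree) :
    totalGoodEmb n S =
      {q : MarkedClass | (q.size = n ∧ q.forest = {S.cls}) ∧ q.IsGood}.ncard := by
  rw [totalGoodEmb, ← sum_card_embedding n S IsGood]
  refine Finset.sum_congr rfl fun T _ => ?_
  conv_lhs => rw [← T.mk_out]
  exact Nat.card_congr (Equiv.subtypeEquivRight fun e => (e.isGood_toMarkedClass T.out.2.1).symm)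

theorem numBinary_eq_ncard (n : ℕ) :
    numBinary n = {q : MarkedClass | q.size = n ∧ q.forest = 0}.ncard := by
  rw [numBinary, ← Nat.card_eq_fintype_card, ← Nat.card_coe_set_eq]
  refine Nat.card_eq_of_bijective (Quotient.lift (fun T => ⟨of ⟨⟨T.1, ∅⟩, T.2.1⟩, T.2.2, ?_⟩)
    fun T T' ⟨f⟩ => Subtype.ext (of_eq_iff.2 ⟨f, by simp⟩)) ⟨?_, ?_⟩
  · exact (MarkedTree.isForest_forest ⟨T.1, ∅⟩).unique (IsForest.zero_iff.2 (by simp))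
  · intro q q' h
    induction q using Quotient.inductionOn with | h T
    induction q' using Quotient.inductionOn with | h T'
    obtain ⟨f, -⟩ := of_eq_iff.1 (congrArg Subtype.val h)
    exact Quotient.sound (s := binarySetoid n) ⟨f⟩
  · rintro ⟨q, hq, hq'⟩
    obtain ⟨⟨⟨T, E⟩, hT⟩, rfl⟩ := q.exists_of
    have hE : IsEmpty E := by
      rw [← IsForest.zero_iff, ← hq']
      exact MarkedTree.isForest_forest ⟨T, E⟩
    obtain rfl := Set.isEmpty_coe_sort.1 hE
    exact ⟨Quotient.mk (binarySetoid n) ⟨T, hT, hq⟩, rfl⟩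

theorem setOf_size_eq {n : ℕ} (hn : Odd n) (p : MarkedClass → Prop) :
    {q : MarkedClass | q.size = n ∧ p q} = {q | q.leaves = (n + 1) / 2 ∧ p q} := by
  ext q
  have := q.size_add_one
  obtain ⟨j, rfl⟩ := hn
  simp only [Set.mem_ofPred_eq]
  refine and_congr_left fun _ => ?_
  omega

theorem totalEmb_eq_coeff {n : ℕ} (hn : Odd n) (S : RTree) :
    (totalEmb n S : ℝ) = (allSeries {S.cls}).coeff ((n + 1) / 2) := by
  rw [totalEmb_eq_ncard, setOf_size_eq hn, allSeries, PowerSeries.coeff_mk]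
  simp only [deg, Prod.mk.injEq]

theorem totalGoodEmb_eq_coeff {n : ℕ} (hn : Odd n) (S : RTree) :
    (totalGoodEmb n S : ℝ) = (goodSeries S.cls).coeff ((n + 1) / 2) := by
  simp only [totalGoodEmb_eq_ncard, and_assoc]
  rw [setOf_size_eq hn, goodSeries, PowerSeries.coeff_mk]
  simp only [deg, Prod.mk.injEq, and_assoc]

theorem numBinary_eq_coeff {n : ℕ} (hn : Odd n) :
    (numBinary n : ℝ) = (allSeries 0).coeff ((n + 1) / 2) := by
  rw [numBinary_eq_ncard, setOf_size_eq hn, allSeries, PowerSeries.coeff_mk]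
  simp only [deg, Prod.mk.injEq]

theorem setOf_size_eq_empty {n : ℕ} (hn : Even n) (p : MarkedClass → Prop) :
    {q : MarkedClass | q.size = n ∧ p q} = ∅ := by
  rw [Set.eq_empty_iff_forall_notMem]
  rintro q ⟨h, -⟩
  have := q.size_add_one
  obtain ⟨j, rfl⟩ := hn
  omega

theorem totalEmb_of_even {n : ℕ} (hn : Even n) (S : RTree) : totalEmb n S = 0 := by
  rw [totalEmb_eq_ncard, setOf_size_eq_empty hn, Set.ncard_empty]

theorem totalGoodEmb_of_even {n : ℕ} (hn : Even n) (S : RTree) : totalGoodEmb n S = 0 := by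
  simp only [totalGoodEmb_eq_ncard, and_assoc]
  rw [setOf_size_eq_empty hn, Set.ncard_empty]

theorem numBinary_of_even {n : ℕ} (hn : Even n) : numBinary n = 0 := by
  rw [numBinary_eq_ncard, setOf_size_eq_empty hn, Set.ncard_empty]

end RTree

/-! ### The symmetry constant and its recursion -/

namespace UBTree

open RTree TreeClass

/-- The forest that remains when the auxiliary vertices are contracted or deleted. -/
noncomputable def forest : UBTree → Multiset TreeClass
  | leaf => {mk 0}
  | unary t => {mk (forest t)}
  | binary x l r => bif x then forest l + forest r else {mk (forest l + forest r)}

/-- Below every unary vertex there is a single tree. -/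
def Valid : UBTree → Prop
  | leaf => True
  | unary t => Valid t ∧ (forest t).card = 1
  | binary _ l r => Valid l ∧ Valid r

theorem Iso.forest_eq {s t : UBTree} (h : Iso s t) : s.forest = t.forest := by
  induction h with
  | leaf => rfl
  | unary _ ih => simp only [forest, ih]
  | binary _ _ ih1 ih2 => simp only [forest, ih1, ih2]
  | swap _ _ ih1 ih2 => simp only [forest, ih1, ih2, add_comm]

theorem Iso.valid_iff {s t : UBTree} (h : Iso s t) : s.Valid ↔ t.Valid := by
  induction h with
  | leaf => rfl
  | unary h ih => simp only [Valid, ih, h.forest_eq]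
  | binary _ _ ih1 ih2 => simp only [Valid, ih1, ih2]
  | swap _ _ ih1 ih2 => simp only [Valid, ih1, ih2, and_comm]

theorem Refines.forest_eq {t : UBTree} {F : List RTree} (h : Refines t F) :
    t.forest = (F.map cls : Multiset TreeClass) := by
  induction h with
  | leaf => simp [forest, cls_ofList]
  | unary _ ih => simp [forest, cls_ofList, ih]
  | binary _ _ ih1 ih2 => simp [forest, cls_ofList, ih1, ih2]
  | aux _ _ ih1 ih2 => simp [forest, ih1, ih2]

theorem Refines.valid {t : UBTree} {F : List RTree} (h : Refines t F) : t.Valid := by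
  induction h with
  | leaf => trivial
  | unary h ih => exact ⟨ih, by simp [h.forest_eq]⟩
  | binary _ _ ih1 ih2 => exact ⟨ih1, ih2⟩
  | aux _ _ ih1 ih2 => exact ⟨ih1, ih2⟩

theorem Valid.exists_refines {t : UBTree} (h : t.Valid) : ∃ F, Refines t F := by
  induction t with
  | leaf => exact ⟨_, .leaf⟩
  | unary t ih =>
    obtain ⟨F, hF⟩ := ih h.1
    have hc := h.2
    rw [hF.forest_eq, Multiset.coe_card, List.length_map, List.length_eq_one_iff] at hc
    obtain ⟨S, rfl⟩ := hc
    exact ⟨_, .unary hF⟩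
  | binary x l r ihl ihr =>
    obtain ⟨F, hF⟩ := ihl h.1
    obtain ⟨G, hG⟩ := ihr h.2
    cases x
    · exact ⟨_, .binary hF hG⟩
    · exact ⟨_, .aux hF hG⟩

/-- Replaces the existence of a plane representative by a condition on forests that is visibly
invariant under isomorphism and can be evaluated recursively. -/
theorem isReplacement_iff {S : RTree} {t : UBTree} :
    IsReplacement S t ↔ t.Valid ∧ t.forest = {S.cls} := by
  constructor
  · rintro ⟨S', hS, h⟩
    refine ⟨h.valid, ?_⟩
    rw [h.forest_eq, List.map_singleton, Multiset.coe_singleton, cls_eq_iff.2 hS]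
  · rintro ⟨h, hS⟩
    obtain ⟨F, hF⟩ := h.exists_refines
    rw [hF.forest_eq] at hS
    have hc := congrArg Multiset.card hS
    rw [Multiset.coe_card, List.length_map, Multiset.card_singleton, List.length_eq_one_iff] at hc
    obtain ⟨S', rfl⟩ := hc
    rw [List.map_singleton, Multiset.coe_singleton, Multiset.singleton_inj, cls_eq_iff] at hS
    exact ⟨S', hS, hF⟩

/-- Gives finiteness of the trees over a given forest, and that no forest is empty. -/
theorem size_add_one_le (t : UBTree) : t.size + 1 ≤ 2 * (t.forest.map TreeClass.size).sum := by
  induction t with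
  | leaf => simp [size, forest, size_mk]
  | unary t ih => simp [size, forest, size_mk] at *; omega
  | binary x l r ihl ihr => cases x <;> simp [size, forest, size_mk] at * <;> omega

/-- Isomorphism of unary-binary trees with auxiliary vertices. -/
def isoSetoid : Setoid UBTree := ⟨Iso, Iso.refl, Iso.symm, Iso.trans⟩

end UBTree

/-- Isomorphism classes of unary-binary trees with auxiliary vertices. -/
def UBClass : Type := Quotient UBTree.isoSetoid

namespace UBClass

open TreeClass

/-- The isomorphism class of a unary-binary tree. -/
def of (t : UBTree) : UBClass := Quotient.mk UBTree.isoSetoid t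

theorem of_eq_iff {s t : UBTree} : of s = of t ↔ s.Iso t := Quotient.eq (r := UBTree.isoSetoid)

theorem exists_of (q : UBClass) : ∃ t, q = of t := by
  obtain ⟨t, rfl⟩ := Quotient.exists_rep q
  exact ⟨t, rfl⟩

/-- The forest that remains when the auxiliary vertices are contracted or deleted. -/
noncomputable def forest : UBClass → Multiset TreeClass :=
  Quotient.lift UBTree.forest fun _ _ h => UBTree.Iso.forest_eq h

open Classical in
/-- The weight `(1/2) ^ s` of a class with `s` symmetry vertices, and zero for trees that are not
obtained by replacement. -/
noncomputable def weight : UBClass → ℝ :=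
  Quotient.lift (fun t => if t.Valid then (1 / 2 : ℝ) ^ t.sym else 0) fun s t h => by
    simp only [UBTree.Iso.valid_iff h, UBTree.sym_congr h]

theorem weight_of_valid {t : UBTree} (h : t.Valid) : (of t).weight = (1 / 2 : ℝ) ^ t.sym :=
  if_pos h

theorem weight_of_not_valid {t : UBTree} (h : ¬ t.Valid) : (of t).weight = 0 := if_neg h

theorem finite_forest_eq (F : Multiset TreeClass) : {q : UBClass | q.forest = F}.Finite := by
  refine ((UBTree.finite_size_le (2 * (F.map TreeClass.size).sum)).image of).subset ?_
  rintro q rfl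
  obtain ⟨t, rfl⟩ := q.exists_of
  have := t.size_add_one_le
  exact ⟨t, by change t.size ≤ 2 * (t.forest.map TreeClass.size).sum; omega, rfl⟩

/-- The binary vertex with an unordered pair of subtrees. -/
def binary (x : Bool) : Sym2 UBClass → UBClass :=
  Sym2.lift ⟨Quotient.lift₂ (fun l r => of (.binary x l r)) fun _ _ _ _ h h' =>
    of_eq_iff.2 (.binary h h'), fun a b => by
      obtain ⟨l, rfl⟩ := a.exists_of
      obtain ⟨r, rfl⟩ := b.exists_of
      exact of_eq_iff.2 (.swap (.refl _) (.refl _))⟩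

theorem binary_mk (x : Bool) (l r : UBTree) : binary x s(of l, of r) = of (.binary x l r) := rfl

theorem binary_injective (x : Bool) : Function.Injective (binary x) := by
  intro p p' h
  induction p with | _ a b
  induction p' with | _ a' b'
  obtain ⟨l, rfl⟩ := a.exists_of
  obtain ⟨r, rfl⟩ := b.exists_of
  obtain ⟨l', rfl⟩ := a'.exists_of
  obtain ⟨r', rfl⟩ := b'.exists_of
  rw [binary_mk, binary_mk, of_eq_iff] at h
  rw [Sym2.eq_iff]
  cases h with
  | binary h h' => exact Or.inl ⟨of_eq_iff.2 h, of_eq_iff.2 h'⟩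
  | swap h h' => exact Or.inr ⟨of_eq_iff.2 h, of_eq_iff.2 h'⟩

open Classical in
-- The root is a symmetry vertex exactly for a diagonal pair. Its extra factor is thus 1/2 on the
-- diagonal and 1 elsewhere, which cancels the multiplicities in `sum_sym2_deg_eq`.
theorem weight_binary (x : Bool) (p : Sym2 UBClass) :
    weight (binary x p) = p.mulWeight weight * (if p.IsDiag then 1 else 2) / 2 := by
  induction p with | _ a b
  obtain ⟨l, rfl⟩ := a.exists_of
  obtain ⟨r, rfl⟩ := b.exists_of
  rw [binary_mk]
  simp only [Sym2.mk_isDiag_iff, of_eq_iff, Sym2.mulWeight, Sym2.lift_mk]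
  by_cases h : l.Valid ∧ r.Valid
  · rw [weight_of_valid h.1, weight_of_valid h.2, weight_of_valid (t := .binary x l r) h]
    simp only [UBTree.sym]
    split_ifs <;> ring
  · rw [weight_of_not_valid (t := .binary x l r) h]
    rcases not_and_or.1 h with h | h <;> simp [weight_of_not_valid h]

theorem weight_nonneg (q : UBClass) : 0 ≤ q.weight := by
  obtain ⟨t, rfl⟩ := q.exists_of
  simp only [weight, of, Quotient.lift_mk]
  split_ifs <;> positivity

theorem forest_binary_true (p : Sym2 UBClass) : (binary true p).forest = p.addDeg forest := by
  induction p with | _ a b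
  obtain ⟨l, rfl⟩ := a.exists_of
  obtain ⟨r, rfl⟩ := b.exists_of
  rfl

theorem forest_binary_false (p : Sym2 UBClass) :
    (binary false p).forest = {mk (p.addDeg forest)} := by
  induction p with | _ a b
  obtain ⟨l, rfl⟩ := a.exists_of
  obtain ⟨r, rfl⟩ := b.exists_of
  rfl

theorem _root_.UBTree.forest_ne_zero (t : UBTree) : t.forest ≠ 0 := by
  intro h
  have := t.size_add_one_le
  simp [h] at this

/-- The sum of the weights of the unary-binary trees that arise from the forest `F`. -/
noncomputable def constant (F : Multiset TreeClass) : ℝ :=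
  ∑ q ∈ (finite_forest_eq F).toFinset, q.weight

theorem constant_zero : constant 0 = 0 := by
  rw [constant]
  refine Finset.sum_eq_zero fun q hq => ?_
  obtain ⟨t, rfl⟩ := q.exists_of
  exact absurd ((finite_forest_eq 0).mem_toFinset.1 hq) t.forest_ne_zero

theorem sum_sym2_weight (x : Bool) (F : Multiset TreeClass) :
    ∑ p ∈ (finite_sym2_deg_eq finite_forest_eq fun _ => Multiset.mem_splittings (F := F)).toFinset,
      weight (binary x p) = (∑ d ∈ F.splittings, constant d.1 * constant d.2) / 2 := by
  classical
  have := sum_sym2_deg_eq finite_forest_eq (fun _ => Multiset.mem_splittings (F := F)) weight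
  simp only [constant]
  rw [← this, Finset.sum_div]
  exact Finset.sum_congr rfl fun p _ => weight_binary x p

theorem constant_mk_zero : constant {mk 0} = 1 := by
  have h : (finite_forest_eq {mk 0}).toFinset = {of .leaf} := by
    ext q
    rw [Set.Finite.mem_toFinset, Finset.mem_singleton, Set.mem_ofPred_eq]
    obtain ⟨t, rfl⟩ := q.exists_of
    constructor
    · intro h
      change t.forest = _ at h
      rcases t with _ | t | ⟨_ | _, l, r⟩
      · rfl
      · exact absurd (mk_injective (Multiset.singleton_inj.1 h)) t.forest_ne_zero
      · have := mk_injective (Multiset.singleton_inj.1 h)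
        simp [UBTree.forest_ne_zero] at this
      · change l.forest + r.forest = _ at h
        have := congrArg Multiset.card h
        have hl := Multiset.card_pos.2 l.forest_ne_zero
        have hr := Multiset.card_pos.2 r.forest_ne_zero
        simp only [Multiset.card_add, Multiset.card_singleton] at this
        omega
    · intro h
      rw [h]
      rfl
  rw [constant, h, Finset.sum_singleton]
  simp [weight, of, UBTree.Valid, UBTree.sym]

/-- Only an auxiliary root leaves more than one tree, and its two subtrees split the forest. -/
theorem constant_of_two_le {F : Multiset TreeClass} (hF : 2 ≤ F.card) :
    constant F = (∑ d ∈ F.splittings, constant d.1 * constant d.2) / 2 := by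
  rw [← sum_sym2_weight true, constant]
  symm
  refine Finset.sum_of_injOn (binary true) (binary_injective _).injOn ?_ ?_ fun _ _ => rfl
  · intro p hp
    rw [Finset.mem_coe, Set.Finite.mem_toFinset] at hp ⊢
    change (binary true p).forest = F
    rwa [forest_binary_true]
  · intro q hq hq'
    exfalso
    rw [Set.Finite.mem_toFinset] at hq
    obtain ⟨t, rfl⟩ := q.exists_of
    have ht : t.forest = F := hq
    rcases t with _ | t | ⟨_ | _, l, r⟩
    · simp [← ht, UBTree.forest] at hF
    · simp [← ht, UBTree.forest] at hF
    · simp [← ht, UBTree.forest] at hF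
    · exact hq' ⟨s(of l, of r), (Set.Finite.mem_toFinset _).2 ht, rfl⟩

/-- For one tree the root is unary and adds no symmetry. For several trees it is a binary
non-auxiliary vertex, giving the same sum as an auxiliary one; a unary root is then invalid and has
weight zero. -/
theorem constant_mk {F : Multiset TreeClass} (hF : F ≠ 0) : constant {mk F} = constant F := by
  rcases Nat.lt_or_ge F.card 2 with h | h
  · have hc : F.card = 1 := by
      have := Multiset.card_pos.2 hF
      omega
    rw [constant, constant]
    symm
    refine Finset.sum_of_injOn (Quotient.lift (fun t => of (.unary t)) fun _ _ h =>
      of_eq_iff.2 (.unary h)) ?_ ?_ ?_ ?_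
    · intro q _ q' _ h
      obtain ⟨t, rfl⟩ := q.exists_of
      obtain ⟨t', rfl⟩ := q'.exists_of
      rcases of_eq_iff.1 h with _ | h
      exact of_eq_iff.2 h
    · intro q hq
      obtain ⟨t, rfl⟩ := q.exists_of
      rw [Finset.mem_coe, Set.Finite.mem_toFinset] at hq ⊢
      change UBTree.forest (.unary t) = _
      rw [UBTree.forest, show t.forest = F from hq]
    · intro q hq hq'
      exfalso
      rw [Set.Finite.mem_toFinset] at hq
      obtain ⟨t, rfl⟩ := q.exists_of
      have ht : t.forest = {mk F} := hq
      rcases t with _ | t | ⟨_ | _, l, r⟩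
      · exact hF (mk_injective (Multiset.singleton_inj.1 ht)).symm
      · refine hq' ⟨of t, ?_, rfl⟩
        rw [Finset.mem_coe, Set.Finite.mem_toFinset]
        exact mk_injective (Multiset.singleton_inj.1 ht)
      · have := mk_injective (Multiset.singleton_inj.1 ht)
        have := congrArg Multiset.card this
        have hl := Multiset.card_pos.2 l.forest_ne_zero
        have hr := Multiset.card_pos.2 r.forest_ne_zero
        simp only [Multiset.card_add] at this
        omega
      · change l.forest + r.forest = _ at ht
        have := congrArg Multiset.card ht
        have hl := Multiset.card_pos.2 l.forest_ne_zero
        have hr := Multiset.card_pos.2 r.forest_ne_zero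
        simp only [Multiset.card_add, Multiset.card_singleton] at this
        omega
    · intro q hq
      rw [Set.Finite.mem_toFinset] at hq
      obtain ⟨t, rfl⟩ := q.exists_of
      have ht : t.forest = F := hq
      change _ = (of (.unary t)).weight
      by_cases h : t.Valid
      · have h' : (UBTree.unary t).Valid := ⟨h, by rw [ht, hc]⟩
        rw [weight_of_valid h, weight_of_valid h']
        rfl
      · have h' : ¬ (UBTree.unary t).Valid := fun h' => h h'.1
        rw [weight_of_not_valid h, weight_of_not_valid h']
  · rw [constant_of_two_le h, ← sum_sym2_weight false, constant]
    symm
    refine Finset.sum_of_injOn (binary false) (binary_injective _).injOn ?_ ?_ fun _ _ => rfl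
    · intro p hp
      rw [Finset.mem_coe, Set.Finite.mem_toFinset] at hp ⊢
      change (binary false p).forest = {mk F}
      rw [forest_binary_false, show p.addDeg forest = F from hp]
    · intro q hq hq'
      rw [Set.Finite.mem_toFinset] at hq
      obtain ⟨t, rfl⟩ := q.exists_of
      have ht : t.forest = {mk F} := hq
      rcases t with _ | t | ⟨_ | _, l, r⟩
      · exact absurd (mk_injective (Multiset.singleton_inj.1 ht)).symm hF
      · have ht : t.forest = F := mk_injective (Multiset.singleton_inj.1 ht)
        refine weight_of_not_valid fun h' => ?_
        have := h'.2
        rw [ht] at this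
        omega
      · refine absurd ⟨s(of l, of r), ?_, rfl⟩ hq'
        rw [Finset.mem_coe, Set.Finite.mem_toFinset]
        exact mk_injective (Multiset.singleton_inj.1 ht)
      · change l.forest + r.forest = _ at ht
        have := congrArg Multiset.card ht
        have hl := Multiset.card_pos.2 l.forest_ne_zero
        have hr := Multiset.card_pos.2 r.forest_ne_zero
        simp only [Multiset.card_add, Multiset.card_singleton] at this
        omega

theorem symmetryConstant_eq (S : RTree) : S.symmetryConstant = constant {S.cls} := by
  rw [RTree.symmetryConstant, constant]
  refine Finset.sum_of_injOn (Quotient.lift (fun t => of t.1) fun _ _ h => of_eq_iff.2 h)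
    ?_ ?_ ?_ ?_
  · intro q _ q' _ h
    induction q using Quotient.inductionOn with | h t
    induction q' using Quotient.inductionOn with | h t'
    exact Quotient.sound (s := UBTree.replacementSetoid S) (of_eq_iff.1 h)
  · intro q _
    induction q using Quotient.inductionOn with | h t
    rw [Finset.mem_coe, Set.Finite.mem_toFinset]
    exact (UBTree.isReplacement_iff.1 t.2).2
  · intro q hq hq'
    rw [Set.Finite.mem_toFinset] at hq
    obtain ⟨t, rfl⟩ := q.exists_of
    refine weight_of_not_valid fun ht => ?_
    exact hq' ⟨Quotient.mk (UBTree.replacementSetoid S) ⟨t, UBTree.isReplacement_iff.2 ⟨ht, hq⟩⟩,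
      Finset.mem_coe.2 (Finset.mem_univ _), rfl⟩
  · intro q _
    induction q using Quotient.inductionOn with | h t
    exact (weight_of_valid (UBTree.isReplacement_iff.1 t.2).1).symm

theorem constant_nonneg (F : Multiset TreeClass) : 0 ≤ constant F :=
  Finset.sum_nonneg fun q _ => q.weight_nonneg

theorem _root_.TreeClass.size_pos (t : TreeClass) : 0 < t.size := by
  obtain ⟨F, rfl⟩ := t.exists_mk
  rw [size_mk]
  omega

/-- Induction on forests, removing a root or splitting. -/
theorem _root_.TreeClass.forest_induction {p : Multiset TreeClass → Prop} (h0 : p {mk 0})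
    (h1 : ∀ F, F ≠ 0 → p F → p {mk F})
    (h2 : ∀ F, 2 ≤ F.card → (∀ G H, G ≠ 0 → H ≠ 0 → G + H = F → p G) → p F)
    {F : Multiset TreeClass} (hF : F ≠ 0) : p F := by
  induction hn : (F.map size).sum using Nat.strong_induction_on generalizing F with
  | _ n ih =>
    rcases Nat.lt_or_ge F.card 2 with h | h
    · have hc : F.card = 1 := by
        have := Multiset.card_pos.2 hF
        omega
      obtain ⟨t, rfl⟩ := Multiset.card_eq_one.1 hc
      obtain ⟨G, rfl⟩ := t.exists_mk
      by_cases hG : G = 0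
      · rw [hG]
        exact h0
      · refine h1 G hG (ih _ ?_ hG rfl)
        rw [← hn, Multiset.map_singleton, Multiset.sum_singleton, size_mk]
        omega
    · refine h2 F h fun G H hG hH hGH => ih _ ?_ hG rfl
      obtain ⟨t, ht⟩ := Multiset.exists_mem_of_ne_zero hH
      have h3 : t.size ≤ (H.map size).sum :=
        Multiset.single_le_sum (fun _ _ => Nat.zero_le _) _ (Multiset.mem_map_of_mem _ ht)
      have := t.size_pos
      rw [← hn, ← hGH, Multiset.map_add, Multiset.sum_add]
      omega

/-- Splitting off one tree already gives a positive summand. Without positivity the leading term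
could vanish and asymptotic equivalence would fail. -/
theorem constant_pos {F : Multiset TreeClass} (hF : F ≠ 0) : 0 < constant F := by
  refine TreeClass.forest_induction (p := fun F => 0 < constant F) ?_ ?_ ?_ hF
  · rw [constant_mk_zero]
    exact one_pos
  · intro F hF h
    rwa [constant_mk hF]
  · intro F hF ih
    rw [constant_of_two_le hF]
    refine half_pos (Finset.sum_pos' (fun d _ =>
      mul_nonneg (constant_nonneg _) (constant_nonneg _)) ?_)
    obtain ⟨t, ht⟩ := Multiset.card_pos_iff_exists_mem.1 (by omega : 0 < F.card)
    obtain ⟨G, rfl⟩ := Multiset.exists_cons_of_mem ht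
    have hG : G ≠ 0 := by
      rintro rfl
      simp at hF
    refine ⟨({t}, G), by simp, mul_pos (ih _ G (by simp) hG (by simp)) (ih _ {t} hG (by simp) ?_)⟩
    rw [add_comm]
    simp

end UBClass

/-! ### Absolutely convergent power series -/

namespace PowerSeries

variable {𝕜 : Type*} [NormedField 𝕜]

/-- Absolute convergence at radius `r`. -/
def AbsConv (r : ℝ) (f : 𝕜⟦X⟧) : Prop := Summable fun n => ‖coeff n f‖ * r ^ n

/-- The value of a power series at a point. -/
noncomputable def ev (x : 𝕜) (f : 𝕜⟦X⟧) : 𝕜 := ∑' n, coeff n f * x ^ n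

namespace AbsConv

variable {r r' : ℝ} {f g : 𝕜⟦X⟧}

theorem mono (h : AbsConv r f) (h0 : 0 ≤ r') (hr : r' ≤ r) : AbsConv r' f :=
  Summable.of_nonneg_of_le (fun _ => by positivity)
    (fun n => mul_le_mul_of_nonneg_left (pow_le_pow_left₀ h0 hr n) (norm_nonneg _)) h

theorem of_eventually_zero {N : ℕ} (h : ∀ n, N ≤ n → coeff n f = 0) : AbsConv r f :=
  summable_of_ne_finset_zero (s := Finset.range N) fun n hn => by
    rw [h n (by simpa using hn)]
    simp

theorem const (c : 𝕜) : AbsConv r (C c) :=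
  of_eventually_zero (N := 1) fun n hn => by
    rw [coeff_C, if_neg (by omega)]

theorem one : AbsConv r (1 : 𝕜⟦X⟧) := by
  simpa using const (r := r) (1 : 𝕜)

theorem var : AbsConv r (X : 𝕜⟦X⟧) :=
  of_eventually_zero (N := 2) fun n hn => by
    rw [coeff_X, if_neg (by omega)]

theorem neg (hf : AbsConv r f) : AbsConv r (-f) := by
  simpa [AbsConv] using hf

theorem add (h0 : 0 ≤ r) (hf : AbsConv r f) (hg : AbsConv r g) : AbsConv r (f + g) :=
  Summable.of_nonneg_of_le (fun _ => by positivity)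
    (fun n => by
      rw [map_add, ← add_mul]
      exact mul_le_mul_of_nonneg_right (norm_add_le _ _) (by positivity)) (Summable.add hf hg)

theorem mul (h0 : 0 ≤ r) (hf : AbsConv r f) (hg : AbsConv r g) : AbsConv r (f * g) := by
  have hf' : Summable fun n => ‖‖coeff n f‖ * r ^ n‖ := Summable.norm hf
  have hg' : Summable fun n => ‖‖coeff n g‖ * r ^ n‖ := Summable.norm hg
  refine Summable.of_nonneg_of_le (fun _ => by positivity) (fun n => ?_)
    (summable_norm_sum_mul_antidiagonal_of_summable_norm hf' hg')
  rw [coeff_mul]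
  refine le_trans ?_ (le_abs_self _)
  calc _ ≤ (∑ p ∈ Finset.HasAntidiagonal.antidiagonal n, ‖coeff p.1 f * coeff p.2 g‖) * r ^ n :=
        mul_le_mul_of_nonneg_right (norm_sum_le _ _) (by positivity)
    _ = _ := by
        rw [Finset.sum_mul]
        refine Finset.sum_congr rfl fun p hp => ?_
        rw [norm_mul, ← Finset.HasAntidiagonal.mem_antidiagonal.1 hp, pow_add]
        ring

theorem expand_two (hf : AbsConv (r ^ 2) f) : AbsConv r (expand 2 two_ne_zero f) := by
  have hinj : Function.Injective fun n : ℕ => 2 * n := fun a b h => by simpa using h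
  refine (hinj.summable_iff fun n hn => ?_).1 ?_
  · have : ¬ 2 ∣ n := fun ⟨k, hk⟩ => hn ⟨k, hk.symm⟩
    rw [coeff_expand_of_not_dvd _ _ _ this]
    simp
  · refine hf.congr fun n => ?_
    simp only [Function.comp]
    rw [coeff_expand_mul, pow_mul]

theorem summable (hf : AbsConv r f) {x : 𝕜} (hx : ‖x‖ ≤ r) :
    Summable fun n => ‖coeff n f * x ^ n‖ :=
  (hf.mono (norm_nonneg x) hx).congr fun n => by rw [norm_mul, norm_pow]

theorem hasSum [CompleteSpace 𝕜] (hf : AbsConv r f) {x : 𝕜} (hx : ‖x‖ ≤ r) :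
    HasSum (fun n => coeff n f * x ^ n) (ev x f) :=
  (hf.summable hx).of_norm.hasSum

end AbsConv

section ev

variable [CompleteSpace 𝕜] {r : ℝ} {f g : 𝕜⟦X⟧} {x : 𝕜}

theorem ev_add (hf : AbsConv r f) (hg : AbsConv r g) (hx : ‖x‖ ≤ r) :
    ev x (f + g) = ev x f + ev x g := by
  rw [ev, ev, ev, ← Summable.tsum_add (hf.summable hx).of_norm (hg.summable hx).of_norm]
  exact tsum_congr fun n => by rw [map_add, add_mul]

theorem ev_mul (hf : AbsConv r f) (hg : AbsConv r g) (hx : ‖x‖ ≤ r) :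
    ev x (f * g) = ev x f * ev x g := by
  rw [ev, ev, ev, tsum_mul_tsum_eq_tsum_sum_antidiagonal_of_summable_norm (hf.summable hx)
    (hg.summable hx)]
  refine tsum_congr fun n => ?_
  rw [coeff_mul, Finset.sum_mul]
  refine Finset.sum_congr rfl fun p hp => ?_
  rw [← Finset.HasAntidiagonal.mem_antidiagonal.1 hp, pow_add]
  ring

omit [CompleteSpace 𝕜] in
theorem ev_neg : ev x (-f) = - ev x f := by
  rw [ev, ev, ← tsum_neg]
  exact tsum_congr fun n => by simp

omit [CompleteSpace 𝕜] in
theorem ev_C (c : 𝕜) : ev x (C c) = c := by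
  rw [ev, tsum_eq_single 0]
  · simp
  · intro n hn
    simp [coeff_C, hn]

omit [CompleteSpace 𝕜] in
theorem ev_one : ev x (1 : 𝕜⟦X⟧) = 1 := by
  simpa using ev_C (x := x) (1 : 𝕜)

omit [CompleteSpace 𝕜] in
theorem ev_X : ev x (X : 𝕜⟦X⟧) = x := by
  rw [ev, tsum_eq_single 1]
  · simp
  · intro n hn
    simp [coeff_X, hn]

omit [CompleteSpace 𝕜] in
theorem ev_expand_two : ev x (expand 2 two_ne_zero f) = ev (x ^ 2) f := by
  have hinj : Function.Injective fun n : ℕ => 2 * n := fun a b h => by simpa using h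
  rw [ev, ev, ← hinj.tsum_eq (f := fun n => coeff n (expand 2 two_ne_zero f) * x ^ n)]
  · refine tsum_congr fun n => ?_
    rw [coeff_expand_mul, pow_mul]
  · intro n hn
    by_contra hn'
    have : ¬ 2 ∣ n := fun ⟨k, hk⟩ => hn' ⟨k, hk.symm⟩
    rw [Function.mem_support, coeff_expand_of_not_dvd _ _ _ this, zero_mul] at hn
    exact hn rfl

end ev

/-- The power series that converge absolutely at some radius greater than `α`. -/
def overconvergent (𝕜 : Type*) [NormedField 𝕜] {α : ℝ} (hα : 0 ≤ α) : Subring 𝕜⟦X⟧ where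
  carrier := {f | ∃ r, α < r ∧ AbsConv r f}
  mul_mem' := by
    rintro f g ⟨r, hr, hf⟩ ⟨s, hs, hg⟩
    have h0 : 0 ≤ min r s := hα.trans (lt_min hr hs).le
    exact ⟨min r s, lt_min hr hs, (hf.mono h0 (min_le_left _ _)).mul h0
      (hg.mono h0 (min_le_right _ _))⟩
  add_mem' := by
    rintro f g ⟨r, hr, hf⟩ ⟨s, hs, hg⟩
    have h0 : 0 ≤ min r s := hα.trans (lt_min hr hs).le
    exact ⟨min r s, lt_min hr hs, (hf.mono h0 (min_le_left _ _)).add h0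
      (hg.mono h0 (min_le_right _ _))⟩
  neg_mem' := by
    rintro f ⟨r, hr, hf⟩
    exact ⟨r, hr, hf.neg⟩
  one_mem' := ⟨α + 1, by linarith, .one⟩
  zero_mem' := ⟨α + 1, by linarith, .of_eventually_zero (N := 0) fun n _ => by simp⟩

section overconvergent

variable {α : ℝ} {hα : 0 ≤ α} {f g : 𝕜⟦X⟧}

theorem C_mem_overconvergent (c : 𝕜) : C c ∈ overconvergent 𝕜 hα :=
  ⟨α + 1, by linarith, .const c⟩

theorem X_mem_overconvergent : X ∈ overconvergent 𝕜 hα := ⟨α + 1, by linarith, .var⟩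

theorem absConv_of_mem_overconvergent (hf : f ∈ overconvergent 𝕜 hα) : AbsConv α f := by
  obtain ⟨r, hr, hf⟩ := hf
  exact hf.mono hα hr.le

end overconvergent

end PowerSeries

/-- The subring `R + R y` for an element `y` with `y ^ 2 ∈ R`. -/
def Subring.adjoinSqrt {A : Type*} [CommRing A] (R : Subring A) {y : A} (hy : y ^ 2 ∈ R) :
    Subring A where
  carrier := {f | ∃ p ∈ R, ∃ q ∈ R, f = p + q * y}
  mul_mem' := by
    rintro _ _ ⟨p, hp, q, hq, rfl⟩ ⟨p', hp', q', hq', rfl⟩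
    exact ⟨p * p' + q * q' * y ^ 2, R.add_mem (R.mul_mem hp hp') (R.mul_mem (R.mul_mem hq hq') hy),
      p * q' + q * p', R.add_mem (R.mul_mem hp hq') (R.mul_mem hq hp'), by ring⟩
  add_mem' := by
    rintro _ _ ⟨p, hp, q, hq, rfl⟩ ⟨p', hp', q', hq', rfl⟩
    exact ⟨p + p', R.add_mem hp hp', q + q', R.add_mem hq hq', by ring⟩
  neg_mem' := by
    rintro _ ⟨p, hp, q, hq, rfl⟩
    exact ⟨-p, R.neg_mem hp, -q, R.neg_mem hq, by ring⟩
  one_mem' := ⟨1, R.one_mem, 0, R.zero_mem, by ring⟩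
  zero_mem' := ⟨0, R.zero_mem, 0, R.zero_mem, by ring⟩

theorem Subring.le_adjoinSqrt {A : Type*} [CommRing A] (R : Subring A) {y : A} (hy : y ^ 2 ∈ R) :
    R ≤ R.adjoinSqrt hy := fun p hp => ⟨p, hp, 0, R.zero_mem, by ring⟩

theorem Subring.self_mem_adjoinSqrt {A : Type*} [CommRing A] (R : Subring A) {y : A}
    (hy : y ^ 2 ∈ R) : y ∈ R.adjoinSqrt hy := ⟨0, R.zero_mem, 1, R.one_mem, by ring⟩

/-! ### The generating function of binary trees and its radius -/

/-- The generating function of the binary trees by leaves. -/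
noncomputable def leafSeries : PowerSeries ℝ := MarkedClass.allSeries 0

namespace leafSeries

open PowerSeries

/-- The empty forest splits only as 0 + 0 and is its own half. -/
theorem two_mul_eq :
    2 * leafSeries = 2 * X + leafSeries * leafSeries + expand 2 two_ne_zero leafSeries := by
  classical
  have h : ∃ H : Multiset TreeClass, 0 = H + H := ⟨0, rfl⟩
  have hH : h.choose = 0 := (add_eq_zero.1 h.choose_spec.symm).1
  have hs : (0 : Multiset TreeClass).splittings = {(0, 0)} := by
    ext x
    simp [Prod.ext_iff]
  have h1 := MarkedClass.two_mul_pairSeries 0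
  rw [dif_pos h, hH, hs, Finset.sum_singleton] at h1
  rw [leafSeries]
  conv_lhs => rw [MarkedClass.allSeries_zero, mul_add, h1]
  ring

theorem coeff_nonneg (n : ℕ) : 0 ≤ coeff n leafSeries := by
  rw [leafSeries, MarkedClass.allSeries, coeff_mk]
  positivity

theorem coeff_zero : coeff 0 leafSeries = 0 := by
  rw [leafSeries, MarkedClass.allSeries, coeff_mk, Nat.cast_eq_zero,
    Set.ncard_eq_zero (MarkedClass.finite_deg_eq _), Set.eq_empty_iff_forall_notMem]
  intro q hq
  have h1 := q.size_add_one
  have h2 : q.leaves = 0 := congrArg Prod.fst hq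
  omega

theorem two_mul_coeff (n : ℕ) : 2 * coeff n leafSeries = (if n = 1 then 2 else 0) +
    ∑ p ∈ Finset.HasAntidiagonal.antidiagonal n, coeff p.1 leafSeries * coeff p.2 leafSeries +
      if 2 ∣ n then coeff (n / 2) leafSeries else 0 := by
  have h := congrArg (coeff n) two_mul_eq
  have h2 : (2 : ℝ⟦X⟧) = C (2 : ℝ) := (map_ofNat C 2).symm
  rw [h2, coeff_C_mul, map_add, map_add, coeff_C_mul, coeff_X, coeff_mul, coeff_expand] at h
  rw [h]
  simp

/-- The partial sums of the series. -/
noncomputable def partialSum (N : ℕ) (x : ℝ) : ℝ :=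
  ∑ n ∈ Finset.range (N + 1), coeff n leafSeries * x ^ n

theorem partialSum_nonneg (N : ℕ) {x : ℝ} (hx : 0 ≤ x) : 0 ≤ partialSum N x :=
  Finset.sum_nonneg fun n _ => mul_nonneg (coeff_nonneg n) (pow_nonneg hx n)

/-- The constant coefficient vanishes, so products of total degree at most `N + 1` only involve
coefficients up to `N`; the square of the partial sum contains them all. -/
theorem sum_mul_le (N : ℕ) {x : ℝ} (hx : 0 ≤ x) :
    ∑ n ∈ Finset.range (N + 2), (∑ p ∈ Finset.HasAntidiagonal.antidiagonal n,
      coeff p.1 leafSeries * coeff p.2 leafSeries) * x ^ n ≤ partialSum N x ^ 2 := by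
  set F : ℕ × ℕ → ℝ := fun p =>
    (coeff p.1 leafSeries * x ^ p.1) * (coeff p.2 leafSeries * x ^ p.2) with hF
  have hF0 : ∀ p, 0 ≤ F p := fun p => mul_nonneg (mul_nonneg (coeff_nonneg _) (pow_nonneg hx _))
    (mul_nonneg (coeff_nonneg _) (pow_nonneg hx _))
  set Q := (Finset.range (N + 1) ×ˢ Finset.range (N + 1)).filter fun p => p.1 + p.2 < N + 2 with hQ
  have h1 : ∑ n ∈ Finset.range (N + 2), (∑ p ∈ Finset.HasAntidiagonal.antidiagonal n,
      coeff p.1 leafSeries * coeff p.2 leafSeries) * x ^ n = ∑ p ∈ Q, F p := by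
    rw [← Finset.sum_fiberwise_of_maps_to (g := fun p : ℕ × ℕ => p.1 + p.2)
      (t := Finset.range (N + 2)) fun p hp => Finset.mem_range.2 (Finset.mem_filter.1 hp).2]
    refine Finset.sum_congr rfl fun n hn => ?_
    rw [Finset.sum_mul]
    have h2 : ∀ p ∈ Finset.HasAntidiagonal.antidiagonal n,
        coeff p.1 leafSeries * coeff p.2 leafSeries * x ^ n = F p := fun p hp => by
      rw [← Finset.HasAntidiagonal.mem_antidiagonal.1 hp, pow_add, hF]
      ring
    rw [Finset.sum_congr rfl h2]
    symm
    refine Finset.sum_subset (fun p hp => ?_) fun p hp hp' => ?_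
    · exact Finset.HasAntidiagonal.mem_antidiagonal.2 (Finset.mem_filter.1 hp).2
    · have hp := Finset.HasAntidiagonal.mem_antidiagonal.1 hp
      simp only [Finset.mem_filter, Finset.mem_product, Finset.mem_range] at hp' hn
      have : p.1 = 0 ∨ p.2 = 0 := by omega
      rcases this with h | h <;> simp [hF, h, coeff_zero]
  rw [h1, partialSum, sq, Finset.sum_mul_sum, ← Finset.sum_product']
  exact Finset.sum_le_sum_of_subset_of_nonneg (Finset.filter_subset _ _) fun p _ _ => hF0 p

theorem sum_expand_le (N : ℕ) (x : ℝ) :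
    ∑ n ∈ Finset.range (N + 2), (if 2 ∣ n then coeff (n / 2) leafSeries else 0) * x ^ n ≤
      partialSum N (x ^ 2) := by
  have h : ∑ n ∈ Finset.range (N + 2), (if 2 ∣ n then coeff (n / 2) leafSeries else 0) * x ^ n =
      ∑ n ∈ (Finset.range (N + 2)).filter (2 ∣ ·), coeff (n / 2) leafSeries * (x ^ 2) ^ (n / 2) := by
    rw [Finset.sum_filter]
    refine Finset.sum_congr rfl fun n _ => ?_
    split_ifs with h
    · rw [← pow_mul, Nat.mul_div_cancel' h]
    · rw [zero_mul]
  have hinj : Set.InjOn (fun n => n / 2) ((Finset.range (N + 2)).filter (2 ∣ ·) : Set ℕ) := by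
    intro a ha b hb hab
    simp only [Finset.coe_filter, Set.mem_ofPred_eq] at ha hb hab
    omega
  rw [h, ← Finset.sum_image (f := fun m => coeff m leafSeries * (x ^ 2) ^ m) hinj]
  refine Finset.sum_le_sum_of_subset_of_nonneg (fun m hm => ?_) fun n _ _ =>
    mul_nonneg (coeff_nonneg n) (by positivity)
  simp only [Finset.mem_image, Finset.mem_filter, Finset.mem_range] at hm ⊢
  omega

theorem two_mul_partialSum_succ_le (N : ℕ) {x : ℝ} (hx : 0 ≤ x) :
    2 * partialSum (N + 1) x ≤ 2 * x + partialSum N x ^ 2 + partialSum N (x ^ 2) := by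
  have h1 : ∑ n ∈ Finset.range (N + 2), (if n = 1 then 2 else 0) * x ^ n = 2 * x := by
    rw [Finset.sum_eq_single 1 (fun n _ h => by simp [h]) (fun h => by simp at h)]
    simp
  rw [partialSum, Finset.mul_sum]
  simp_rw [← mul_assoc, two_mul_coeff, add_mul]
  rw [Finset.sum_add_distrib, Finset.sum_add_distrib, h1]
  gcongr
  · exact sum_mul_le N hx
  · exact sum_expand_le N x

/-- A bound β for the partial sums reproduces itself through the quadratic equation; induction
starts at the zero coefficient. -/
theorem partialSum_le {x β : ℝ} (hx : 0 ≤ x) (hβ : 0 ≤ β)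
    (h : ∀ N, partialSum N x ≤ β → 2 * x + β ^ 2 + partialSum N (x ^ 2) ≤ 2 * β) (N : ℕ) :
    partialSum N x ≤ β := by
  induction N with
  | zero => simpa [partialSum, coeff_zero] using hβ
  | succ N ih =>
    have h1 := two_mul_partialSum_succ_le N hx
    have h2 := h N ih
    have h3 : partialSum N x ^ 2 ≤ β ^ 2 := pow_le_pow_left₀ (partialSum_nonneg N hx) ih 2
    linarith

theorem absConv_of_partialSum_le {x β : ℝ} (hx : 0 ≤ x) (h : ∀ N, partialSum N x ≤ β) :
    AbsConv x leafSeries := by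
  refine summable_of_sum_range_le (c := β) (fun n => by positivity) fun N => ?_
  refine le_trans ?_ (h N)
  rw [partialSum, Finset.sum_range_succ]
  have : 0 ≤ coeff N leafSeries * x ^ N := mul_nonneg (coeff_nonneg N) (pow_nonneg hx N)
  simp_rw [Real.norm_of_nonneg (coeff_nonneg _)]
  linarith

theorem partialSum_le_ev {r x : ℝ} (hr : AbsConv r leafSeries) (hx : 0 ≤ x) (hxr : x ≤ r) (N : ℕ) :
    partialSum N x ≤ ev x leafSeries :=
  sum_le_hasSum _ (fun n _ => mul_nonneg (coeff_nonneg n) (pow_nonneg hx n))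
    (hr.hasSum ((Real.norm_of_nonneg hx).trans_le hxr))

theorem partialSum_quarter_le (N : ℕ) : partialSum N (1 / 4) ≤ 1 / 2 := by
  refine partialSum_le (by norm_num) (by norm_num) (fun N hN => ?_) N
  -- Since (x²)^n ≤ x · x^n for n ≥ 1, the value at 1/16 is at most 1/8, and 1/2 + 1/4 + 1/8 ≤ 1
  -- closes the induction with β = 1/2.
  have h : partialSum N ((1 / 4) ^ 2) ≤ 1 / 4 * partialSum N (1 / 4) := by
    rw [partialSum, partialSum, Finset.mul_sum]
    refine Finset.sum_le_sum fun n _ => ?_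
    rcases n with _ | n
    · simp [coeff_zero]
    · have h1 : ((1 : ℝ) / 4) ^ n ≤ 1 := pow_le_one₀ (by norm_num) (by norm_num)
      have h2 : ((1 / 4 : ℝ) ^ 2) ^ (n + 1) = 1 / 4 * (1 / 4) ^ (n + 1) * (1 / 4) ^ n := by
        rw [← pow_mul]
        ring
      rw [h2]
      have h3 := coeff_nonneg (n + 1)
      calc _ = (1 / 4 * (coeff (n + 1) leafSeries * (1 / 4) ^ (n + 1))) * (1 / 4) ^ n := by ring
        _ ≤ (1 / 4 * (coeff (n + 1) leafSeries * (1 / 4) ^ (n + 1))) * 1 := by gcongr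
        _ = _ := by ring
  norm_num at h ⊢
  linarith

theorem absConv_quarter : AbsConv (1 / 4) leafSeries :=
  absConv_of_partialSum_le (by norm_num) partialSum_quarter_le

theorem coeff_one : coeff 1 leafSeries = 1 := by
  have := two_mul_coeff 1
  simp [Finset.Nat.antidiagonal_succ, coeff_zero] at this
  linarith

theorem coeff_two : coeff 2 leafSeries = 1 := by
  have := two_mul_coeff 2
  simp [Finset.Nat.antidiagonal_succ, coeff_zero, coeff_one] at this
  linarith

theorem ev_mono {r x y : ℝ} (hr : AbsConv r leafSeries) (hx : 0 ≤ x) (hxy : x ≤ y) (hy : y ≤ r) :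
    ev x leafSeries ≤ ev y leafSeries := by
  refine hasSum_le (fun n => ?_) (hr.hasSum ((Real.norm_of_nonneg hx).trans_le (hxy.trans hy)))
    (hr.hasSum ((Real.norm_of_nonneg (hx.trans hxy)).trans_le hy))
  exact mul_le_mul_of_nonneg_left (pow_le_pow_left₀ hx hxy n) (coeff_nonneg n)

/-- The discriminant of the quadratic equation for the series. -/
noncomputable def discr (x : ℝ) : ℝ := 1 - 2 * x - ev (x ^ 2) leafSeries

theorem discr_lt {x y : ℝ} (hx : 0 ≤ x) (hxy : x < y) (hy : y ≤ 1 / 2) : discr y < discr x := by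
  have := ev_mono absConv_quarter (sq_nonneg x) (pow_le_pow_left₀ hx hxy.le 2) (by nlinarith)
  rw [discr, discr]
  linarith

theorem continuousOn_ev : ContinuousOn (fun x : ℝ => ev x leafSeries) (Set.Icc 0 (1 / 4)) := by
  refine continuousOn_tsum (u := fun n => ‖coeff n leafSeries‖ * (1 / 4) ^ n)
    (fun n => by fun_prop) absConv_quarter fun n x hx => ?_
  rw [norm_mul, norm_pow, Real.norm_of_nonneg hx.1]
  exact mul_le_mul_of_nonneg_left (pow_le_pow_left₀ hx.1 hx.2 n) (norm_nonneg _)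

theorem sq_one_sub_ev {x : ℝ} (hx : 0 ≤ x) (h : AbsConv x leafSeries) (hx' : x ≤ 1 / 2) :
    (1 - ev x leafSeries) ^ 2 = discr x := by
  have hn : ‖x‖ ≤ x := (Real.norm_of_nonneg hx).le
  have hq : AbsConv x (expand 2 two_ne_zero leafSeries) :=
    (absConv_quarter.mono (sq_nonneg x) (by nlinarith)).expand_two
  have h2 : (2 : ℝ⟦X⟧) = C (2 : ℝ) := (map_ofNat C 2).symm
  have h1 := congrArg (ev x) two_mul_eq
  have hX : AbsConv x (C (2 : ℝ) * X : ℝ⟦X⟧) := (AbsConv.const 2).mul hx .var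
  rw [h2, ev_mul (.const 2) h hn, ev_add (hX.add hx (h.mul hx h)) hq hn,
    ev_add hX (h.mul hx h) hn, ev_mul (.const 2) .var hn, ev_mul h h hn, ev_expand_two, ev_X,
    ev_C] at h1
  rw [discr]
  linarith

/-- Intermediate values: the discriminant is 1 at 0, and negative at 1/2 because B(1/4) ≥ 1/4. -/
theorem exists_discr_eq_zero : ∃ α : ℝ, 0 < α ∧ α < 1 / 2 ∧ discr α = 0 := by
  have hc : ContinuousOn discr (Set.Icc 0 (1 / 2)) := by
    unfold discr
    have : ContinuousOn (fun x : ℝ => ev (x ^ 2) leafSeries) (Set.Icc 0 (1 / 2)) := by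
      refine continuousOn_ev.comp (f := fun x : ℝ => x ^ 2) (by fun_prop) fun x hx => ?_
      exact ⟨sq_nonneg x, by nlinarith [hx.1, hx.2]⟩
    fun_prop
  have h0 : discr 0 = 1 := by
    have : ev (0 : ℝ) leafSeries = 0 := by
      rw [ev, tsum_eq_single 0]
      · simp [coeff_zero]
      · intro n hn
        simp [hn]
    simp [discr, this]
  have h1 : discr (1 / 2) < 0 := by
    have h2 := partialSum_le_ev absConv_quarter (x := (1 / 2) ^ 2) (by norm_num) (by norm_num) 1
    have h3 : partialSum 1 ((1 / 2) ^ 2) = 1 / 4 := by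
      norm_num [partialSum, Finset.sum_range_succ, coeff_zero, coeff_one]
    rw [discr]
    linarith
  obtain ⟨α, hα, h⟩ := intermediate_value_Icc' (by norm_num) hc
    (show (0 : ℝ) ∈ Set.Icc (discr (1 / 2)) (discr 0) from ⟨h1.le, by rw [h0]; norm_num⟩)
  refine ⟨α, lt_of_le_of_ne hα.1 ?_, lt_of_le_of_ne hα.2 ?_, h⟩
  · rintro rfl
    linarith
  · rintro rfl
    linarith

/-- At a zero of the discriminant β = 1 solves the quadratic equation exactly, so the partial sums
stay below 1; the double root then forces the value 1. -/
theorem absConv_of_discr_eq_zero {α : ℝ} (h0 : 0 < α) (h2 : α < 1 / 2) (h : discr α = 0) :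
    AbsConv α leafSeries ∧ ev α leafSeries = 1 := by
  have h3 : ∀ N, partialSum N α ≤ 1 := by
    refine partialSum_le h0.le (by norm_num) fun N _ => ?_
    have := partialSum_le_ev absConv_quarter (sq_nonneg α) (by nlinarith) N
    rw [discr] at h
    linarith
  have h4 := absConv_of_partialSum_le h0.le h3
  refine ⟨h4, ?_⟩
  have := sq_one_sub_ev h0.le h4 h2.le
  rw [h, sq_eq_zero_iff] at this
  linarith

theorem exists_radius : ∃ α : ℝ, 0 < α ∧ α < 1 / 2 ∧ AbsConv α leafSeries ∧
    ev α leafSeries = 1 := by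
  obtain ⟨α, h0, h1, h⟩ := exists_discr_eq_zero
  exact ⟨α, h0, h1, absConv_of_discr_eq_zero h0 h1 h⟩

/-- The radius of convergence of the generating function by leaves. -/
noncomputable def radius : ℝ := exists_radius.choose

theorem radius_pos : 0 < radius := exists_radius.choose_spec.1

theorem radius_lt_half : radius < 1 / 2 := exists_radius.choose_spec.2.1

theorem absConv_radius : AbsConv radius leafSeries := exists_radius.choose_spec.2.2.1

theorem ev_radius : ev radius leafSeries = 1 := exists_radius.choose_spec.2.2.2

theorem discr_radius : discr radius = 0 := by
  rw [← sq_one_sub_ev radius_pos.le absConv_radius radius_lt_half.le, ev_radius]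
  norm_num

/-- Beyond the radius the strictly decreasing discriminant is negative, yet it would have to be a
square. -/
theorem not_absConv {x : ℝ} (hx : radius < x) : ¬ AbsConv x leafSeries := by
  intro h
  -- The point is capped at 1/2 because convergence of B(x²) is available for x² ≤ 1/4.
  have h1 : radius < min x (1 / 2) := lt_min hx radius_lt_half
  have h2 := sq_one_sub_ev (radius_pos.trans h1).le
    (h.mono (radius_pos.trans h1).le (min_le_left _ _)) (min_le_right _ _)
  have h3 := discr_lt radius_pos.le h1 (min_le_right _ _)
  rw [discr_radius, ← h2] at h3
  exact absurd h3 (not_lt.2 (sq_nonneg _))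

theorem ev_lt_one {x : ℝ} (h0 : 0 ≤ x) (hx : x < radius) : ev x leafSeries < 1 := by
  have h1 := ev_mono absConv_radius h0 hx.le le_rfl
  rw [ev_radius] at h1
  refine lt_of_le_of_ne h1 fun h => ?_
  have h2 := sq_one_sub_ev h0 (absConv_radius.mono h0 hx.le) (hx.le.trans radius_lt_half.le)
  have h3 := discr_lt h0 hx radius_lt_half.le
  rw [discr_radius, ← h2, h] at h3
  norm_num at h3

theorem one_sub_ev_eq_sqrt {x : ℝ} (h0 : 0 ≤ x) (hx : x ≤ radius) :
    1 - ev x leafSeries = √(discr x) := by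
  rw [← sq_one_sub_ev h0 (absConv_radius.mono h0 hx) (hx.trans radius_lt_half.le), Real.sqrt_sq]
  have := ev_mono absConv_radius h0 hx le_rfl
  rw [ev_radius] at this
  linarith

end leafSeries

/-! ### Reciprocals of power series -/

theorem sum_range_antidiagonal_le {a t : ℕ → ℝ} (ha : ∀ n, 0 ≤ a n) (ht : ∀ n, 0 ≤ t n) (N : ℕ) :
    ∑ n ∈ Finset.range N, ∑ p ∈ Finset.HasAntidiagonal.antidiagonal n, a p.1 * t p.2 ≤
      (∑ n ∈ Finset.range N, a n) * ∑ n ∈ Finset.range N, t n := by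
  have h : ∀ n ∈ Finset.range N,
      ∑ p ∈ Finset.HasAntidiagonal.antidiagonal n, a p.1 * t p.2 =
      ∑ p ∈ ((Finset.range N ×ˢ Finset.range N).filter fun p => p.1 + p.2 ∈ Finset.range N) with
        p.1 + p.2 = n, a p.1 * t p.2 := by
    intro n hn
    refine Finset.sum_congr ?_ fun _ _ => rfl
    ext p
    simp only [Finset.HasAntidiagonal.mem_antidiagonal, Finset.mem_filter, Finset.mem_product,
      Finset.mem_range] at hn ⊢
    omega
  rw [Finset.sum_congr rfl h, Finset.sum_fiberwise_of_maps_to (fun p hp => (Finset.mem_filter.1 hp).2),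
    Finset.sum_mul_sum, ← Finset.sum_product']
  exact Finset.sum_le_sum_of_subset_of_nonneg (Finset.filter_subset _ _) fun p _ _ =>
    mul_nonneg (ha _) (ht _)

namespace PowerSeries

theorem ofNat_two_ne_zero : (2 : ℝ⟦X⟧) ≠ 0 := by
  rw [← map_ofNat (C : ℝ →+* ℝ⟦X⟧) 2]
  simp

/-- From g = 1 + f g the absolute partial sums `T` of the inverse satisfy T ≤ 1 + q T with q < 1. -/
theorem AbsConv.inv_one_sub {r : ℝ} (hr : 0 ≤ r) {f : ℝ⟦X⟧} (h0 : coeff 0 f = 0)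
    (hf : AbsConv r f) (h1 : ∑' n, ‖coeff n f‖ * r ^ n < 1) : AbsConv r (1 - f)⁻¹ := by
  set g := (1 - f)⁻¹
  have hg : g = 1 + f * g := by
    have : (1 - f) * g = 1 := PowerSeries.mul_inv_cancel _ (by
      rw [coeff_zero_eq_constantCoeff_apply] at h0
      simp [h0])
    linear_combination this
  set q := ∑' n, ‖coeff n f‖ * r ^ n
  refine summable_of_sum_range_le (c := 1 / (1 - q)) (fun n => by positivity) fun N => ?_
  rw [le_div_iff₀ (by linarith)]
  set T := ∑ n ∈ Finset.range N, ‖coeff n g‖ * r ^ n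
  have hT : T ≤ 1 + q * T := by
    have h2 : ∀ n, ‖coeff n g‖ * r ^ n ≤ (if n = 0 then 1 else 0) +
        ∑ p ∈ Finset.HasAntidiagonal.antidiagonal n,
          (‖coeff p.1 f‖ * r ^ p.1) * (‖coeff p.2 g‖ * r ^ p.2) := by
      intro n
      conv_lhs => rw [hg, map_add, coeff_one, coeff_mul]
      refine (mul_le_mul_of_nonneg_right (norm_add_le _ _) (by positivity)).trans ?_
      rw [add_mul]
      refine add_le_add ?_ ?_
      · split_ifs with h <;> simp [h]
      · refine (mul_le_mul_of_nonneg_right (norm_sum_le _ _) (by positivity)).trans_eq ?_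
        rw [Finset.sum_mul]
        refine Finset.sum_congr rfl fun p hp => ?_
        rw [norm_mul, ← Finset.HasAntidiagonal.mem_antidiagonal.1 hp, pow_add]
        ring
    refine (Finset.sum_le_sum fun n _ => h2 n).trans ?_
    rw [Finset.sum_add_distrib]
    refine add_le_add ?_ ?_
    · rw [Finset.sum_ite_eq']
      split_ifs <;> norm_num
    · refine (sum_range_antidiagonal_le (a := fun n => ‖coeff n f‖ * r ^ n)
        (t := fun n => ‖coeff n g‖ * r ^ n) (fun _ => by positivity) (fun _ => by positivity) N).trans ?_
      refine mul_le_mul_of_nonneg_right (Summable.sum_le_tsum _ (fun _ _ => by positivity) hf)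
        (Finset.sum_nonneg fun _ _ => by positivity)
  linarith

end PowerSeries

open PowerSeries

/-! ### The ring of square root singularities -/

/-- The square root of the discriminant, as a power series. -/
noncomputable def rootSeries : ℝ⟦X⟧ := 1 - leafSeries

namespace rootSeries

open leafSeries

theorem sq_eq : rootSeries ^ 2 = 1 - 2 * X - expand 2 two_ne_zero leafSeries := by
  have := leafSeries.two_mul_eq
  rw [rootSeries]
  linear_combination -this

theorem constantCoeff_eq : constantCoeff rootSeries = 1 := by
  have := leafSeries.coeff_zero
  rw [coeff_zero_eq_constantCoeff_apply] at this
  simp [rootSeries, this]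

theorem ne_zero : rootSeries ≠ 0 := fun h => by
  have := constantCoeff_eq
  simp [h] at this

theorem mul_inv : rootSeries * rootSeries⁻¹ = 1 :=
  PowerSeries.mul_inv_cancel _ (by rw [constantCoeff_eq]; norm_num)

theorem absConv_inv {r : ℝ} (h0 : 0 ≤ r) (hr : r < leafSeries.radius) :
    AbsConv r rootSeries⁻¹ := by
  refine (absConv_radius.mono h0 hr.le).inv_one_sub h0 leafSeries.coeff_zero ?_
  have := ev_lt_one h0 hr
  rw [ev] at this
  simpa only [Real.norm_of_nonneg (coeff_nonneg _)] using this

/-- The series that converge beyond the singularity. -/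
noncomputable abbrev regular : Subring ℝ⟦X⟧ := overconvergent ℝ leafSeries.radius_pos.le

/-- A series that converges below α gives one in x² that converges below √α, and √α > α. All
diagonal terms are regular for this reason. -/
theorem expand_mem {f : ℝ⟦X⟧} (hf : ∀ r, 0 ≤ r → r < leafSeries.radius → AbsConv r f) :
    expand 2 two_ne_zero f ∈ regular := by
  have h0 := radius_pos
  have h1 := radius_lt_half
  have h2 : leafSeries.radius < √leafSeries.radius := Real.lt_sqrt_of_sq_lt (by nlinarith)
  obtain ⟨r, hr, hr'⟩ := exists_between h2
  exact ⟨r, hr, (hf _ (sq_nonneg r) ((Real.lt_sqrt (h0.trans hr).le).1 hr')).expand_two⟩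

theorem sq_mem : rootSeries ^ 2 ∈ regular := by
  rw [sq_eq]
  have h2 : (2 : ℝ⟦X⟧) = C (2 : ℝ) := (map_ofNat C 2).symm
  rw [h2]
  refine Subring.sub_mem _ (Subring.sub_mem _ (Subring.one_mem _)
    (Subring.mul_mem _ (C_mem_overconvergent _) X_mem_overconvergent)) ?_
  exact expand_mem fun r h0 hr => absConv_radius.mono h0 hr.le

/-- The functions of the form `p + q √h` with `p` and `q` analytic beyond the singularity. -/
noncomputable def sqrtRing : Subring ℝ⟦X⟧ := regular.adjoinSqrt sq_mem

theorem mem_sqrtRing : rootSeries ∈ sqrtRing := Subring.self_mem_adjoinSqrt _ _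

theorem C_mem_sqrtRing (c : ℝ) : C c ∈ sqrtRing :=
  Subring.le_adjoinSqrt _ _ (C_mem_overconvergent c)

theorem absConv_of_mem_sqrtRing {f : ℝ⟦X⟧} (hf : f ∈ sqrtRing) : AbsConv leafSeries.radius f := by
  obtain ⟨p, hp, q, hq, rfl⟩ := hf
  have h0 := radius_pos.le
  have hy : AbsConv leafSeries.radius rootSeries := by
    rw [rootSeries, sub_eq_add_neg]
    exact AbsConv.one.add h0 absConv_radius.neg
  exact (absConv_of_mem_overconvergent hp).add h0 ((absConv_of_mem_overconvergent hq).mul h0 hy)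

end rootSeries

/-! ### Singular expansions by induction on forests -/

namespace TreeClass

open rootSeries MarkedClass UBClass

/-- The number of vertices plus the number of leaves of a forest. -/
def weight (F : Multiset TreeClass) : ℕ := (F.map fun t => t.size + t.leaves).sum

theorem weight_add (F G : Multiset TreeClass) : weight (F + G) = weight F + weight G := by
  simp [weight]

theorem weight_mk_zero : weight {mk 0} = 2 := by
  simp [weight, size_mk, leaves_mk_zero]

theorem weight_mk {F : Multiset TreeClass} (hF : F ≠ 0) : weight {mk F} = weight F + 1 := by
  simp only [weight, Multiset.map_singleton, Multiset.sum_singleton, size_mk, leaves_mk hF,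
    Multiset.sum_map_add]
  ring

theorem two_le_weight {F : Multiset TreeClass} (hF : F ≠ 0) : 2 ≤ weight F := by
  refine forest_induction (p := fun F => 2 ≤ weight F) ?_ ?_ ?_ hF
  · rw [weight_mk_zero]
  · intro F hF h
    rw [weight_mk hF]
    omega
  · intro F hF ih
    obtain ⟨t, ht⟩ := Multiset.card_pos_iff_exists_mem.1 (by omega : 0 < F.card)
    obtain ⟨G, rfl⟩ := Multiset.exists_cons_of_mem ht
    have hG : G ≠ 0 := by
      rintro rfl
      simp at hF
    have h := ih {t} G (by simp) hG (by simp)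
    rw [← Multiset.singleton_add, weight_add]
    omega

theorem pairSeries_singleton (S : TreeClass) :
    pairSeries {S} = leafSeries * allSeries {S} := by
  classical
  have h : ¬ ∃ H : Multiset TreeClass, {S} = H + H := by
    rintro ⟨H, hH⟩
    have := congrArg Multiset.card hH
    simp only [Multiset.card_singleton, Multiset.card_add] at this
    omega
  have hs : ({S} : Multiset TreeClass).splittings = {(0, {S}), ({S}, 0)} := by
    ext ⟨G, H⟩
    simp only [Multiset.mem_splittings, Finset.mem_insert, Finset.mem_singleton, Prod.mk.injEq]
    constructor
    · intro h
      by_cases hG : G = 0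
      · left
        simpa [hG] using h
      · right
        have hc := congrArg Multiset.card h
        have := Multiset.card_pos.2 hG
        simp only [Multiset.card_add, Multiset.card_singleton] at hc
        have hH : H = 0 := Multiset.card_eq_zero.1 (by omega)
        simpa [hH] using h
    · rintro (⟨rfl, rfl⟩ | ⟨rfl, rfl⟩) <;> simp
  have h1 := two_mul_pairSeries {S}
  rw [dif_neg h, hs, Finset.sum_pair (by simp [Prod.ext_iff])] at h1
  have h2 := PowerSeries.ofNat_two_ne_zero
  apply mul_left_cancel₀ h2
  rw [h1, leafSeries]
  ring

/-- One tree splits only with the empty forest, so passing from good to all embeddings is division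
by 1 - B. -/
theorem root_mul_allSeries_singleton (S : TreeClass) :
    rootSeries * allSeries {S} = goodSeries S := by
  have h1 := allSeries_singleton S
  have h2 := pairSeries_singleton S
  rw [rootSeries]
  linear_combination h1 + h2

theorem goodSeries_leaf : goodSeries (mk 0) = 1 - rootSeries := by
  rw [goodSeries_mk, if_pos rfl, ← allSeries_zero, rootSeries, leafSeries]
  ring

theorem goodSeries_mk_singleton (S : TreeClass) :
    goodSeries (mk {S}) = (1 - rootSeries) * allSeries {S} := by
  rw [goodSeries_mk, if_neg (by simp), pairSeries_singleton, rootSeries]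
  ring

theorem goodSeries_mk_of_two_le {F : Multiset TreeClass} (hF : 2 ≤ F.card) :
    goodSeries (mk F) = allSeries F := by
  have : F ≠ 0 := by
    rintro rfl
    simp at hF
  rw [goodSeries_mk, if_neg this, zero_add, allSeries_of_two_le hF]

/-- The new root raises the weight by one but keeps the constant, while the good series is A_F or (1
- y) A_F. -/
theorem goodSeries_expansion {F : Multiset TreeClass} (hF : F ≠ 0)
    (h : ∃ e ∈ sqrtRing, allSeries F * rootSeries ^ weight F =
      rootSeries * (C (constant F) + rootSeries * e)) :
    ∃ e ∈ sqrtRing, goodSeries (mk F) * rootSeries ^ weight {mk F} =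
      rootSeries ^ 2 * (C (constant {mk F}) + rootSeries * e) := by
  obtain ⟨e, he, h⟩ := h
  rw [weight_mk hF, constant_mk hF, pow_succ]
  rcases Nat.lt_or_ge F.card 2 with hc | hc
  · have hc : F.card = 1 := by
      have := Multiset.card_pos.2 hF
      omega
    obtain ⟨S, rfl⟩ := Multiset.card_eq_one.1 hc
    -- The factor 1 - y changes the error term only.
    refine ⟨e - C (constant {S}) - rootSeries * e, sqrtRing.sub_mem (sqrtRing.sub_mem he
      (C_mem_sqrtRing _)) (sqrtRing.mul_mem mem_sqrtRing he), ?_⟩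
    rw [goodSeries_mk_singleton]
    linear_combination rootSeries * (1 - rootSeries) * h
  · refine ⟨e, he, ?_⟩
    rw [goodSeries_mk_of_two_le hc]
    linear_combination rootSeries * h

theorem absConv_allSeries {F : Multiset TreeClass}
    (h : ∃ e ∈ sqrtRing, allSeries F * rootSeries ^ weight F =
      rootSeries * (C (constant F) + rootSeries * e)) {r : ℝ} (h0 : 0 ≤ r)
    (hr : r < leafSeries.radius) : AbsConv r (allSeries F) := by
  obtain ⟨e, he, h⟩ := h
  have h1 : allSeries F =
      rootSeries * (C (constant F) + rootSeries * e) * rootSeries⁻¹ ^ weight F := by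
    rw [← h, mul_assoc, ← mul_pow, mul_inv, one_pow, mul_one]
  have h2 : ∀ n, AbsConv r (rootSeries⁻¹ ^ n) := fun n => by
    induction n with
    | zero => simpa using AbsConv.one
    | succ n ih => rw [pow_succ]; exact ih.mul h0 (absConv_inv h0 hr)
  rw [h1]
  refine AbsConv.mul h0 (AbsConv.mono (absConv_of_mem_sqrtRing ?_) h0 hr.le) (h2 _)
  exact sqrtRing.mul_mem mem_sqrtRing
    (sqrtRing.add_mem (C_mem_sqrtRing _) (sqrtRing.mul_mem mem_sqrtRing he))

/-- The two splittings with an empty part contribute 2 B A_F, which moves to the left; the diagonal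
term is regular because the halves already converge below the radius. -/
theorem two_mul_root_mul_allSeries {F : Multiset TreeClass} (hF : 2 ≤ F.card)
    (ih : ∀ H, H ≠ 0 → H + H = F → ∀ r, 0 ≤ r → r < leafSeries.radius → AbsConv r (allSeries H)) :
    open Classical in ∃ s ∈ sqrtRing, 2 * (rootSeries * allSeries F) =
      ∑ d ∈ F.splittings with d.1 ≠ 0 ∧ d.2 ≠ 0, allSeries d.1 * allSeries d.2 + s := by
  classical
  have hF0 : F ≠ 0 := by
    rintro rfl
    simp at hF
  refine ⟨if h : ∃ H, F = H + H then expand 2 two_ne_zero (allSeries h.choose) else 0, ?_, ?_⟩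
  · split_ifs with h
    · refine Subring.le_adjoinSqrt _ _ (expand_mem (ih _ ?_ h.choose_spec.symm))
      intro h0
      have := h.choose_spec
      rw [h0] at this
      exact hF0 this
    · exact sqrtRing.zero_mem
  · have h1 := two_mul_pairSeries F
    rw [← allSeries_of_two_le hF,
      ← Finset.sum_filter_add_sum_filter_not _ (fun d => d.1 ≠ 0 ∧ d.2 ≠ 0)] at h1
    have hs : {d ∈ F.splittings | ¬ (d.1 ≠ 0 ∧ d.2 ≠ 0)} = {(0, F), (F, 0)} := by
      ext ⟨G, H⟩
      simp only [Finset.mem_filter, Multiset.mem_splittings, Finset.mem_insert,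
        Finset.mem_singleton, Prod.mk.injEq]
      constructor
      · rintro ⟨h, h'⟩
        by_cases hG : G = 0
        · left
          simpa [hG] using h
        · right
          have hH : H = 0 := by tauto
          simpa [hH] using h
      · rintro (⟨rfl, rfl⟩ | ⟨rfl, rfl⟩) <;> simp
    rw [hs, Finset.sum_pair (by simp [Prod.ext_iff, hF0, hF0.symm])] at h1
    rw [rootSeries, leafSeries]
    linear_combination h1

/-- Each product over a splitting is y² (C_G C_H + y E) after multiplication by y^w, since weights
add. Division by 2y leaves the order claimed, with the recursion of `constant` as leading
coefficient. -/
theorem allSeries_expansion {F : Multiset TreeClass} (hF : F ≠ 0) :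
    ∃ e ∈ sqrtRing, allSeries F * rootSeries ^ weight F =
      rootSeries * (C (constant F) + rootSeries * e) := by
  classical
  refine forest_induction (p := fun F => ∃ e ∈ sqrtRing, allSeries F * rootSeries ^ weight F =
      rootSeries * (C (constant F) + rootSeries * e)) ?_ ?_ ?_ hF
  · refine ⟨-1, sqrtRing.neg_mem sqrtRing.one_mem, ?_⟩
    have := root_mul_allSeries_singleton (mk 0)
    rw [goodSeries_leaf] at this
    rw [weight_mk_zero, constant_mk_zero, map_one]
    linear_combination rootSeries * this
  · intro F hF h
    obtain ⟨e, he, h⟩ := goodSeries_expansion hF h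
    refine ⟨e, he, mul_left_cancel₀ ne_zero ?_⟩
    rw [← root_mul_allSeries_singleton] at h
    linear_combination h
  · intro F hc ih
    have hF0 : F ≠ 0 := by
      rintro rfl
      simp at hc
    have ih2 : ∀ d ∈ F.splittings.filter (fun d => d.1 ≠ 0 ∧ d.2 ≠ 0), ∃ E ∈ sqrtRing,
        allSeries d.1 * allSeries d.2 * rootSeries ^ weight F =
          rootSeries ^ 2 * (C (constant d.1 * constant d.2) + rootSeries * E) := by
      intro d hd
      simp only [Finset.mem_filter, Multiset.mem_splittings] at hd
      obtain ⟨hd, h1, h2⟩ := hd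
      obtain ⟨e, he, h⟩ := ih d.1 d.2 h1 h2 hd
      obtain ⟨e', he', h'⟩ := ih d.2 d.1 h2 h1 (by rw [add_comm, hd])
      refine ⟨C (constant d.1) * e' + C (constant d.2) * e + rootSeries * (e * e'), ?_, ?_⟩
      · exact sqrtRing.add_mem (sqrtRing.add_mem (sqrtRing.mul_mem (C_mem_sqrtRing _) he')
          (sqrtRing.mul_mem (C_mem_sqrtRing _) he))
          (sqrtRing.mul_mem mem_sqrtRing (sqrtRing.mul_mem he he'))
      · rw [← hd, weight_add, pow_add, map_mul]
        linear_combination (allSeries d.2 * rootSeries ^ weight d.2) * h +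
          rootSeries * (C (constant d.1) + rootSeries * e) * h'
    choose! E hE hE' using ih2
    obtain ⟨s, hs, h⟩ := two_mul_root_mul_allSeries hc fun H hH hHF r h0 hr =>
      absConv_allSeries (ih H H hH hH hHF) h0 hr
    have hsum : ∑ d ∈ F.splittings with d.1 ≠ 0 ∧ d.2 ≠ 0,
        C (constant d.1 * constant d.2) = C (2 * constant F) := by
      rw [← map_sum, constant_of_two_le hc, mul_div_cancel₀ _ (two_ne_zero (α := ℝ)),
        Finset.sum_filter]
      congr 1
      refine Finset.sum_congr rfl fun d _ => ?_
      split_ifs with hd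
      · rfl
      · rw [not_and_or, not_not, not_not] at hd
        rcases hd with hd | hd <;> simp [hd, constant_zero]
    -- The regular term is multiplied by y^w and must be absorbed in the error, which carries y³ at
    -- this stage.
    have hw : 3 ≤ weight F := by
      obtain ⟨t, ht⟩ := Multiset.card_pos_iff_exists_mem.1 (by omega : 0 < F.card)
      obtain ⟨G, rfl⟩ := Multiset.exists_cons_of_mem ht
      have hG : G ≠ 0 := by
        rintro rfl
        simp at hc
      have h1 := two_le_weight hG
      have h2 := two_le_weight (F := {t}) (by simp)
      rw [← Multiset.singleton_add, weight_add]
      omega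
    obtain ⟨k, hk⟩ := Nat.exists_eq_add_of_le hw
    have h3 := congrArg (· * rootSeries ^ weight F) h
    simp only [add_mul, Finset.sum_mul] at h3
    rw [Finset.sum_congr rfl hE', ← Finset.mul_sum, Finset.sum_add_distrib, hsum,
      ← Finset.mul_sum] at h3
    set W := ∑ d ∈ F.splittings with d.1 ≠ 0 ∧ d.2 ≠ 0, E d
    have hW : W ∈ sqrtRing := sqrtRing.sum_mem fun d hd => hE d hd
    refine ⟨C (1 / 2) * (W + s * rootSeries ^ k), sqrtRing.mul_mem (C_mem_sqrtRing _)
      (sqrtRing.add_mem hW (sqrtRing.mul_mem hs (sqrtRing.pow_mem mem_sqrtRing k))), ?_⟩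
    have h2 : (C (1 / 2 : ℝ) : ℝ⟦X⟧) * 2 = 1 := by
      rw [← map_ofNat (C : ℝ →+* ℝ⟦X⟧) 2, ← map_mul]
      norm_num
    have h4 : (C (2 * constant F) : ℝ⟦X⟧) = 2 * C (constant F) := by
      rw [map_mul, map_ofNat]
    apply mul_left_cancel₀ (mul_ne_zero PowerSeries.ofNat_two_ne_zero ne_zero : (2 : ℝ⟦X⟧) * rootSeries ≠ 0)
    rw [h4] at h3
    have h5 : rootSeries ^ weight F = rootSeries ^ 3 * rootSeries ^ k := by rw [hk, pow_add]
    linear_combination h3 + s * h5 - rootSeries ^ 3 * (W + s * rootSeries ^ k) * h2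

end TreeClass

/-! ### Holomorphic square roots and Taylor series -/

/-- A holomorphic function without zeros on a disc has a holomorphic square root. -/
theorem exists_sq_eq_of_differentiableOn {K : ℂ → ℂ} {R : ℝ} (hR : 0 < R)
    (hK : DifferentiableOn ℂ K (Metric.ball 0 R)) (h0 : ∀ x ∈ Metric.ball (0 : ℂ) R, K x ≠ 0) :
    ∃ w : ℂ → ℂ, DifferentiableOn ℂ w (Metric.ball 0 R) ∧
      ∀ x ∈ Metric.ball (0 : ℂ) R, w x ^ 2 = K x := by
  have hK' : ∀ x ∈ Metric.ball (0 : ℂ) R, HasDerivAt K (deriv K x) x := fun x hx =>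
    (hK.differentiableAt (Metric.isOpen_ball.mem_nhds hx)).hasDerivAt
  -- `g` is a primitive of K'/K, that is, a logarithm of K up to a constant; c · exp(g/2) is then a
  -- root.
  obtain ⟨g, hg⟩ := ((hK.deriv Metric.isOpen_ball).div hK h0).isExactOn_ball
  have hq : ∀ x ∈ Metric.ball (0 : ℂ) R, HasDerivAt (fun x => K x * Complex.exp (-g x)) 0 x := by
    intro x hx
    have := (hK' x hx).mul (hg x hx).neg.cexp
    refine this.congr_deriv ?_
    have h1 : K x ≠ 0 := h0 x hx
    simp only [Pi.div_apply]
    field_simp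
    ring
  have h00 : (0 : ℂ) ∈ Metric.ball (0 : ℂ) R := Metric.mem_ball_self hR
  have hc : ∀ x ∈ Metric.ball (0 : ℂ) R,
      K x * Complex.exp (-g x) = K 0 * Complex.exp (-g 0) := fun x hx =>
    Metric.isOpen_ball.is_const_of_deriv_eq_zero (convex_ball _ _).isPreconnected
      (fun x hx => (hq x hx).differentiableAt.differentiableWithinAt)
      (fun x hx => (hq x hx).deriv) hx h00
  obtain ⟨c, hc2⟩ := IsAlgClosed.exists_pow_nat_eq (K 0 * Complex.exp (-g 0)) two_pos
  refine ⟨fun x => c * Complex.exp (g x / 2), fun x hx => ?_, fun x hx => ?_⟩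
  · exact (((hg x hx).div_const 2).cexp.const_mul c).differentiableAt.differentiableWithinAt
  · rw [mul_pow, hc2, ← hc x hx, ← Complex.exp_nat_mul, mul_assoc, ← Complex.exp_add]
    have : -g x + ((2 : ℕ) : ℂ) * (g x / 2) = 0 := by
      push_cast
      ring
    rw [this, Complex.exp_zero, mul_one]

namespace PowerSeries

theorem exists_taylor {w : ℂ → ℂ} {R : ℝ} (hR : 0 < R)
    (hw : DifferentiableOn ℂ w (Metric.closedBall 0 R)) :
    ∃ W : ℂ⟦X⟧, (∀ r, 0 ≤ r → r < R → AbsConv r W) ∧ ∀ x : ℂ, ‖x‖ < R → ev x W = w x := by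
  lift R to NNReal using hR.le
  have h := hw.hasFPowerSeriesOnBall (NNReal.coe_pos.1 hR)
  set p := cauchyPowerSeries w 0 R
  refine ⟨mk fun n => p.coeff n, fun r h0 hr => ?_, fun x hx => ?_⟩
  · lift r to NNReal using h0
    have := p.summable_norm_mul_pow
      (lt_of_lt_of_le (ENNReal.coe_lt_coe.2 (NNReal.coe_lt_coe.1 hr)) h.r_le)
    refine this.congr fun n => ?_
    rw [coeff_mk, FormalMultilinearSeries.norm_apply_eq_norm_coef]
  · have hx' : x ∈ Metric.eball (0 : ℂ) R := by
      rw [mem_eball_zero_iff, enorm_eq_nnnorm, ENNReal.coe_lt_coe]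
      exact hx
    have := h.hasSum hx'
    rw [zero_add] at this
    rw [← this.tsum_eq, ev]
    refine tsum_congr fun n => ?_
    rw [FormalMultilinearSeries.apply_eq_pow_smul_coeff, coeff_mk, smul_eq_mul, mul_comm]

theorem hasFPowerSeriesAt_ev {r : ℝ} (hr : 0 < r) {f : ℂ⟦X⟧} (hf : AbsConv r f) :
    HasFPowerSeriesAt (fun x => ev x f)
      (FormalMultilinearSeries.ofScalars ℂ fun n => coeff n f) 0 := by
  lift r to NNReal using hr.le
  refine ⟨r, ?_, ENNReal.coe_pos.2 (NNReal.coe_pos.1 hr), fun {y} hy => ?_⟩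
  · refine FormalMultilinearSeries.le_radius_of_summable _ (hf.congr fun n => ?_)
    rw [FormalMultilinearSeries.ofScalars_norm]
  · have hy' : ‖y‖ ≤ r := by
      rw [mem_eball_zero_iff, enorm_eq_nnnorm, ENNReal.coe_lt_coe] at hy
      exact hy.le
    rw [zero_add]
    refine (hf.hasSum hy').congr_fun fun n => ?_
    rw [FormalMultilinearSeries.ofScalars_apply_eq, smul_eq_mul]

/-- Carries identities between holomorphic functions back to formal power series. -/
theorem eq_of_ev_eq {r : ℝ} (hr : 0 < r) {f g : ℂ⟦X⟧} (hf : AbsConv r f) (hg : AbsConv r g)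
    (h : ∀ x : ℂ, ‖x‖ < r → ev x f = ev x g) : f = g := by
  have h1 := (hasFPowerSeriesAt_ev hr hf).congr (g := fun x => ev x g) <| by
    filter_upwards [Metric.ball_mem_nhds (0 : ℂ) hr] with x hx
    exact h x (by simpa using hx)
  have h2 := h1.eq_formalMultilinearSeries (hasFPowerSeriesAt_ev hr hg)
  have h3 := FormalMultilinearSeries.ofScalars_series_injective ℂ ℂ h2
  ext n
  exact congrFun h3 n

/-- The power series with complex coefficients. -/
noncomputable abbrev toComplex : ℝ⟦X⟧ →+* ℂ⟦X⟧ := PowerSeries.map Complex.ofRealHom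

theorem absConv_toComplex {r : ℝ} {f : ℝ⟦X⟧} : AbsConv r (toComplex f) ↔ AbsConv r f := by
  simp [AbsConv]

theorem ev_toComplex (x : ℝ) (f : ℝ⟦X⟧) : ev (x : ℂ) (toComplex f) = (ev x f : ℝ) := by
  rw [ev, ev, Complex.ofReal_tsum]
  refine tsum_congr fun n => ?_
  simp

end PowerSeries

/-! ### Powers of 1 - x/α -/

namespace PowerSeries

/-- The power series of `(1 - x / α) ^ s`. -/
noncomputable def powSeries (α s : ℝ) : ℝ⟦X⟧ :=
  rescale (-α⁻¹) (PowerSeries.binomialSeries ℝ s)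

theorem powSeries_add (α s t : ℝ) : powSeries α (s + t) = powSeries α s * powSeries α t := by
  rw [powSeries, binomialSeries_add, map_mul, powSeries, powSeries]

theorem powSeries_one (α : ℝ) : powSeries α 1 = 1 - C α⁻¹ * X := by
  have h : (PowerSeries.binomialSeries ℝ (1 : ℝ)) = 1 + X := by
    have := PowerSeries.binomialSeries_nat (R := ℝ) (A := ℝ) 1
    simpa using this
  rw [powSeries, h, map_add, map_one, rescale_X, map_neg]
  ring

theorem powSeries_zero (α : ℝ) : powSeries α 0 = 1 := by
  rw [powSeries, PowerSeries.binomialSeries_zero, map_one]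

theorem coeff_powSeries (α s : ℝ) (n : ℕ) :
    coeff n (powSeries α s) = (-α⁻¹) ^ n * Ring.choose s n := by
  rw [powSeries, coeff_rescale, PowerSeries.binomialSeries_coeff, smul_eq_mul, mul_one]

end PowerSeries

/-! ### Zeros of the discriminant in the disc -/

namespace leafSeries

open PowerSeries

/-- The terms of the series that appear in the discriminant. -/
theorem norm_term_le (n : ℕ) {x : ℂ} (hx : x ∈ Metric.ball (0 : ℂ) (1 / 2)) :
    ‖((coeff n leafSeries : ℝ) : ℂ) * (x ^ 2) ^ n‖ ≤ ‖coeff n leafSeries‖ * (1 / 4) ^ n := by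
  rw [mem_ball_zero_iff] at hx
  rw [norm_mul, Complex.norm_real, norm_pow, norm_pow]
  gcongr
  nlinarith [norm_nonneg x]

/-- The discriminant as a holomorphic function. -/
noncomputable def complexDiscr (x : ℂ) : ℂ :=
  1 - 2 * x - ∑' n, ((coeff n leafSeries : ℝ) : ℂ) * (x ^ 2) ^ n

theorem differentiableOn_complexDiscr :
    DifferentiableOn ℂ complexDiscr (Metric.ball 0 (1 / 2)) := by
  have := Complex.differentiableOn_tsum_of_summable_norm absConv_quarter
    (F := fun n (x : ℂ) => ((coeff n leafSeries : ℝ) : ℂ) * (x ^ 2) ^ n)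
    (fun n => by fun_prop) Metric.isOpen_ball fun n x hx => norm_term_le n hx
  unfold complexDiscr
  fun_prop

theorem complexDiscr_ofReal (x : ℝ) : complexDiscr x = (discr x : ℝ) := by
  rw [complexDiscr, discr, ev]
  push_cast
  rfl

theorem complexDiscr_eq_ev {x : ℂ} (hx : ‖x‖ ≤ 1 / 2) :
    complexDiscr x = ev x (toComplex (rootSeries ^ 2)) := by
  have hB : AbsConv (1 / 2) (expand 2 two_ne_zero (toComplex leafSeries)) := by
    refine AbsConv.expand_two ?_
    norm_num
    exact absConv_toComplex.2 (by simpa using absConv_quarter)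
  have h2 : toComplex (2 : ℝ⟦X⟧) = C (2 : ℂ) := by rw [map_ofNat, map_ofNat]
  have hX : AbsConv (1 / 2) (C (2 : ℂ) * X : ℂ⟦X⟧) := (AbsConv.const 2).mul (by norm_num) .var
  rw [rootSeries.sq_eq, map_sub, map_sub, map_mul, map_one, h2, PowerSeries.map_expand,
    PowerSeries.map_X, sub_eq_add_neg, sub_eq_add_neg,
    ev_add (AbsConv.one.add (by norm_num) hX.neg) hB.neg hx, ev_add .one hX.neg hx,
    ev_neg, ev_neg, ev_mul (.const 2) .var hx, ev_C, ev_X, ev_one, ev_expand_two, complexDiscr, ev]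
  simp only [toComplex, PowerSeries.coeff_map, Complex.ofRealHom_eq_coe]
  ring

/-- The derivative at the singularity of the series in the discriminant. -/
noncomputable def slope : ℝ :=
  ∑' n : ℕ, coeff n leafSeries * (n * (radius ^ 2) ^ (n - 1) * (2 * radius))

theorem radius_mem_ball : (radius : ℂ) ∈ Metric.ball (0 : ℂ) (1 / 2) := by
  rw [mem_ball_zero_iff, Complex.norm_real, Real.norm_of_nonneg radius_pos.le]
  exact radius_lt_half

theorem hasDerivAt_term (n : ℕ) (x : ℂ) :
    HasDerivAt (fun x : ℂ => ((coeff n leafSeries : ℝ) : ℂ) * (x ^ 2) ^ n)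
      (((coeff n leafSeries : ℝ) : ℂ) * (n * (x ^ 2) ^ (n - 1) * (2 * x))) x := by
  have := (((hasDerivAt_id x).pow 2).pow n).const_mul ((coeff n leafSeries : ℝ) : ℂ)
  simpa using this

/-- Termwise differentiation inside the disc of radius 1/2, where the series in x² is dominated by
its value at 1/4. -/
theorem hasSum_slope' : HasSum
    (fun n : ℕ => ((coeff n leafSeries * (n * (radius ^ 2) ^ (n - 1) * (2 * radius)) : ℝ) : ℂ))
    (deriv (fun x : ℂ => ∑' n, ((coeff n leafSeries : ℝ) : ℂ) * (x ^ 2) ^ n) radius) := by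
  have := Complex.hasSum_deriv_of_summable_norm absConv_quarter
    (F := fun n (x : ℂ) => ((coeff n leafSeries : ℝ) : ℂ) * (x ^ 2) ^ n)
    (fun n => by fun_prop) Metric.isOpen_ball (fun n x hx => norm_term_le n hx) radius_mem_ball
  refine this.congr_fun fun n => ?_
  rw [(hasDerivAt_term n radius).deriv]
  push_cast
  rfl

theorem summable_slope :
    Summable fun n : ℕ => coeff n leafSeries * (n * (radius ^ 2) ^ (n - 1) * (2 * radius)) :=
  Complex.summable_ofReal.1 hasSum_slope'.summable

theorem slope_nonneg : 0 ≤ slope := tsum_nonneg fun n => by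
  have := coeff_nonneg n
  have := radius_pos
  positivity

theorem hasDerivAt_complexDiscr :
    HasDerivAt complexDiscr ((-(2 + slope) : ℝ) : ℂ) (radius : ℂ) := by
  have h1 : deriv (fun x : ℂ => ∑' n, ((coeff n leafSeries : ℝ) : ℂ) * (x ^ 2) ^ n) radius = slope := by
    rw [← hasSum_slope'.tsum_eq, slope, Complex.ofReal_tsum]
  have h2 : DifferentiableAt ℂ (fun x : ℂ => ∑' n, ((coeff n leafSeries : ℝ) : ℂ) * (x ^ 2) ^ n)
      radius := (Complex.differentiableOn_tsum_of_summable_norm absConv_quarter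
    (F := fun n (x : ℂ) => ((coeff n leafSeries : ℝ) : ℂ) * (x ^ 2) ^ n)
    (fun n => by fun_prop) Metric.isOpen_ball fun n x hx => norm_term_le n hx).differentiableAt
      (Metric.isOpen_ball.mem_nhds radius_mem_ball)
  have h3 := h2.hasDerivAt
  rw [h1] at h3
  have h4 := (((hasDerivAt_id (radius : ℂ)).const_mul 2).const_sub 1).sub h3
  refine h4.congr_deriv ?_
  push_cast
  ring

theorem hasDerivAt_discr : HasDerivAt discr (-(2 + slope)) radius := by
  have := hasDerivAt_complexDiscr.real_of_complex
  rw [Complex.ofReal_re] at this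
  refine this.congr_of_eventuallyEq (Eventually.of_forall fun x => ?_)
  change discr x = (complexDiscr x).re
  rw [complexDiscr_ofReal, Complex.ofReal_re]

/-- Equality in the triangle inequality would force `x` to be the positive real number `r`. -/
theorem norm_one_add_lt {r : ℝ} {x : ℂ} (hr : 0 ≤ r) (hx : ‖x‖ ≤ r) (hne : x ≠ r) :
    ‖1 + x‖ < 1 + r := by
  have h1 : x.re < r := by
    refine lt_of_le_of_ne ((Complex.re_le_norm x).trans hx) fun h => hne ?_
    have h2 : ‖x‖ = x.re := le_antisymm (h ▸ hx) (Complex.re_le_norm x)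
    have h3 : x.im = 0 := by
      have := Complex.sq_norm x
      rw [h2, Complex.normSq_apply] at this
      nlinarith
    exact Complex.ext (by simpa using h) (by simpa using h3)
  have h4 : ‖1 + x‖ ^ 2 = 1 + 2 * x.re + ‖x‖ ^ 2 := by
    rw [Complex.sq_norm, Complex.sq_norm, Complex.normSq_apply, Complex.normSq_apply]
    simp
    ring
  have h5 : ‖x‖ ^ 2 ≤ r ^ 2 := pow_le_pow_left₀ (norm_nonneg _) hx 2
  nlinarith [norm_nonneg (1 + x)]

/-- The first two terms x + x² = x (1 + x) lose strictly against their value at α, and the remaining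
terms cannot gain. -/
theorem norm_ev_lt_one {x : ℂ} (hx : ‖x‖ ≤ radius) (hne : x ≠ radius) :
    ‖ev x (toComplex leafSeries)‖ < 1 := by
  have h0 := radius_pos
  have hB := absConv_toComplex.2 absConv_radius
  have hs := (hB.summable hx).of_norm
  have hs' : Summable fun n => coeff n leafSeries * radius ^ n :=
    (absConv_radius.hasSum (Real.norm_of_nonneg h0.le).le).summable
  have h1 : ev x (toComplex leafSeries) = x * (1 + x) +
      ∑' n, coeff (n + 3) (toComplex leafSeries) * x ^ (n + 3) := by
    rw [ev, ← hs.sum_add_tsum_nat_add 3]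
    simp only [Finset.sum_range_succ, Finset.sum_range_zero, toComplex, PowerSeries.coeff_map,
      leafSeries.coeff_zero, leafSeries.coeff_one, leafSeries.coeff_two]
    simp
    ring
  have h2 : (1 : ℝ) = radius * (1 + radius) +
      ∑' n, coeff (n + 3) leafSeries * radius ^ (n + 3) := by
    have h := ev_radius
    rw [ev, ← hs'.sum_add_tsum_nat_add 3] at h
    simp only [Finset.sum_range_succ, Finset.sum_range_zero,
      leafSeries.coeff_zero, leafSeries.coeff_one, leafSeries.coeff_two] at h
    linear_combination -h
  have h3 : ‖∑' n, coeff (n + 3) (toComplex leafSeries) * x ^ (n + 3)‖ ≤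
      ∑' n, coeff (n + 3) leafSeries * radius ^ (n + 3) := by
    refine tsum_of_norm_bounded ((summable_nat_add_iff 3).2 hs').hasSum fun n => ?_
    rw [norm_mul, norm_pow, toComplex, PowerSeries.coeff_map, Complex.ofRealHom_eq_coe,
      Complex.norm_real, Real.norm_of_nonneg (coeff_nonneg _)]
    exact mul_le_mul_of_nonneg_left (pow_le_pow_left₀ (norm_nonneg _) hx _) (coeff_nonneg _)
  have h4 : ‖x * (1 + x)‖ < radius * (1 + radius) := by
    rw [norm_mul]
    have h5 := norm_one_add_lt h0.le hx hne
    calc ‖x‖ * ‖1 + x‖ ≤ radius * ‖1 + x‖ := mul_le_mul_of_nonneg_right hx (norm_nonneg _)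
      _ < radius * (1 + radius) := mul_lt_mul_of_pos_left h5 h0
  rw [h1]
  exact (norm_add_le _ _).trans_lt (by rw [h2]; exact add_lt_add_of_lt_of_le h4 h3)

/-- In the closed disc the discriminant is (1 - B(x))², and |B(x)| < 1 away from α. -/
theorem complexDiscr_ne_zero {x : ℂ} (hx : ‖x‖ ≤ radius) (hne : x ≠ radius) :
    complexDiscr x ≠ 0 := by
  have hB := absConv_toComplex.2 absConv_radius
  have h1 : AbsConv radius (toComplex rootSeries) := by
    rw [rootSeries, map_sub, map_one, sub_eq_add_neg]
    exact AbsConv.one.add radius_pos.le hB.neg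
  rw [complexDiscr_eq_ev (hx.trans radius_lt_half.le), map_pow, sq, ev_mul h1 h1 hx, ← sq]
  refine pow_ne_zero 2 fun h => ?_
  rw [rootSeries, map_sub, map_one, sub_eq_add_neg, ev_add .one hB.neg hx, ev_one, ev_neg,
    ← sub_eq_add_neg, sub_eq_zero] at h
  have := norm_ev_lt_one hx hne
  rw [← h] at this
  simp at this

/-- The discriminant divided by `1 - x / α`. -/
noncomputable def reducedDiscr (x : ℂ) : ℂ := -radius * dslope complexDiscr radius x

theorem differentiableOn_reducedDiscr :
    DifferentiableOn ℂ reducedDiscr (Metric.ball 0 (1 / 2)) :=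
  ((Complex.differentiableOn_dslope (Metric.isOpen_ball.mem_nhds radius_mem_ball)).2
    differentiableOn_complexDiscr).const_mul _

theorem complexDiscr_eq_mul (x : ℂ) :
    complexDiscr x = (1 - (radius : ℂ)⁻¹ * x) * reducedDiscr x := by
  have h := sub_smul_dslope complexDiscr (radius : ℂ) x
  have h0 : complexDiscr radius = 0 := by
    rw [complexDiscr_ofReal, discr_radius, Complex.ofReal_zero]
  have h1 : (radius : ℂ) ≠ 0 := Complex.ofReal_ne_zero.2 radius_pos.ne'
  rw [h0, sub_zero, smul_eq_mul] at h
  rw [← h, reducedDiscr]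
  field_simp
  ring

theorem reducedDiscr_radius : reducedDiscr radius = (radius * (2 + slope) : ℝ) := by
  rw [reducedDiscr, dslope_same, hasDerivAt_complexDiscr.deriv]
  push_cast
  ring

/-- At α itself the value is -α h'(α) > 0: the zero of the discriminant is simple. -/
theorem reducedDiscr_ne_zero {x : ℂ} (hx : ‖x‖ ≤ radius) : reducedDiscr x ≠ 0 := by
  by_cases hne : x = radius
  · rw [hne, reducedDiscr_radius]
    have := radius_pos
    have := slope_nonneg
    exact Complex.ofReal_ne_zero.2 (by positivity)
  · intro h
    exact complexDiscr_ne_zero hx hne (by rw [complexDiscr_eq_mul, h, mul_zero])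

end leafSeries

/-! ### The analytic factor of the square root -/

namespace rootSeries

open PowerSeries leafSeries

/-- The series `√h / √(1 - x / α)`. -/
noncomputable def unit : ℝ⟦X⟧ := rootSeries * powSeries leafSeries.radius (-(1 / 2))

theorem eq_mul_unit : rootSeries = powSeries leafSeries.radius (1 / 2) * unit := by
  rw [unit, mul_left_comm, ← powSeries_add]
  norm_num [powSeries_zero]

theorem unit_sq : rootSeries ^ 2 = (1 - C leafSeries.radius⁻¹ * X) * unit ^ 2 := by
  conv_lhs => rw [eq_mul_unit, mul_pow, sq, ← powSeries_add]
  norm_num [powSeries_one]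

/-- `W` and `W'` are the Taylor series of a holomorphic square root of the reduced discriminant and
of its reciprocal. By compactness the reduced discriminant has no zeros on a disc slightly larger
than the closed disc of radius α. -/
theorem exists_complex_unit : ∃ (r : ℝ) (W W' : ℂ⟦X⟧), leafSeries.radius < r ∧ AbsConv r W ∧
    AbsConv r W' ∧ W * W' = 1 ∧ W ^ 2 = toComplex (unit ^ 2) ∧
    ev (leafSeries.radius : ℂ) W ^ 2 = (leafSeries.radius * (2 + slope) : ℝ) := by
  have h0 := radius_pos
  have hopen : IsOpen (Metric.ball (0 : ℂ) (1 / 2) ∩ reducedDiscr ⁻¹' {0}ᶜ) :=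
    differentiableOn_reducedDiscr.continuousOn.isOpen_inter_preimage Metric.isOpen_ball
      isOpen_compl_singleton
  have hsub : Metric.closedBall (0 : ℂ) leafSeries.radius ⊆
      Metric.ball (0 : ℂ) (1 / 2) ∩ reducedDiscr ⁻¹' {0}ᶜ := fun x hx => by
    rw [mem_closedBall_zero_iff] at hx
    exact ⟨mem_ball_zero_iff.2 (hx.trans_lt radius_lt_half), reducedDiscr_ne_zero hx⟩
  obtain ⟨δ, hδ, hδ'⟩ :=
    (isCompact_closedBall (0 : ℂ) leafSeries.radius).exists_thickening_subset_open hopen hsub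
  rw [thickening_closedBall hδ h0.le] at hδ'
  set R := δ + leafSeries.radius
  have hR : 0 < R := by positivity
  obtain ⟨w, hw, hw2⟩ := exists_sq_eq_of_differentiableOn hR
    (differentiableOn_reducedDiscr.mono fun x hx => (hδ' hx).1) fun x hx => (hδ' hx).2
  have hw0 : ∀ x ∈ Metric.ball (0 : ℂ) R, w x ≠ 0 := fun x hx h => by
    have h1 := hw2 x hx
    rw [h] at h1
    exact (hδ' hx).2 (by simpa using h1.symm)
  have hRR : leafSeries.radius < R := by simp only [R]; linarith
  -- Radii α < r < s < R: Cauchy's formula needs a closed disc inside that of radius R, and absolute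
  -- convergence holds strictly inside it.
  obtain ⟨s, hs, hsR⟩ := exists_between hRR
  obtain ⟨r, hr, hrs⟩ := exists_between hs
  have hs0 : 0 < s := h0.trans hs
  have hr0 : 0 < r := h0.trans hr
  have hsub' : Metric.closedBall (0 : ℂ) s ⊆ Metric.ball 0 R := Metric.closedBall_subset_ball hsR
  obtain ⟨W, hW, hWw⟩ := exists_taylor hs0 (hw.mono hsub')
  obtain ⟨W', hW', hWw'⟩ := exists_taylor hs0 ((hw.inv hw0).mono hsub')
  have hWr := hW r hr0.le hrs
  have hWr' := hW' r hr0.le hrs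
  have hball : ∀ {x : ℂ}, ‖x‖ < s → x ∈ Metric.ball (0 : ℂ) R := fun hx =>
    hsub' (mem_closedBall_zero_iff.2 hx.le)
  -- The disc of radius R lies in the open disc of radius 1/2 and thus omits the point 1/2.
  have hs2 : s < 1 / 2 := by
    by_contra h
    have h1 : ((1 / 2 : ℝ) : ℂ) ∈ Metric.ball (0 : ℂ) R := by
      rw [mem_ball_zero_iff, Complex.norm_real]
      norm_num
      linarith
    have h2 := (hδ' h1).1
    rw [mem_ball_zero_iff, Complex.norm_real] at h2
    norm_num at h2
  refine ⟨r, W, W', hr, hWr, hWr', ?_, ?_, ?_⟩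
  · refine eq_of_ev_eq hr0 (hWr.mul hr0.le hWr') .one fun x hx => ?_
    rw [ev_mul hWr hWr' hx.le, hWw x (hx.trans hrs), hWw' x (hx.trans hrs), ev_one, Pi.inv_apply,
      mul_inv_cancel₀ (hw0 x (hball (hx.trans hrs)))]
  · have hL : AbsConv r (1 - C (leafSeries.radius : ℂ)⁻¹ * X : ℂ⟦X⟧) := by
      rw [sub_eq_add_neg]
      exact AbsConv.one.add hr0.le ((AbsConv.const _).mul hr0.le .var).neg
    have hD : AbsConv r (toComplex (rootSeries ^ 2)) := by
      obtain ⟨t, -, ht⟩ := sq_mem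
      refine absConv_toComplex.2 ?_
      rw [sq_eq, ← map_ofNat (C : ℝ →+* ℝ⟦X⟧) 2, sub_eq_add_neg, sub_eq_add_neg]
      refine (AbsConv.one.add hr0.le ((AbsConv.const _).mul hr0.le .var).neg).add hr0.le
        (AbsConv.expand_two (absConv_quarter.mono (sq_nonneg r) ?_)).neg
      nlinarith
    have h1 : (1 - C (leafSeries.radius : ℂ)⁻¹ * X : ℂ⟦X⟧) * W ^ 2 =
        toComplex (rootSeries ^ 2) := by
      rw [sq W]
      refine eq_of_ev_eq hr0 (hL.mul hr0.le (hWr.mul hr0.le hWr)) hD fun x hx => ?_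
      rw [ev_mul hL (hWr.mul hr0.le hWr) hx.le, ev_mul hWr hWr hx.le, hWw x (hx.trans hrs), ← sq,
        hw2 x (hball (hx.trans hrs)), ← complexDiscr_eq_ev (by linarith), complexDiscr_eq_mul,
        sub_eq_add_neg, ev_add .one ((AbsConv.const _).mul hr0.le .var).neg hx.le, ev_neg,
        ev_mul (.const _) .var hx.le, ev_one, ev_C, ev_X, ← sub_eq_add_neg]
    have h2 : toComplex (1 - C leafSeries.radius⁻¹ * X) =
        (1 - C (leafSeries.radius : ℂ)⁻¹ * X : ℂ⟦X⟧) := by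
      simp
    rw [unit_sq, map_mul, h2] at h1
    refine mul_left_cancel₀ (fun h => ?_) h1
    have := congrArg constantCoeff h
    simp at this
  · have h1 : ‖(leafSeries.radius : ℂ)‖ < s := by
      rw [Complex.norm_real, Real.norm_of_nonneg h0.le]
      exact hs
    rw [hWw _ h1, hw2 _ (hball h1), reducedDiscr_radius]

/-- Formal power series over ℂ form a domain, so equal squares give `unit = ± W`; convergence passes
to `unit` and to its inverse for either sign. -/
theorem exists_unit_inv : unit ∈ regular ∧ ∃ V ∈ regular, unit * V = 1 := by
  obtain ⟨r, W, W', hr, hW, hW', hWW, hsq, -⟩ := exists_complex_unit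
  rw [map_pow] at hsq
  have hc : constantCoeff unit = 1 := by
    have := congrArg constantCoeff eq_mul_unit
    rw [constantCoeff_eq, map_mul, ← coeff_zero_eq_constantCoeff_apply (powSeries _ _),
      coeff_powSeries] at this
    simpa using this.symm
  have hinv : unit * unit⁻¹ = 1 := PowerSeries.mul_inv_cancel _ (by rw [hc]; norm_num)
  have hinv' : toComplex unit * toComplex unit⁻¹ = 1 := by rw [← map_mul, hinv, map_one]
  rcases sq_eq_sq_iff_eq_or_eq_neg.1 hsq with h | h
  · refine ⟨⟨r, hr, absConv_toComplex.1 (h ▸ hW)⟩, unit⁻¹, ⟨r, hr, absConv_toComplex.1 ?_⟩, hinv⟩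
    have : toComplex unit⁻¹ = W' := by
      linear_combination W' * hinv' - toComplex unit⁻¹ * hWW + toComplex unit⁻¹ * W' * h
    rwa [this]
  · have h' : toComplex unit = -W := by rw [h, neg_neg]
    refine ⟨⟨r, hr, absConv_toComplex.1 (h' ▸ hW.neg)⟩, unit⁻¹,
      ⟨r, hr, absConv_toComplex.1 ?_⟩, hinv⟩
    have : toComplex unit⁻¹ = -W' := by
      linear_combination -W' * hinv' - toComplex unit⁻¹ * hWW + toComplex unit⁻¹ * W' * h
    rw [this]
    exact hW'.neg

theorem unit_mem : unit ∈ regular := exists_unit_inv.1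

theorem ev_unit_sq : ev leafSeries.radius unit ^ 2 = leafSeries.radius * (2 + slope) := by
  obtain ⟨r, W, W', hr, hW, hW', hWW, hsq, h⟩ := exists_complex_unit
  have hn : ‖(leafSeries.radius : ℂ)‖ ≤ r := by
    rw [Complex.norm_real, Real.norm_of_nonneg radius_pos.le]
    exact hr.le
  have hu := absConv_toComplex.2 (absConv_of_mem_overconvergent unit_mem)
  have hn' : ‖(leafSeries.radius : ℂ)‖ ≤ leafSeries.radius := by
    rw [Complex.norm_real, Real.norm_of_nonneg radius_pos.le]
  rw [sq, ← ev_mul hW hW hn, ← sq, hsq, map_pow, sq, ev_mul hu hu hn', ev_toComplex, ← sq] at h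
  exact_mod_cast h

end rootSeries

/-! ### Coefficient asymptotics -/

open PowerSeries in
theorem factorial_mul_choose (s : ℝ) (n : ℕ) :
    (-1) ^ n * Ring.choose (-s) n = (∏ j ∈ Finset.range n, (s + j)) / n.factorial := by
  have h1 := Ring.descPochhammer_eq_factorial_smul_choose (-s) n
  have h2 : ∀ n : ℕ, (-1) ^ n * (descPochhammer ℤ n).smeval (-s) = ∏ j ∈ Finset.range n, (s + j) := by
    intro n
    induction n with
    | zero => simp [descPochhammer_zero]
    | succ n ih =>
      rw [Finset.prod_range_succ, ← ih, descPochhammer_succ_right, Polynomial.smeval_mul,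
        Polynomial.smeval_sub, Polynomial.smeval_X, Polynomial.smeval_natCast]
      simp
      ring
  rw [← h2, h1, eq_div_iff (by positivity), nsmul_eq_mul]
  ring

theorem tendsto_natCast_div_add (s : ℝ) :
    Tendsto (fun n : ℕ => (n : ℝ) / (s + n)) atTop (𝓝 1) := by
  have := tendsto_natCast_div_add_atTop s
  simpa only [add_comm] using this

/-- The coefficients of `(1 - x) ^ (-s)`. -/
theorem tendsto_prod_div_factorial (s : ℝ) :
    Tendsto (fun n : ℕ => (∏ j ∈ Finset.range n, (s + j)) / n.factorial * (n : ℝ) ^ (1 - s)) atTop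
      (𝓝 (Real.Gamma s)⁻¹) := by
  have hev : ∀ᶠ n : ℕ in atTop, s + n ≠ 0 := by
    filter_upwards [(tendsto_natCast_atTop_atTop (R := ℝ)).eventually_gt_atTop (-s)] with n hn
    linarith
  -- At a pole `Real.Gamma` takes the value 0, whose inverse is 0; the product eventually contains a
  -- zero factor, so the formula persists. Otherwise it is Euler's limit.
  by_cases hs : Real.Gamma s = 0
  · obtain ⟨m, hm⟩ := (Real.Gamma_eq_zero_iff s).1 hs
    rw [hs, inv_zero]
    refine tendsto_const_nhds.congr' ?_
    filter_upwards [eventually_gt_atTop m] with n hn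
    rw [Finset.prod_eq_zero (Finset.mem_range.2 hn) (by rw [hm]; ring)]
    simp
  · have h := ((Real.GammaSeq_tendsto_Gamma s).inv₀ hs).mul (tendsto_natCast_div_add s)
    rw [mul_one] at h
    refine h.congr' ?_
    filter_upwards [hev, eventually_gt_atTop 0] with n hn hn0
    have hn0' : (0 : ℝ) < n := Nat.cast_pos.2 hn0
    have h1 : (n : ℝ) ^ s ≠ 0 := (Real.rpow_pos_of_pos hn0' s).ne'
    rw [Real.GammaSeq, Finset.prod_range_succ, Real.rpow_sub hn0', Real.rpow_one, inv_div]
    have h2 : (n.factorial : ℝ) ≠ 0 := by positivity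
    field_simp

theorem tendsto_natCast_add_div (k : ℕ) :
    Tendsto (fun n : ℕ => ((n : ℝ) + k + 1) / (n + 1)) atTop (𝓝 1) := by
  have h1 : Tendsto (fun n : ℕ => (k : ℝ) / ((n : ℝ) + 1)) atTop (𝓝 0) :=
    tendsto_const_nhds.div_atTop
      (tendsto_atTop_add_const_right _ _ tendsto_natCast_atTop_atTop)
  have h2 := h1.const_add 1
  rw [add_zero] at h2
  refine h2.congr fun n => ?_
  have : (n : ℝ) + 1 ≠ 0 := by positivity
  field_simp
  ring

/-- Geometric decay beats every power of k; this supplies the dominating series for the convolution.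
-/
theorem summable_rpow_mul {a : ℕ → ℝ} {q : ℝ} (hq : 1 < q) (ha : Summable fun k => |a k| * q ^ k)
    (p : ℝ) : Summable fun k : ℕ => ((k : ℝ) + 1) ^ p * |a k| := by
  obtain ⟨P, hP⟩ := exists_nat_ge p
  have h1 := (tendsto_pow_const_div_const_pow_of_one_lt P hq).comp (tendsto_add_atTop_nat 1)
  obtain ⟨M, hM⟩ := h1.bddAbove_range
  have hq0 : 0 < q := by linarith
  refine Summable.of_nonneg_of_le (fun k => by positivity) (fun k => ?_) (ha.mul_left (M * q))
  have h2 : ((k : ℝ) + 1) ^ P / q ^ (k + 1) ≤ M := by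
    have := hM ⟨k, rfl⟩
    simpa using this
  rw [div_le_iff₀ (by positivity)] at h2
  have h3 : ((k : ℝ) + 1) ^ p ≤ ((k : ℝ) + 1) ^ P := by
    rw [← Real.rpow_natCast]
    exact Real.rpow_le_rpow_of_exponent_le (by linarith [Nat.cast_nonneg (α := ℝ) k]) hP
  calc ((k : ℝ) + 1) ^ p * |a k| ≤ (M * q ^ (k + 1)) * |a k| :=
        mul_le_mul_of_nonneg_right (h3.trans h2) (abs_nonneg _)
    _ = _ := by ring

/-- Tannery's theorem: the k-th term tends to L a_k, and the ratio (n + 1)/(n - k + 1) lies between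
1 and k + 1, which bounds its t-th power by (k + 1)^|t|. -/
theorem tendsto_convolution {c a : ℕ → ℝ} {t L q : ℝ} (hq : 1 < q)
    (ha : Summable fun k => |a k| * q ^ k)
    (hc : Tendsto (fun n : ℕ => c n * ((n : ℝ) + 1) ^ t) atTop (𝓝 L)) :
    Tendsto (fun n : ℕ => (∑ p ∈ Finset.HasAntidiagonal.antidiagonal n, c p.1 * a p.2) *
      ((n : ℝ) + 1) ^ t) atTop (𝓝 (L * ∑' k, a k)) := by
  obtain ⟨M, hM⟩ : ∃ M, ∀ n : ℕ, |c n * ((n : ℝ) + 1) ^ t| ≤ M := by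
    obtain ⟨M, hM⟩ := hc.abs.bddAbove_range
    exact ⟨M, fun n => hM ⟨n, rfl⟩⟩
  have hM0 : 0 ≤ M := (abs_nonneg _).trans (hM 0)
  have hfac : ∀ m k : ℕ, c m * (((m + k : ℕ) : ℝ) + 1) ^ t =
      c m * ((m : ℝ) + 1) ^ t * (((m : ℝ) + k + 1) / (m + 1)) ^ t := by
    intro m k
    rw [Real.div_rpow (by positivity) (by positivity)]
    have : ((m : ℝ) + 1) ^ t ≠ 0 := (Real.rpow_pos_of_pos (by positivity) t).ne'
    push_cast
    field_simp
  set f : ℕ → ℕ → ℝ := fun n k => if k ≤ n then c (n - k) * ((n : ℝ) + 1) ^ t * a k else 0 with hf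
  have hsum : ∀ n : ℕ, (∑ p ∈ Finset.HasAntidiagonal.antidiagonal n, c p.1 * a p.2) *
      ((n : ℝ) + 1) ^ t = ∑' k, f n k := by
    intro n
    rw [tsum_eq_sum (s := Finset.range (n + 1)) (fun k hk => if_neg (by simpa using hk)),
      ← Finset.Nat.sum_antidiagonal_eq_sum_range_succ (fun k i => f n k), Finset.sum_mul,
      ← Finset.Nat.sum_antidiagonal_swap]
    refine Finset.sum_congr rfl fun p hp => ?_
    have hp := Finset.HasAntidiagonal.mem_antidiagonal.1 hp
    have h1 : p.1 ≤ n := by omega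
    have h2 : n - p.1 = p.2 := by omega
    simp only [hf, if_pos h1, h2, Prod.fst_swap, Prod.snd_swap]
    ring
  simp_rw [hsum]
  rw [← tsum_mul_left]
  refine tendsto_tsum_of_dominated_convergence
    (bound := fun k => M * (((k : ℝ) + 1) ^ |t| * |a k|))
    ((summable_rpow_mul hq ha |t|).mul_left M) (fun k => ?_) (Eventually.of_forall fun n k => ?_)
  · rw [← tendsto_add_atTop_iff_nat k]
    have h1 := (hc.mul ((tendsto_natCast_add_div k).rpow_const (p := t)
      (Or.inl one_ne_zero))).mul_const (a k)
    rw [Real.one_rpow, mul_one] at h1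
    refine h1.congr fun m => ?_
    simp only [hf, if_pos (Nat.le_add_left k m), Nat.add_sub_cancel]
    rw [hfac]
  · simp only [hf]
    split_ifs with hk
    · obtain ⟨m, rfl⟩ := Nat.exists_eq_add_of_le' hk
      rw [Nat.add_sub_cancel, hfac, norm_mul, norm_mul, Real.norm_eq_abs, Real.norm_eq_abs,
        Real.norm_eq_abs, mul_assoc]
      refine mul_le_mul (hM m) (mul_le_mul_of_nonneg_right ?_ (abs_nonneg _)) (by positivity) hM0
      have h1 : (1 : ℝ) ≤ ((m : ℝ) + k + 1) / (m + 1) := by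
        rw [le_div_iff₀ (by positivity)]
        linarith [Nat.cast_nonneg (α := ℝ) k]
      have h2 : ((m : ℝ) + k + 1) / (m + 1) ≤ k + 1 := by
        rw [div_le_iff₀ (by positivity)]
        nlinarith [Nat.cast_nonneg (α := ℝ) k, Nat.cast_nonneg (α := ℝ) m]
      rw [abs_of_nonneg (by positivity)]
      calc _ ≤ (((m : ℝ) + k + 1) / (m + 1)) ^ |t| :=
            Real.rpow_le_rpow_of_exponent_le h1 (le_abs_self t)
        _ ≤ _ := Real.rpow_le_rpow (by positivity) h2 (abs_nonneg t)
    · rw [norm_zero]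
      positivity

namespace PowerSeries

theorem tendsto_coeff_powSeries_mul {α s : ℝ} (hα : 0 < α) {g : ℝ⟦X⟧}
    (hg : g ∈ overconvergent ℝ hα.le) :
    Tendsto (fun n : ℕ => coeff n (powSeries α (-s) * g) * α ^ n * ((n : ℝ) + 1) ^ (1 - s)) atTop
      (𝓝 ((Real.Gamma s)⁻¹ * ev α g)) := by
  obtain ⟨r, hr, hg⟩ := hg
  have hc : Tendsto (fun n : ℕ => (coeff n (powSeries α (-s)) * α ^ n) *
      ((n : ℝ) + 1) ^ (1 - s)) atTop (𝓝 (Real.Gamma s)⁻¹) := by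
    have h1 := (tendsto_prod_div_factorial s).mul
      (((tendsto_natCast_div_add 1).inv₀ one_ne_zero).rpow_const (p := 1 - s)
        (Or.inl (inv_ne_zero one_ne_zero)))
    rw [inv_one, Real.one_rpow, mul_one] at h1
    refine h1.congr' ?_
    filter_upwards [eventually_gt_atTop 0] with n hn
    have hn' : (0 : ℝ) < n := Nat.cast_pos.2 hn
    rw [inv_div, Real.div_rpow (by positivity) hn'.le, ← factorial_mul_choose, coeff_powSeries]
    have : (n : ℝ) ^ (1 - s) ≠ 0 := (Real.rpow_pos_of_pos hn' _).ne'
    have h2 : (-α⁻¹) ^ n * Ring.choose (-s) n * α ^ n = (-1) ^ n * Ring.choose (-s) n := by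
      have : (-α⁻¹) ^ n * α ^ n = (-1) ^ n := by
        rw [← mul_pow, neg_mul, inv_mul_cancel₀ hα.ne']
      rw [← this]
      ring
    rw [h2, add_comm (1 : ℝ)]
    field_simp
  have ha : Summable fun k => |coeff k g * α ^ k| * (r / α) ^ k := by
    refine hg.congr fun k => ?_
    rw [abs_mul, abs_of_nonneg (pow_nonneg hα.le k), div_pow, Real.norm_eq_abs]
    field_simp
  refine (tendsto_convolution ((one_lt_div hα).2 hr) ha hc).congr fun n => ?_
  rw [coeff_mul, Finset.sum_mul _ _ (α ^ n)]
  congr 1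
  refine Finset.sum_congr rfl fun p hp => ?_
  rw [← Finset.HasAntidiagonal.mem_antidiagonal.1 hp, pow_add]
  ring

end PowerSeries

namespace PowerSeries

/-- A weaker singularity loses a power of n against the stronger normalisation. -/
theorem tendsto_coeff_powSeries_mul_zero {α s t : ℝ} (hα : 0 < α) (hst : s < t) {g : ℝ⟦X⟧}
    (hg : g ∈ overconvergent ℝ hα.le) :
    Tendsto (fun n : ℕ => coeff n (powSeries α (-s) * g) * α ^ n * ((n : ℝ) + 1) ^ (1 - t)) atTop
      (𝓝 0) := by
  have h1 : Tendsto (fun n : ℕ => ((n : ℝ) + 1) ^ (-(t - s))) atTop (𝓝 0) :=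
    (tendsto_rpow_neg_atTop (sub_pos.2 hst)).comp
      (tendsto_atTop_add_const_right _ _ tendsto_natCast_atTop_atTop)
  have h2 := (tendsto_coeff_powSeries_mul (s := s) hα hg).mul h1
  rw [mul_zero] at h2
  refine h2.congr fun n => ?_
  rw [mul_assoc, ← Real.rpow_add (by positivity)]
  congr 2
  ring

theorem ev_pow {r : ℝ} {f : ℝ⟦X⟧} {x : ℝ} (hr : 0 ≤ r) (hf : AbsConv r f) (hx : ‖x‖ ≤ r) (j : ℕ) :
    AbsConv r (f ^ j) ∧ ev x (f ^ j) = ev x f ^ j := by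
  induction j with
  | zero => simp [AbsConv.one, ev_one]
  | succ j ih =>
    rw [pow_succ, pow_succ, ev_mul ih.1 hf hx, ih.2]
    exact ⟨ih.1.mul hr hf, rfl⟩

end PowerSeries

namespace rootSeries

open PowerSeries leafSeries

/-- B = 1 - y has the exponent 1/2, and Γ(-1/2) = -2√π; the constant 1 affects only the coefficient
of order zero. -/
theorem tendsto_coeff_leafSeries :
    Tendsto (fun n : ℕ => coeff n leafSeries * leafSeries.radius ^ n * ((n : ℝ) + 1) ^ (3 / 2 : ℝ))
      atTop (𝓝 (ev leafSeries.radius unit / (2 * √Real.pi))) := by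
  have h := (tendsto_coeff_powSeries_mul (s := -(1 / 2)) radius_pos unit_mem).neg
  have hG : Real.Gamma (-(1 / 2)) = -(2 * √Real.pi) := by
    have := Real.Gamma_add_one (s := -(1 / 2)) (by norm_num)
    norm_num at this
    rw [Real.Gamma_one_half_eq] at this
    linarith
  have h2 : -((Real.Gamma (-(1 / 2)))⁻¹ * ev leafSeries.radius unit) =
      ev leafSeries.radius unit / (2 * √Real.pi) := by
    rw [hG, inv_neg]
    ring
  rw [h2, neg_neg, ← eq_mul_unit] at h
  refine h.congr' ?_
  filter_upwards [eventually_gt_atTop 0] with n hn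
  have : leafSeries = 1 - rootSeries := by rw [rootSeries]; ring
  rw [this, map_sub, PowerSeries.coeff_one, if_neg hn.ne']
  norm_num

/-- The square determines the value up to sign; nonnegative coefficients of B exclude the negative
one. -/
theorem ev_unit_pos : 0 < ev leafSeries.radius unit := by
  have h1 : 0 ≤ ev leafSeries.radius unit / (2 * √Real.pi) :=
    ge_of_tendsto' tendsto_coeff_leafSeries fun n => by
      have := leafSeries.coeff_nonneg n
      have := radius_pos
      positivity
  have h2 := ev_unit_sq
  have h3 : 0 ≤ ev leafSeries.radius unit := by
    by_contra h
    exact absurd h1 (not_le.2 (div_neg_of_neg_of_pos (not_le.1 h) (by positivity)))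
  refine lt_of_le_of_ne h3 fun h => ?_
  rw [← h] at h2
  have := radius_pos
  have := slope_nonneg
  have : 0 < leafSeries.radius * (2 + slope) := by positivity
  linarith

/-- Coefficient asymptotics for a series with an algebraic singularity. -/
theorem tendsto_coeff {f e : ℝ⟦X⟧} {c : ℝ} {j : ℕ} (he : e ∈ sqrtRing)
    (h : f * rootSeries ^ j = C c + rootSeries * e) :
    Tendsto (fun n : ℕ => coeff n f * leafSeries.radius ^ n * ((n : ℝ) + 1) ^ (1 - (j : ℝ) / 2))
      atTop (𝓝 (c / (ev leafSeries.radius unit ^ j * Real.Gamma (j / 2)))) := by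
  obtain ⟨hu, V, hV, hUV⟩ := exists_unit_inv
  obtain ⟨p, hp, q, hq, rfl⟩ := he
  have hn : ‖leafSeries.radius‖ ≤ leafSeries.radius := (Real.norm_of_nonneg radius_pos.le).le
  have hVa := absConv_of_mem_overconvergent hV
  have hVj := ev_pow radius_pos.le hVa hn j
  have hev : ev leafSeries.radius unit * ev leafSeries.radius V = 1 := by
    rw [← ev_mul (absConv_of_mem_overconvergent hu) hVa hn, hUV, ev_one]
  have hP : powSeries leafSeries.radius (-(j / 2)) * powSeries leafSeries.radius (1 / 2) ^ j = 1 := by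
    have h1 : ∀ j : ℕ, powSeries leafSeries.radius (1 / 2) ^ j =
        powSeries leafSeries.radius (j / 2) := by
      intro j
      induction j with
      | zero => simp [powSeries_zero]
      | succ j ih =>
        rw [pow_succ, ih, ← powSeries_add]
        congr 1
        push_cast
        ring
    rw [h1, ← powSeries_add, neg_add_cancel, powSeries_zero]
  -- With e = p + q y and y = (1 - x/α)^(1/2) u, division by y^j gives the exponents -j/2, -(j -
  -- 1)/2 and -(j - 2)/2; only the first contributes to the limit.
  have hf : f = powSeries leafSeries.radius (-(j / 2)) * (C c * V ^ j) +
      powSeries leafSeries.radius (-((j - 1) / 2)) * (unit * p * V ^ j) +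
      powSeries leafSeries.radius (-((j - 2) / 2)) * (unit ^ 2 * q * V ^ j) := by
    have h1 : powSeries leafSeries.radius (-((j - 1) / 2)) =
        powSeries leafSeries.radius (-(j / 2)) * powSeries leafSeries.radius (1 / 2) := by
      rw [← powSeries_add]
      congr 1
      ring
    have h2 : powSeries leafSeries.radius (-((j - 2) / 2)) =
        powSeries leafSeries.radius (-(j / 2)) * powSeries leafSeries.radius (1 / 2) ^ 2 := by
      rw [sq, ← powSeries_add, ← powSeries_add]
      congr 1
      ring
    have h3 : unit ^ j * V ^ j = 1 := by rw [← mul_pow, hUV, one_pow]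
    rw [h1, h2]
    rw [eq_mul_unit, mul_pow] at h
    linear_combination (powSeries leafSeries.radius (-(j / 2)) * V ^ j) * h - f * hP -
      f * powSeries leafSeries.radius (-(j / 2)) * powSeries leafSeries.radius (1 / 2) ^ j * h3
  have hreg : V ^ j ∈ regular := Subring.pow_mem _ hV j
  have h1 := tendsto_coeff_powSeries_mul (s := j / 2) radius_pos
    (Subring.mul_mem _ (C_mem_overconvergent c) hreg)
  have h2 := tendsto_coeff_powSeries_mul_zero (s := (j - 1) / 2) (t := j / 2) radius_pos
    (by linarith) (Subring.mul_mem _ (Subring.mul_mem _ hu hp) hreg)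
  have h3 := tendsto_coeff_powSeries_mul_zero (s := (j - 2) / 2) (t := j / 2) radius_pos
    (by linarith) (Subring.mul_mem _ (Subring.mul_mem _ (Subring.pow_mem _ hu 2) hq) hreg)
  have h4 := (h1.add h2).add h3
  have hlim : (Real.Gamma (j / 2))⁻¹ * ev leafSeries.radius (C c * V ^ j) + 0 + 0 =
      c / (ev leafSeries.radius unit ^ j * Real.Gamma (j / 2)) := by
    rw [ev_mul (AbsConv.const c) hVj.1 hn, hVj.2, ev_C,
      eq_inv_of_mul_eq_one_right hev, add_zero, add_zero, inv_pow, div_eq_mul_inv c, _root_.mul_inv]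
    ring
  rw [hlim] at h4
  refine h4.congr fun n => ?_
  conv_rhs => rw [hf, map_add, map_add]
  ring

end rootSeries

namespace TreeClass

open PowerSeries rootSeries MarkedClass UBClass

theorem tendsto_coeff_allSeries (S : TreeClass) :
    Tendsto (fun n : ℕ => coeff n (allSeries {S}) * leafSeries.radius ^ n *
      ((n : ℝ) + 1) ^ (1 - ((weight {S} : ℝ) - 1) / 2)) atTop
      (𝓝 (constant {S} / (ev leafSeries.radius unit ^ (weight {S} - 1) *
        Real.Gamma (((weight {S} : ℝ) - 1) / 2)))) := by
  obtain ⟨e, he, h⟩ := allSeries_expansion (F := {S}) (by simp)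
  have hw := two_le_weight (F := {S}) (by simp)
  obtain ⟨k, hk⟩ := Nat.exists_eq_add_of_le' (by omega : 1 ≤ weight {S})
  rw [hk] at h ⊢
  have := tendsto_coeff (j := k) he (mul_left_cancel₀ rootSeries.ne_zero
    (by rw [← h]; ring : rootSeries * (allSeries {S} * rootSeries ^ k) = _))
  simpa using this

/-- G_S = y A_S, so one more factor y cancels than for all embeddings. For the single vertex the
exponent is 0 and the limit is 0, which is too weak; that case needs `tendsto_coeff_leafSeries`. -/
theorem tendsto_coeff_goodSeries (S : TreeClass) :
    Tendsto (fun n : ℕ => coeff n (goodSeries S) * leafSeries.radius ^ n *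
      ((n : ℝ) + 1) ^ (1 - ((weight {S} : ℝ) - 2) / 2)) atTop
      (𝓝 (constant {S} / (ev leafSeries.radius unit ^ (weight {S} - 2) *
        Real.Gamma (((weight {S} : ℝ) - 2) / 2)))) := by
  obtain ⟨e, he, h⟩ := allSeries_expansion (F := {S}) (by simp)
  have hw := two_le_weight (F := {S}) (by simp)
  obtain ⟨k, hk⟩ := Nat.exists_eq_add_of_le' hw
  rw [hk] at h ⊢
  have := tendsto_coeff (j := k) (f := goodSeries S) he (mul_left_cancel₀ rootSeries.ne_zero
    (by rw [← h, ← root_mul_allSeries_singleton]; ring))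
  simpa using this

end TreeClass

/-! ### Numerical bounds -/

namespace leafSeries

open PowerSeries

theorem coeff_rec {n : ℕ} (hn : 2 ≤ n) : coeff n leafSeries =
    (∑ k ∈ Finset.range (n + 1), coeff k leafSeries * coeff (n - k) leafSeries +
      if 2 ∣ n then coeff (n / 2) leafSeries else 0) / 2 := by
  have h := two_mul_coeff n
  rw [if_neg (by omega), Finset.Nat.sum_antidiagonal_eq_sum_range_succ
    (fun i j => coeff i leafSeries * coeff j leafSeries)] at h
  linarith

/-- The recursion is run up to 15 leaves, which suffices for four decimals of both constants. -/
theorem coeff_values {n : ℕ} (hn : n < 16) : coeff n leafSeries =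
    ([0, 1, 1, 1, 2, 3, 6, 11, 23, 46, 98, 207, 451, 983, 2179, 4850].getD n 0 : ℝ) := by
  have h0 := coeff_zero
  have h1 := coeff_one
  have h2 := coeff_two
  have h3 := coeff_rec (n := 3) (by norm_num)
  norm_num [Finset.sum_range_succ, -PowerSeries.coeff_zero_eq_constantCoeff, h0, h1, h2] at h3
  have h4 := coeff_rec (n := 4) (by norm_num)
  norm_num [Finset.sum_range_succ, -PowerSeries.coeff_zero_eq_constantCoeff, h0, h1, h2, h3] at h4
  have h5 := coeff_rec (n := 5) (by norm_num)
  norm_num [Finset.sum_range_succ, -PowerSeries.coeff_zero_eq_constantCoeff, h0, h1, h2, h3, h4] at h5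
  have h6 := coeff_rec (n := 6) (by norm_num)
  norm_num [Finset.sum_range_succ, -PowerSeries.coeff_zero_eq_constantCoeff, h0, h1, h2, h3, h4, h5] at h6
  have h7 := coeff_rec (n := 7) (by norm_num)
  norm_num [Finset.sum_range_succ, -PowerSeries.coeff_zero_eq_constantCoeff, h0, h1, h2, h3, h4, h5, h6] at h7
  have h8 := coeff_rec (n := 8) (by norm_num)
  norm_num [Finset.sum_range_succ, -PowerSeries.coeff_zero_eq_constantCoeff, h0, h1, h2, h3, h4, h5, h6, h7] at h8
  have h9 := coeff_rec (n := 9) (by norm_num)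
  norm_num [Finset.sum_range_succ, -PowerSeries.coeff_zero_eq_constantCoeff, h0, h1, h2, h3, h4, h5, h6, h7,
    h8] at h9
  have h10 := coeff_rec (n := 10) (by norm_num)
  norm_num [Finset.sum_range_succ, -PowerSeries.coeff_zero_eq_constantCoeff, h0, h1, h2, h3, h4, h5, h6, h7,
    h8, h9] at h10
  have h11 := coeff_rec (n := 11) (by norm_num)
  norm_num [Finset.sum_range_succ, -PowerSeries.coeff_zero_eq_constantCoeff, h0, h1, h2, h3, h4, h5, h6, h7,
    h8, h9, h10] at h11
  have h12 := coeff_rec (n := 12) (by norm_num)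
  norm_num [Finset.sum_range_succ, -PowerSeries.coeff_zero_eq_constantCoeff, h0, h1, h2, h3, h4, h5, h6, h7,
    h8, h9, h10, h11] at h12
  have h13 := coeff_rec (n := 13) (by norm_num)
  norm_num [Finset.sum_range_succ, -PowerSeries.coeff_zero_eq_constantCoeff, h0, h1, h2, h3, h4, h5, h6, h7,
    h8, h9, h10, h11, h12] at h13
  have h14 := coeff_rec (n := 14) (by norm_num)
  norm_num [Finset.sum_range_succ, -PowerSeries.coeff_zero_eq_constantCoeff, h0, h1, h2, h3, h4, h5, h6, h7,
    h8, h9, h10, h11, h12, h13] at h14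
  have h15 := coeff_rec (n := 15) (by norm_num)
  norm_num [Finset.sum_range_succ, -PowerSeries.coeff_zero_eq_constantCoeff, h0, h1, h2, h3, h4, h5, h6, h7,
    h8, h9, h10, h11, h12, h13, h14] at h15
  interval_cases n <;> simp [-PowerSeries.coeff_zero_eq_constantCoeff, *]

theorem partialSum_fifteen (x : ℝ) : partialSum 15 x =
    x + x ^ 2 + x ^ 3 + 2 * x ^ 4 + 3 * x ^ 5 + 6 * x ^ 6 + 11 * x ^ 7 + 23 * x ^ 8 + 46 * x ^ 9 +
      98 * x ^ 10 + 207 * x ^ 11 + 451 * x ^ 12 + 983 * x ^ 13 + 2179 * x ^ 14 + 4850 * x ^ 15 := by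
  rw [partialSum, Finset.sum_congr rfl fun n hn => by rw [coeff_values (Finset.mem_range.1 hn)]]
  simp [Finset.sum_range_succ]

theorem partialSum_mono (N : ℕ) {x y : ℝ} (hx : 0 ≤ x) (hxy : x ≤ y) :
    partialSum N x ≤ partialSum N y :=
  Finset.sum_le_sum fun n _ =>
    mul_le_mul_of_nonneg_left (pow_le_pow_left₀ hx hxy n) (coeff_nonneg n)

/-- Partial sums bound B(α²) from below, so the discriminant would be negative if α were at least
0.4027. -/
theorem radius_lt : radius < 0.4027 := by
  by_contra! h
  have h1 := discr_radius
  have h2 := partialSum_le_ev absConv_quarter (sq_nonneg radius)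
    (by nlinarith [radius_pos, radius_lt_half]) 15
  have h3 := partialSum_mono 15 (sq_nonneg (0.4027 : ℝ)) (pow_le_pow_left₀ (by norm_num) h 2)
  have h4 : (1 : ℝ) - 2 * 0.4027 < partialSum 15 (0.4027 ^ 2) := by
    rw [partialSum_fifteen]
    norm_num
  rw [discr] at h1
  linarith

theorem tail_le (N : ℕ) : ∑' n, coeff (n + N) leafSeries * radius ^ (n + N) ≤ 1 := by
  have hs := (absConv_radius.hasSum (Real.norm_of_nonneg radius_pos.le).le).summable
  have h := hs.sum_add_tsum_nat_add N
  have h1 : 0 ≤ ∑ n ∈ Finset.range N, coeff n leafSeries * radius ^ n :=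
    Finset.sum_nonneg fun n _ => mul_nonneg (coeff_nonneg n) (pow_nonneg radius_pos.le n)
  have h2 := ev_radius
  rw [ev] at h2
  linarith

theorem summable_tail (N : ℕ) : Summable fun n => coeff (n + N) leafSeries * radius ^ (n + N) :=
  (summable_nat_add_iff N).2 (absConv_radius.hasSum (Real.norm_of_nonneg radius_pos.le).le).summable

/-- For n ≥ 16 one has α^(2n) ≤ α^16 α^n, and the coefficients weighted by α^n sum to B(α) = 1; so
the tail of B(α²) is at most α^16. -/
theorem lt_radius : 0.402697 < radius := by
  by_contra! h
  have h0 := radius_pos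
  have h1 := discr_radius
  have hn : ‖radius ^ 2‖ ≤ 1 / 4 := by
    rw [Real.norm_of_nonneg (sq_nonneg radius)]
    nlinarith [radius_lt_half]
  have hs := (absConv_quarter.hasSum hn).summable
  have h2 := hs.sum_add_tsum_nat_add 16
  have h3 : ∑' n, coeff (n + 16) leafSeries * (radius ^ 2) ^ (n + 16) ≤ radius ^ 16 * 1 := by
    refine le_trans ?_ (mul_le_mul_of_nonneg_left (tail_le 16) (by positivity))
    rw [← tsum_mul_left]
    refine ((summable_nat_add_iff 16).2 hs).tsum_le_tsum (fun n => ?_)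
      ((summable_tail 16).mul_left _)
    have h4 : radius ^ n ≤ 1 := pow_le_one₀ h0.le (by linarith [radius_lt_half])
    have h5 := coeff_nonneg (n + 16)
    calc _ = radius ^ 16 * (coeff (n + 16) leafSeries * radius ^ (n + 16)) * radius ^ n := by ring
      _ ≤ radius ^ 16 * (coeff (n + 16) leafSeries * radius ^ (n + 16)) * 1 := by gcongr
      _ = _ := mul_one _
  have h4 : ∑ n ∈ Finset.range 16, coeff n leafSeries * (radius ^ 2) ^ n ≤
      partialSum 15 (0.402697 ^ 2) :=
    partialSum_mono 15 (sq_nonneg radius) (pow_le_pow_left₀ h0.le h 2)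
  have h5 : radius ^ 16 ≤ 0.402697 ^ 16 := pow_le_pow_left₀ h0.le h 16
  have h6 : partialSum 15 (0.402697 ^ 2) + 0.402697 ^ 16 < (1 : ℝ) - 2 * 0.402697 := by
    rw [partialSum_fifteen]
    norm_num
  rw [discr, ev] at h1
  linarith

/-- The partial sum of the series for the slope. -/
noncomputable def slopeSum (x : ℝ) : ℝ :=
  ∑ n ∈ Finset.range 16, coeff n leafSeries * (n * (x ^ 2) ^ (n - 1) * (2 * x))

theorem slopeSum_eq (x : ℝ) : slopeSum x = 2 * x * (1 + 2 * x ^ 2 + 3 * (x ^ 2) ^ 2 +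
    8 * (x ^ 2) ^ 3 + 15 * (x ^ 2) ^ 4 + 36 * (x ^ 2) ^ 5 + 77 * (x ^ 2) ^ 6 + 184 * (x ^ 2) ^ 7 +
    414 * (x ^ 2) ^ 8 + 980 * (x ^ 2) ^ 9 + 2277 * (x ^ 2) ^ 10 + 5412 * (x ^ 2) ^ 11 +
    12779 * (x ^ 2) ^ 12 + 30506 * (x ^ 2) ^ 13 + 72750 * (x ^ 2) ^ 14) := by
  rw [slopeSum, Finset.sum_congr rfl fun n hn => by rw [coeff_values (Finset.mem_range.1 hn)]]
  simp [Finset.sum_range_succ]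
  ring

theorem slopeSum_mono {x y : ℝ} (hx : 0 ≤ x) (hxy : x ≤ y) : slopeSum x ≤ slopeSum y := by
  refine Finset.sum_le_sum fun n _ => mul_le_mul_of_nonneg_left ?_ (coeff_nonneg n)
  gcongr

theorem lt_slope : 1.171044 < slope := by
  have h1 : slopeSum radius ≤ slope := summable_slope.sum_le_tsum _ fun n _ => by
    have := coeff_nonneg n
    have := radius_pos
    positivity
  have h2 := slopeSum_mono (by norm_num) lt_radius.le
  have h3 : 1.171044 < slopeSum 0.402697 := by
    rw [slopeSum_eq]
    norm_num
  linarith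

/-- For x ≤ 1/2 the sequence n x^(n-1) decreases from n = 16 on. The tail of the slope, with terms 2
(n α^(n-1)) b_n α^n, is then at most 32 α^15. -/
theorem natCast_mul_pow_le {x : ℝ} (hx : 0 ≤ x) (hx' : x ≤ 1 / 2) (n : ℕ) :
    ((n + 16 : ℕ) : ℝ) * x ^ (n + 15) ≤ 16 * x ^ 15 := by
  induction n with
  | zero => norm_num
  | succ n ih =>
    refine le_trans ?_ ih
    have h1 : ((n + 1 + 16 : ℕ) : ℝ) * x ≤ (n + 16 : ℕ) := by
      push_cast
      nlinarith [Nat.cast_nonneg (α := ℝ) n]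
    calc _ = (((n + 1 + 16 : ℕ) : ℝ) * x) * x ^ (n + 15) := by ring
      _ ≤ _ := mul_le_mul_of_nonneg_right h1 (by positivity)

theorem slope_lt : slope < 1.17129 := by
  have h0 := radius_pos
  have h1 := summable_slope.sum_add_tsum_nat_add 16
  have h2 : ∑' n, coeff (n + 16) leafSeries *
      ((n + 16 : ℕ) * (radius ^ 2) ^ (n + 16 - 1) * (2 * radius)) ≤ 2 * (16 * radius ^ 15) * 1 := by
    refine le_trans ?_ (mul_le_mul_of_nonneg_left (tail_le 16) (by positivity))
    rw [← tsum_mul_left]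
    refine ((summable_nat_add_iff 16).2 summable_slope).tsum_le_tsum (fun n => ?_)
      ((summable_tail 16).mul_left _)
    have h3 := natCast_mul_pow_le h0.le radius_lt_half.le n
    have h4 := coeff_nonneg (n + 16)
    calc _ = 2 * (((n + 16 : ℕ) : ℝ) * radius ^ (n + 15)) *
          (coeff (n + 16) leafSeries * radius ^ (n + 16)) := by
          rw [Nat.add_sub_assoc (by norm_num)]
          ring
      _ ≤ _ := by gcongr
  have h3 := slopeSum_mono h0.le radius_lt.le
  have h4 : radius ^ 15 ≤ 0.4027 ^ 15 := pow_le_pow_left₀ h0.le radius_lt.le 15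
  have h5 : slopeSum 0.4027 + 32 * 0.4027 ^ 15 < 1.17129 := by
    rw [slopeSum_eq]
    norm_num
  rw [slopeSum] at h3
  rw [slope]
  linarith

theorem abs_sqrt_radius_sub_lt : |√radius - 0.6346| < 0.00005 := by
  have h1 : 0.63455 < √radius := Real.lt_sqrt_of_sq_lt (by linarith [lt_radius])
  have h2 : √radius < 0.63465 := (Real.sqrt_lt' (by norm_num)).2 (by linarith [radius_lt])
  rw [abs_lt]
  constructor <;> linarith

theorem abs_sqrt_slope_sub_lt : |√(2 * (2 + slope)) - 2.5184| < 0.00005 := by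
  have h1 : 2.51835 < √(2 * (2 + slope)) := Real.lt_sqrt_of_sq_lt (by linarith [lt_slope])
  have h2 : √(2 * (2 + slope)) < 2.51845 :=
    (Real.sqrt_lt' (by norm_num)).2 (by linarith [slope_lt])
  rw [abs_lt]
  constructor <;> linarith

end leafSeries

/-! ### Return to counting by vertices -/

namespace RTree

open PowerSeries leafSeries rootSeries

theorem numBinary_two_mul_add_one (k : ℕ) :
    (numBinary (2 * k + 1) : ℝ) = coeff (k + 1) leafSeries := by
  rw [numBinary_eq_coeff ⟨k, rfl⟩, leafSeries]
  congr 2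
  omega

theorem injective_two_mul_add_one : Function.Injective fun k : ℕ => 2 * k + 1 :=
  fun a b h => by simpa using h

theorem numBinary_eq_zero {n : ℕ} (hn : n ∉ Set.range fun k : ℕ => 2 * k + 1) :
    numBinary n = 0 :=
  numBinary_of_even (Nat.not_odd_iff_even.1 fun ⟨k, hk⟩ => hn ⟨k, hk.symm⟩)

/-- Only n = 2k + 1 contributes, with k + 1 leaves; an extra factor r turns r^(2k+1) into
(r²)^(k+1). -/
theorem summable_numBinary_iff {r : ℝ} (hr : 0 < r) :
    (Summable fun n => (numBinary n : ℝ) * r ^ n) ↔ AbsConv (r ^ 2) leafSeries := by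
  rw [← injective_two_mul_add_one.summable_iff fun n hn => by rw [numBinary_eq_zero hn]; simp,
    AbsConv, ← summable_nat_add_iff (f := fun n => ‖coeff n leafSeries‖ * (r ^ 2) ^ n) 1,
    ← summable_mul_left_iff hr.ne']
  refine summable_congr fun k => ?_
  simp only [Function.comp]
  rw [numBinary_two_mul_add_one, Real.norm_of_nonneg (leafSeries.coeff_nonneg _)]
  ring

theorem norm_binarySeries (n : ℕ) : ‖binarySeries n‖ = numBinary n := by
  rw [binarySeries, FormalMultilinearSeries.ofScalars_norm, Real.norm_of_nonneg (by positivity)]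

theorem radius_binarySeries : binarySeries.radius = ENNReal.ofReal √leafSeries.radius := by
  have hs : 0 < √leafSeries.radius := Real.sqrt_pos.2 radius_pos
  apply le_antisymm
  · by_contra! h
    obtain ⟨r, hr, hr'⟩ := ENNReal.lt_iff_exists_nnreal_btwn.1 h
    have h1 := binarySeries.summable_norm_mul_pow hr'
    have h2 : √leafSeries.radius < r := by
      rwa [← ENNReal.ofReal_coe_nnreal, ENNReal.ofReal_lt_ofReal_iff_of_nonneg hs.le] at hr
    simp_rw [norm_binarySeries] at h1
    exact not_absConv (Real.lt_sq_of_sqrt_lt h2) ((summable_numBinary_iff (hs.trans h2)).1 h1)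
  · refine binarySeries.le_radius_of_summable ?_
    simp_rw [norm_binarySeries]
    rw [Real.coe_toNNReal _ hs.le, summable_numBinary_iff hs, Real.sq_sqrt radius_pos.le]
    exact absConv_radius

theorem mul_sum_binarySeries (z : ℝ) : z * binarySeries.sum z = ev (z ^ 2) leafSeries := by
  have h1 : binarySeries.sum z = ∑' n, (numBinary n : ℝ) * z ^ n := by
    simp only [FormalMultilinearSeries.sum, binarySeries, FormalMultilinearSeries.ofScalars_apply_eq,
      smul_eq_mul]
  rw [h1, ← injective_two_mul_add_one.tsum_eq, ← tsum_mul_left, ev,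
    ← (Nat.succ_injective).tsum_eq (f := fun n => coeff n leafSeries * (z ^ 2) ^ n)]
  · refine tsum_congr fun k => ?_
    rw [numBinary_two_mul_add_one, Nat.succ_eq_add_one]
    ring
  · intro n hn
    rcases n with _ | n
    · simp [-PowerSeries.coeff_zero_eq_constantCoeff, leafSeries.coeff_zero] at hn
    · exact ⟨n, rfl⟩
  · intro n hn
    by_contra h
    simp [numBinary_eq_zero h] at hn

theorem sum_binarySeries {z : ℝ} (h0 : 0 < z) (hz : z < √leafSeries.radius) :
    binarySeries.sum z = (1 - √(discr (z ^ 2))) / z := by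
  have h1 : z ^ 2 ≤ leafSeries.radius := ((Real.lt_sqrt h0.le).1 hz).le
  rw [eq_div_iff h0.ne', mul_comm, mul_sum_binarySeries, ← one_sub_ev_eq_sqrt (sq_nonneg z) h1]
  ring

/-- Since h(α) = 0, this is -ρ times the difference quotient of h(z²) at ρ = √α, whose derivative
there is 2 ρ h'(α). -/
theorem tendsto_discr_div :
    Tendsto (fun z : ℝ => discr (z ^ 2) / (1 - z / √leafSeries.radius)) (𝓝[<] √leafSeries.radius)
      (𝓝 (2 * leafSeries.radius * (2 + slope))) := by
  have hs : 0 < √leafSeries.radius := Real.sqrt_pos.2 radius_pos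
  have hsq : √leafSeries.radius ^ 2 = leafSeries.radius := Real.sq_sqrt radius_pos.le
  have h1 : HasDerivAt (fun z : ℝ => discr (z ^ 2)) (-(2 + slope) * (2 * √leafSeries.radius))
      √leafSeries.radius := by
    have := HasDerivAt.comp_of_eq (h := fun z : ℝ => z ^ 2) (√leafSeries.radius) hasDerivAt_discr
      (hasDerivAt_pow 2 (√leafSeries.radius)) hsq.symm
    simpa [Function.comp_def] using this
  have h2 := (hasDerivAt_iff_tendsto_slope.1 h1).mono_left
    (nhdsWithin_mono _ fun z (hz : z < √leafSeries.radius) => hz.ne)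
  have h3 := h2.const_mul (-√leafSeries.radius)
  have h4 : -√leafSeries.radius * (-(2 + leafSeries.slope) * (2 * √leafSeries.radius)) =
      2 * leafSeries.radius * (2 + leafSeries.slope) := by
    linear_combination (2 * (2 + leafSeries.slope)) * hsq
  rw [h4] at h3
  refine h3.congr' ?_
  filter_upwards [self_mem_nhdsWithin] with z hz
  have h5 : z - √leafSeries.radius ≠ 0 := sub_ne_zero.2 (ne_of_lt hz)
  have h6 : √leafSeries.radius - z ≠ 0 := sub_ne_zero.2 (ne_of_gt hz)
  rw [slope_def_field, hsq, discr_radius]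
  field_simp
  ring

theorem sum_binarySeries_isLittleO :
    (fun z : ℝ => binarySeries.sum z - (1 / √leafSeries.radius -
      √(2 * (2 + slope)) * √(1 - z / √leafSeries.radius))) =o[𝓝[<] √leafSeries.radius]
      fun z : ℝ => √(1 - z / √leafSeries.radius) := by
  have hs : 0 < √leafSeries.radius := Real.sqrt_pos.2 radius_pos
  have hev : ∀ᶠ z in 𝓝[<] √leafSeries.radius, 0 < z ∧ z < √leafSeries.radius :=
    Ioo_mem_nhdsLT hs
  have hpos : ∀ z, 0 < z ∧ z < √leafSeries.radius → 0 < 1 - z / √leafSeries.radius :=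
    fun z hz => sub_pos.2 ((div_lt_one hs).2 hz.2)
  refine isLittleO_of_tendsto' ?_ ?_
  · filter_upwards [hev] with z hz h
    exact absurd h (Real.sqrt_pos.2 (hpos z hz)).ne'
  · have hz : Tendsto (fun z : ℝ => z) (𝓝[<] √leafSeries.radius) (𝓝 √leafSeries.radius) :=
      tendsto_nhdsWithin_of_tendsto_nhds tendsto_id
    have h1 := (((hz.div_const √leafSeries.radius).const_sub 1).sqrt).div hz hs.ne'
    rw [div_self hs.ne', sub_self, Real.sqrt_zero, zero_div] at h1
    have h2 := tendsto_discr_div.sqrt.div hz hs.ne'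
    have h3 : √(2 * leafSeries.radius * (2 + slope)) / √leafSeries.radius = √(2 * (2 + slope)) := by
      rw [mul_right_comm, Real.sqrt_mul' _ radius_pos.le, mul_div_cancel_right₀ _ hs.ne']
    rw [h3] at h2
    have h4 := (h1.sub h2).add_const √(2 * (2 + slope))
    rw [zero_sub, neg_add_cancel] at h4
    refine h4.congr' ?_
    filter_upwards [hev] with z hz
    have hw := Real.sqrt_pos.2 (hpos z hz)
    have hw2 := Real.sq_sqrt (hpos z hz).le
    simp only [Pi.div_apply]
    rw [sum_binarySeries hz.1 hz.2, Real.sqrt_div' _ (hpos z hz).le]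
    set w := √(1 - z / √leafSeries.radius)
    have hz0 := hz.1.ne'
    -- As w² = 1 - z/ρ, the quotient in question becomes w/z minus √(h(z²))/(z w) plus b; the first
    -- term vanishes in the limit and the second tends to b.
    have h5 : w / z = (1 / z - 1 / √leafSeries.radius) / w := by
      rw [div_eq_div_iff hz0 hw.ne', ← sq, hw2]
      field_simp
    rw [h5]
    field_simp
    ring

/-- For odd n and k = (n + 1)/2 leaves, (ρ²)^k = ρ^(n+1), which accounts for the factor 1/ρ, and k +
1 = (n + 3)/2, which accounts for 2^t. -/
theorem isEquivalent_of_tendsto {A f : ℕ → ℝ} {ρ t u L K : ℝ} (hρ : 0 < ρ) (hL : L ≠ 0)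
    (hA : Tendsto (fun k : ℕ => A k * (ρ ^ 2) ^ k * ((k : ℝ) + 1) ^ t) atTop (𝓝 L))
    (hf : ∀ n, Odd n → f n = A ((n + 1) / 2)) (hK : K = L * ρ⁻¹ * 2 ^ t) (hu : u = -t) :
    f ~[atTop ⊓ 𝓟 {n | Odd n}] fun n : ℕ => K * ρ ^ (-(n : ℤ)) * (n : ℝ) ^ u := by
  have hev : ∀ᶠ n : ℕ in atTop ⊓ 𝓟 {n | Odd n}, Odd n :=
    mem_inf_of_right (mem_principal_self _)
  have hK0 : K ≠ 0 := by
    rw [hK]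
    have : (2 : ℝ) ^ t ≠ 0 := (Real.rpow_pos_of_pos two_pos t).ne'
    positivity
  have hpos : ∀ n : ℕ, Odd n → (0 : ℝ) < n := fun n hn => Nat.cast_pos.2 hn.pos
  refine (isEquivalent_iff_tendsto_one ?_).2 ?_
  · filter_upwards [hev] with n hn
    have := (Real.rpow_pos_of_pos (hpos n hn) u).ne'
    positivity
  · have h1 : Tendsto (fun n : ℕ => (n + 1) / 2) atTop atTop :=
      tendsto_atTop_atTop.2 fun b => ⟨2 * b, fun n hn => by omega⟩
    have h2 := ((hA.comp h1).div_const L).mul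
      ((tendsto_natCast_div_add 3).rpow_const (p := t) (Or.inl one_ne_zero))
    rw [div_self hL, Real.one_rpow, mul_one] at h2
    refine (h2.mono_left inf_le_left).congr' ?_
    filter_upwards [hev] with n hn
    obtain ⟨k, hk⟩ := hn
    have h3 : (n + 1) / 2 = k + 1 := by omega
    have hn0 : (0 : ℝ) < n := hpos n ⟨k, hk⟩
    have h4 : (3 + n : ℝ) = 2 * (((k + 1 : ℕ) : ℝ) + 1) := by
      rw [hk]
      push_cast
      ring
    simp only [Function.comp, Pi.div_apply]
    rw [hf n ⟨k, hk⟩, h3, h4, Real.div_rpow hn0.le (by positivity),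
      Real.mul_rpow two_pos.le (by positivity), hK, hu, Real.rpow_neg hn0.le, zpow_neg,
      zpow_natCast]
    have h5 : (ρ ^ 2) ^ (k + 1) = ρ ^ n * ρ := by
      rw [hk]
      ring
    have h6 : (((k + 1 : ℕ) : ℝ) + 1) ^ t ≠ 0 := (Real.rpow_pos_of_pos (by positivity) t).ne'
    have h7 : (n : ℝ) ^ t ≠ 0 := (Real.rpow_pos_of_pos hn0 t).ne'
    have h8 : (2 : ℝ) ^ t ≠ 0 := (Real.rpow_pos_of_pos two_pos t).ne'
    rw [h5]
    field_simp

theorem weight_cls (S : RTree) : TreeClass.weight {S.cls} = S.size + S.leaves := by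
  simp [TreeClass.weight]

/-- Adding a root above a nonempty forest gives weight at least 3. -/
theorem cls_eq_mk_zero {S : RTree} (h : S.size + S.leaves = 2) : S.cls = TreeClass.mk 0 := by
  obtain ⟨F, hF⟩ := TreeClass.exists_mk S.cls
  rw [← weight_cls, hF] at h
  by_cases h0 : F = 0
  · rw [hF, h0]
  · rw [TreeClass.weight_mk h0] at h
    have := TreeClass.two_le_weight h0
    omega

/-- From u(α)² = α (2 + slope) one gets u(α) = ρ b / √2; the powers of √2 later cancel those from
passing from leaves to vertices. -/
theorem ev_unit_pow (k : ℕ) : ev leafSeries.radius unit ^ k =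
    √leafSeries.radius ^ k * √(2 * (2 + slope)) ^ k * 2 ^ (-(k / 2) : ℝ) := by
  have h1 : ev leafSeries.radius unit = √leafSeries.radius * √(2 * (2 + slope)) * (√2)⁻¹ := by
    rw [← Real.sqrt_sq ev_unit_pos.le, ev_unit_sq, Real.sqrt_mul two_pos.le,
      Real.sqrt_mul radius_pos.le]
    field_simp
  rw [h1, mul_pow, mul_pow, Real.sqrt_eq_rpow 2, ← Real.rpow_neg two_pos.le, ← Real.rpow_natCast
    (2 ^ (-(1 / 2) : ℝ)), ← Real.rpow_mul two_pos.le]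
  congr 2
  ring

theorem sqrt_slope_pos : 0 < √(2 * (2 + slope)) :=
  Real.sqrt_pos.2 (by have := slope_nonneg; positivity)

theorem symmetryConstant_pos (S : RTree) : 0 < S.symmetryConstant := by
  rw [UBClass.symmetryConstant_eq]
  exact UBClass.constant_pos (by simp)

theorem totalEmb_isEquivalent (S : RTree) :
    (fun n : ℕ => (totalEmb n S : ℝ)) ~[atTop ⊓ 𝓟 {n | Odd n}] fun n : ℕ =>
      2 * S.symmetryConstant * √(2 * (2 + slope)) ^ (-(S.size : ℤ) - S.leaves + 1) *
        √leafSeries.radius ^ (-(S.size : ℤ) - S.leaves) /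
        Real.Gamma (((S.size : ℝ) + S.leaves - 1) / 2) * √leafSeries.radius ^ (-(n : ℤ)) *
        (n : ℝ) ^ (((S.size : ℝ) + S.leaves - 3) / 2) := by
  have hs : 0 < √leafSeries.radius := Real.sqrt_pos.2 radius_pos
  have hsq : √leafSeries.radius ^ 2 = leafSeries.radius := Real.sq_sqrt radius_pos.le
  have hw := TreeClass.two_le_weight (F := {S.cls}) (by simp)
  have hT := TreeClass.tendsto_coeff_allSeries S.cls
  rw [weight_cls] at hw hT
  obtain ⟨k, hk⟩ := Nat.exists_eq_add_of_le' (by omega : 1 ≤ S.size + S.leaves)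
  have hkR : (S.size : ℝ) + S.leaves = k + 1 := by exact_mod_cast hk
  have hkZ : (S.size : ℤ) + S.leaves = k + 1 := by exact_mod_cast hk
  rw [hk, ← UBClass.symmetryConstant_eq, ← hsq] at hT
  have hk0 : (0 : ℝ) < k := Nat.cast_pos.2 (by omega)
  have hG : 0 < Real.Gamma (((k : ℝ) + 1 - 1) / 2) := Real.Gamma_pos_of_pos (by linarith)
  have hC := S.symmetryConstant_pos
  have hE := ev_unit_pos
  push_cast at hT
  rw [hsq] at hT
  -- Only the base of the power becomes ρ²; the point where `unit` is evaluated stays α.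
  nth_rewrite 1 [← hsq] at hT
  refine isEquivalent_of_tendsto hs ?_ hT (fun n hn => totalEmb_eq_coeff hn S) ?_ ?_
  · have := pow_pos hE (k + 1 - 1)
    positivity
  · have h1 : -(S.size : ℤ) - S.leaves + 1 = -k := by linarith
    have h2 : -(S.size : ℤ) - S.leaves = -((k + 1 : ℕ) : ℤ) := by push_cast; linarith
    rw [h1, h2, hkR, ev_unit_pow, zpow_neg, zpow_neg, zpow_natCast,
      zpow_natCast, sub_eq_add_neg (1 : ℝ), Real.rpow_add two_pos, Real.rpow_one,
      add_sub_cancel_right]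
    rw [add_sub_cancel_right] at hG
    have h3 : (2 : ℝ) ^ (-(k / 2) : ℝ) ≠ 0 := (Real.rpow_pos_of_pos two_pos _).ne'
    have := sqrt_slope_pos
    field_simp
    rw [pow_succ]
  · rw [hkR]
    ring

theorem totalGoodEmb_isEquivalent {S : RTree} (h : 2 < S.size + S.leaves) :
    (fun n : ℕ => (totalGoodEmb n S : ℝ)) ~[atTop ⊓ 𝓟 {n | Odd n}] fun n : ℕ =>
      2 * S.symmetryConstant * √(2 * (2 + slope)) ^ (-(S.size : ℤ) - S.leaves + 2) *
        √leafSeries.radius ^ (-(S.size : ℤ) - S.leaves + 1) /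
        Real.Gamma (((S.size : ℝ) + S.leaves - 2) / 2) * √leafSeries.radius ^ (-(n : ℤ)) *
        (n : ℝ) ^ (((S.size : ℝ) + S.leaves - 4) / 2) := by
  have hs : 0 < √leafSeries.radius := Real.sqrt_pos.2 radius_pos
  have hsq : √leafSeries.radius ^ 2 = leafSeries.radius := Real.sq_sqrt radius_pos.le
  have hT := TreeClass.tendsto_coeff_goodSeries S.cls
  rw [weight_cls] at hT
  obtain ⟨k, hk⟩ := Nat.exists_eq_add_of_le' h.le
  have hkR : (S.size : ℝ) + S.leaves = k + 2 := by exact_mod_cast hk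
  have hkZ : (S.size : ℤ) + S.leaves = k + 2 := by exact_mod_cast hk
  rw [hk, ← UBClass.symmetryConstant_eq] at hT
  have hk0 : (0 : ℝ) < k := Nat.cast_pos.2 (by omega)
  have hG : 0 < Real.Gamma (((k : ℝ) + 2 - 2) / 2) := Real.Gamma_pos_of_pos (by linarith)
  have hC := S.symmetryConstant_pos
  have hE := ev_unit_pos
  push_cast at hT
  nth_rewrite 1 [← hsq] at hT
  refine isEquivalent_of_tendsto hs ?_ hT (fun n hn => totalGoodEmb_eq_coeff hn S) ?_ ?_
  · have := pow_pos hE (k + 2 - 2)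
    positivity
  · have h1 : -(S.size : ℤ) - S.leaves + 2 = -k := by linarith
    have h2 : -(S.size : ℤ) - S.leaves + 1 = -((k + 1 : ℕ) : ℤ) := by push_cast; linarith
    rw [h1, h2, hkR, ev_unit_pow, zpow_neg, zpow_neg, zpow_natCast,
      zpow_natCast, sub_eq_add_neg (1 : ℝ), Real.rpow_add two_pos, Real.rpow_one,
      add_sub_cancel_right]
    rw [add_sub_cancel_right] at hG
    have h3 : (2 : ℝ) ^ (-(k / 2) : ℝ) ≠ 0 := (Real.rpow_pos_of_pos two_pos _).ne'
    have := sqrt_slope_pos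
    field_simp
    rw [pow_succ]
  · rw [hkR]
    ring

theorem totalGoodEmb_isEquivalent_leaf {S : RTree} (h : S.size + S.leaves = 2) :
    (fun n : ℕ => (totalGoodEmb n S : ℝ)) ~[atTop ⊓ 𝓟 {n | Odd n}] fun n : ℕ =>
      √(2 * (2 + slope)) / √Real.pi * √leafSeries.radius ^ (-(n : ℤ)) *
        (n : ℝ) ^ (-(3 / 2) : ℝ) := by
  have hs : 0 < √leafSeries.radius := Real.sqrt_pos.2 radius_pos
  have hsq : √leafSeries.radius ^ 2 = leafSeries.radius := Real.sq_sqrt radius_pos.le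
  have hT := tendsto_coeff_leafSeries
  have hE := ev_unit_pos
  nth_rewrite 1 [← hsq] at hT
  refine isEquivalent_of_tendsto hs (by positivity) hT (fun n hn => ?_) ?_ rfl
  · rw [totalGoodEmb_eq_coeff hn, cls_eq_mk_zero h, TreeClass.goodSeries_leaf, rootSeries]
    ring_nf
  · have h1 := ev_unit_pow 1
    rw [pow_one, pow_one, pow_one, Nat.cast_one] at h1
    have h2 : (2 : ℝ) ^ (-(1 / 2) : ℝ) * 2 ^ (3 / 2 : ℝ) = 2 := by
      rw [← Real.rpow_add two_pos]
      norm_num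
    rw [h1]
    have : √Real.pi ≠ 0 := (Real.sqrt_pos.2 Real.pi_pos).ne'
    field_simp
    linear_combination -√(2 * (2 + leafSeries.slope)) * h2

end RTree

theorem mainTheorem7 :
    ∃ ρ b : ℝ,
      -- numerical values, correct to four decimals
      |ρ - 0.6346| < 0.00005 ∧ |b - 2.5184| < 0.00005 ∧
      -- `ρ` is the radius of convergence of `V`, and `b` is the constant of its expansion at `ρ`
      RTree.binarySeries.radius = ENNReal.ofReal ρ ∧
      (fun z : ℝ => RTree.binarySeries.sum z - (1 / ρ - b * √(1 - z / ρ)))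
        =o[𝓝[<] ρ] (fun z : ℝ => √(1 - z / ρ)) ∧
      ∀ (S : RTree) (m l : ℕ), m = S.size → l = S.leaves →
        -- all embeddings
        ((fun n : ℕ => (RTree.totalEmb n S : ℝ)) ~[atTop ⊓ 𝓟 {n | Odd n}]
          (fun n : ℕ => 2 * S.symmetryConstant * b ^ (-(m : ℤ) - l + 1) * ρ ^ (-(m : ℤ) - l) /
            Real.Gamma (((m : ℝ) + l - 1) / 2) * ρ ^ (-(n : ℤ)) *
            (n : ℝ) ^ (((m : ℝ) + l - 3) / 2))) ∧
        (∀ n : ℕ, Even n → RTree.totalEmb n S = 0) ∧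
        -- good embeddings
        (0 < (m : ℤ) + l - 2 →
          (fun n : ℕ => (RTree.totalGoodEmb n S : ℝ)) ~[atTop ⊓ 𝓟 {n | Odd n}]
            (fun n : ℕ => 2 * S.symmetryConstant * b ^ (-(m : ℤ) - l + 2) *
              ρ ^ (-(m : ℤ) - l + 1) / Real.Gamma (((m : ℝ) + l - 2) / 2) * ρ ^ (-(n : ℤ)) *
              (n : ℝ) ^ (((m : ℝ) + l - 4) / 2))) ∧
        ((m : ℤ) + l - 2 = 0 →
          (fun n : ℕ => (RTree.totalGoodEmb n S : ℝ)) ~[atTop ⊓ 𝓟 {n | Odd n}]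
            (fun n : ℕ => b / √Real.pi * ρ ^ (-(n : ℤ)) * (n : ℝ) ^ (-(3 / 2) : ℝ))) ∧
        (∀ n : ℕ, Even n → RTree.totalGoodEmb n S = 0) := by
  refine ⟨√leafSeries.radius, √(2 * (2 + leafSeries.slope)), leafSeries.abs_sqrt_radius_sub_lt,
    leafSeries.abs_sqrt_slope_sub_lt, RTree.radius_binarySeries, RTree.sum_binarySeries_isLittleO,
    ?_⟩
  rintro S m l rfl rfl
  exact ⟨S.totalEmb_isEquivalent, fun n hn => RTree.totalEmb_of_even hn S,
    fun h => RTree.totalGoodEmb_isEquivalent (by omega),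
    fun h => RTree.totalGoodEmb_isEquivalent_leaf (by omega),
    fun n hn => RTree.totalGoodEmb_of_even hn S⟩
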